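/- **Conventions.** All spaces are Hausdorff and all $C^*$-algebras are commutative (over $\mathbb C$). For a locally compact Hausdorff space $X$ let $\mathcal{B}a_b(X)$ and $\mathcal{B}a_c(X)$ be the $\sigma$-algebras generated by the bounded continuous functions $X\to\mathbb C$, respectively by the compactly supported ones; they coincide if $X$ is compact. A probability measure $\mu$ on a $\sigma$-algebra $\Sigma$ of subsets of $X$ is *Radon* if $\mu(E)=\sup\{\mu(F): F\in\Sigma,\ F\subseteq E,\ F \text{ compact } G_\delta\}$ for all $E\in\Sigma$. A *state* on a $C^*$-algebra $A$ is a bounded linear functional $\tau:A\to\mathbb C$ which is non-negative on non-negative elements and has operator norm $1$. $M(A)$ is the multiplier algebra of $A$. A $*$-homomorphism $\Phi:A\to B$ (resp. $\Phi:A\to M(B)$) is *nondegenerate* if the linear span of $\Phi(A)B$ is dense in $B$; in both cases $\Phi$ extends uniquely to a unital $*$-homomorphism $\mathrm{Mult}(\Phi):M(A)\to M(B)$. **Categories of spaces.** * $\mathbf{CHPrb}$: compact Hausdorff spaces with a Radon probability measure on $\mathcal{B}a_b(X)$; morphisms are the continuous maps $T:X\to Y$ with $T_*\mu_X=\mu_Y$.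 * $\mathbf{CHptPrb}$: the same with a distinguished point; morphisms also preserve the point. * $\mathbf{LCHprPrb}$: locally compact Hausdorff spaces with a Radon probability measure on $\mathcal{B}a_c(X)$; morphisms are the proper continuous maps with $T_*\mu_X=\mu_Y$. * $\mathbf{LCHPrb}$: locally compact Hausdorff spaces with a Radon probability measure on $\mathcal{B}a_b(X)$; morphisms are the continuous maps with $T_*\mu_X=\mu_Y$. **Categories of algebras** (objects are commutative $C^*$-algebras with a state $\tau_A$). * $\mathbf{U}^\tau$: unital algebras; unital $*$-homomorphisms with $\tau_B\circ\Phi=\tau_A$. * $\mathbf{U}_\infty^\tau$: unital algebras with a unital $*$-homomorphism $\infty_A:A\to\mathbb C$; morphisms of $\mathbf U^\tau$ with $\infty_B\circ\Phi=\infty_A$. * $\mathbf{N}^\tau$: possibly non-unital algebras; nondegenerate $*$-homomorphisms $A\to B$ with $\tau_B\circ\Phi=\tau_A$. * $\mathbf{M}^\tau$: possibly non-unital algebras; morphisms $A\to B$ are the nondegenerate $*$-homomorphisms $\Phi:A\to M(B)$ with $\tau_{M(B)}\circ\mathrm{Mult}(\Phi)=\tau_{M(A)}$, where $\tau_{M(A)}$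 is the unique extension of $\tau_A$ to a state of $M(A)$; the composite of $\Phi:A\to M(B)$ and $\Psi:B\to M(C)$ is $\mathrm{Mult}(\Psi)\circ\Phi$, and the identity of $A$ is the inclusion $A\to M(A)$. **Vertical functors.** $C:\mathbf{CHPrb}\to(\mathbf U^\tau)^{op}$, $C:\mathbf{CHptPrb}\to(\mathbf U^\tau_\infty)^{op}$, $C_0:\mathbf{LCHprPrb}\to(\mathbf N^\tau)^{op}$ and $C_0:\mathbf{LCHPrb}\to(\mathbf M^\tau)^{op}$ send $X$ to $C(X)$, respectively $C_0(X)$, with the state $f\mapsto\int f\,d\mu_X$ (and $f\mapsto f(x)$ as $\infty_{C(X)}$ if $x$ is the distinguished point), and $T$ to $f\mapsto f\circ T$, which in the last case is multiplication by a bounded continuous function, an element of $M(C_0(X))$. In the opposite direction $\mathrm{Riesz}$ sends $A$ to the space $\mathrm{Spec}(A)$ of nonzero characters with the pointwise topology (with the distinguished point $\infty_A$ in the case of $\mathbf U^\tau_\infty$), with the unique Radon probability measure $\mu$ such that $\tau_A(a)=\int\lambda(a)\,d\mu(\lambda)$ for all $a\in A$; and it sends $\Phi$ to $\lambda\mapsto\lambda\circ\Phi$,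 where for $\mathbf M^\tau$ the character $\lambda$ of $B$ is first extended to $M(B)$. **Horizontal functors, first diagram.** * $\mathrm{Unit}:\mathbf N^\tau\to\mathbf U^\tau_\infty$, $A\mapsto A\oplus\mathbb C$ with state $a+c\mapsto\tau_A(a)+c$ and homomorphism $a+c\mapsto c$; the forgetful functor $\mathbf N^\tau\to\mathbf M^\tau$; $\mathrm{Mult}:\mathbf M^\tau\to\mathbf U^\tau$, $A\mapsto(M(A),\tau_{M(A)})$, $\Phi\mapsto \mathrm{Mult}(\Phi)$. * $\mathrm{Alex}:\mathbf{LCHprPrb}\to\mathbf{CHptPrb}$, the one-point compactification with the pushforward measure and distinguished point $\infty$; the forgetful functor $\mathbf{LCHprPrb}\to\mathbf{LCHPrb}$, which replaces the measure by its unique extension to a Radon probability measure on $\mathcal{B}a_b(X)$; $\beta:\mathbf{LCHPrb}\to\mathbf{CHPrb}$, the Stone–Čech compactification $\beta X=\mathrm{Spec}(C_b(X))$ with the pushforward measure. * The diagonal functor $C_b:\mathbf{LCHPrb}\to(\mathbf U^\tau)^{op}$, $X\mapsto(C_b(X),\ f\mapsto\int f\,d\mu_X)$. **Horizontal functors, second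 diagram.** The forgetful functors $\mathbf U^\tau_\infty\to\mathbf U^\tau\to\mathbf N^\tau\to\mathbf M^\tau$, $\mathbf U^\tau\to\mathbf M^\tau$ and $\mathbf{CHptPrb}\to\mathbf{CHPrb}\to\mathbf{LCHprPrb}\to\mathbf{LCHPrb}$, $\mathbf{CHPrb}\to\mathbf{LCHPrb}$. **Theorem.** All of these are well-defined categories and functors (in particular the states, measures and extensions named above exist, are unique where this is said, and are preserved by the morphisms named above). Moreover: 1. All eight vertical functors are full and faithful. All horizontal functors and $C_b$ are faithful. The forgetful functors $\mathbf U^\tau\to\mathbf N^\tau$, $\mathbf U^\tau\to\mathbf M^\tau$, $\mathbf{CHPrb}\to\mathbf{LCHprPrb}$ and $\mathbf{CHPrb}\to\mathbf{LCHPrb}$ are also full. 2. Each of the four pairs $(C,\mathrm{Riesz})$, $(C_0,\mathrm{Riesz})$ is a duality of categories: both composites are naturally isomorphic to the identity functors. 3. The first diagram $$\begin{array}{ccccccc}(\mathbf U^\tau_\infty)^{op}&\xleftarrow{\mathrm{Unit}}&(\mathbf N^\tau)^{op}&\longrightarrow&(\mathbf M^\tau)^{op}&\xrightarrow{\mathrm{Mult}}&(\mathbf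 U^\tau)^{op}\\ \updownarrow&&\updownarrow&&\updownarrow&&\updownarrow\\ \mathbf{CHptPrb}&\xleftarrow{\mathrm{Alex}}&\mathbf{LCHprPrb}&\longrightarrow&\mathbf{LCHPrb}&\xrightarrow{\ \beta\ }&\mathbf{CHPrb}\end{array}$$ with the diagonal $C_b:\mathbf{LCHPrb}\to(\mathbf U^\tau)^{op}$, where the vertical arrows are $C$ or $C_0$ upwards and $\mathrm{Riesz}$ downwards, commutes up to natural isomorphism. 4. The second diagram $$\begin{array}{ccccccc}(\mathbf U^\tau_\infty)^{op}&\longrightarrow&(\mathbf U^\tau)^{op}&\longrightarrow&(\mathbf N^\tau)^{op}&\longrightarrow&(\mathbf M^\tau)^{op}\\ \updownarrow&&\updownarrow&&\updownarrow&&\updownarrow\\ \mathbf{CHptPrb}&\longrightarrow&\mathbf{CHPrb}&\longrightarrow&\mathbf{LCHprPrb}&\longrightarrow&\mathbf{LCHPrb}\end{array}$$ with the additional arrows $(\mathbf U^\tau)^{op}\to(\mathbf M^\tau)^{op}$ and $\mathbf{CHPrb}\to\mathbf{LCHPrb}$, and the same vertical functors, commutes up to natural isomorphism. (The two diagrams are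 separate; no commutation between arrows of different diagrams is claimed.) -/

import Mathlib

open CategoryTheory MeasureTheory Filter Topology
open scoped MultiplierAlgebra ComplexOrder ZeroAtInfty CompactlySupported BoundedContinuousFunction

universe u

namespace RieszDuality

noncomputable section

section Multiplier

variable {A B C : Type u} [NonUnitalCommCStarAlgebra A] [NonUnitalCommCStarAlgebra B]
  [NonUnitalCommCStarAlgebra C]

theorem eq_of_forall_mul_eq {x y : A} (h : ∀ c : A, c * x = c * y) : x = y := by
  rw [← sub_eq_zero, ← CStarRing.star_mul_self_eq_zero_iff, mul_sub, h, sub_self]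

theorem mult_fst_mul (m : 𝓜(ℂ, A)) (a b : A) : m.fst (a * b) = m.fst a * b :=
  eq_of_forall_mul_eq fun c => by rw [← m.central, ← mul_assoc, ← mul_assoc, m.central]

theorem mult_fst_mul' (m : 𝓜(ℂ, A)) (a b : A) : m.fst (a * b) = a * m.fst b := by
  rw [mul_comm, mult_fst_mul, mul_comm]

theorem mult_snd_eq_fst (m : 𝓜(ℂ, A)) (a : A) : m.snd a = m.fst a :=
  eq_of_forall_mul_eq fun c => by
    rw [mul_comm, m.central, ← mult_fst_mul', ← mult_fst_mul', mul_comm]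

theorem mult_ext {m n : 𝓜(ℂ, A)} (h : ∀ a, m.fst a = n.fst a) : m = n := by
  refine DoubleCentralizer.ext _ _ _ _ (Prod.ext (ContinuousLinearMap.ext h) ?_)
  exact ContinuousLinearMap.ext fun a => by
    rw [mult_snd_eq_fst, mult_snd_eq_fst, h]

theorem mult_mul_apply (m n : 𝓜(ℂ, A)) (a : A) : (m * n).fst a = m.fst (n.fst a) := rfl

/-- The multiplier algebra of a commutative C⋆-algebra is a unital commutative C⋆-algebra. -/
instance : CommCStarAlgebra 𝓜(ℂ, A) where
  mul_comm m n := mult_ext fun a => eq_of_forall_mul_eq fun c => by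
    rw [mult_mul_apply, mult_mul_apply, ← mult_fst_mul', mult_fst_mul, ← mult_fst_mul' n,
      ← mult_fst_mul' n, ← mult_fst_mul' m, mult_fst_mul m]

/-- The canonical embedding of a commutative C⋆-algebra in its multiplier algebra. -/
abbrev toMult (A : Type u) [NonUnitalCommCStarAlgebra A] : A →⋆ₙₐ[ℂ] 𝓜(ℂ, A) :=
  DoubleCentralizer.coeHom

theorem toMult_fst (a b : A) : (toMult A a).fst b = a * b := rfl

theorem mult_mul_toMult (m : 𝓜(ℂ, A)) (a : A) : m * toMult A a = toMult A (m.fst a) :=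
  mult_ext fun b => by rw [mult_mul_apply, toMult_fst, toMult_fst, mult_fst_mul]

/-- Nondegeneracy of a `*`-homomorphism `Φ : A → B`: the linear span of `Φ(A) B` is dense. -/
def Nondegenerate (Φ : A →⋆ₙₐ[ℂ] B) : Prop :=
  Dense (Submodule.span ℂ {x : B | ∃ a b, x = Φ a * b} : Set B)

/-- Nondegeneracy of a `*`-homomorphism `Φ : A → M(B)`: the linear span of `Φ(A) B` is dense
in `B`. -/
def MultNondegenerate (Φ : A →⋆ₙₐ[ℂ] 𝓜(ℂ, B)) : Prop :=
  Dense (Submodule.span ℂ {x : B | ∃ a b, x = (Φ a).fst b} : Set B)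

theorem multNondegenerate_toMult_comp {Φ : A →⋆ₙₐ[ℂ] B} (h : Nondegenerate Φ) :
    MultNondegenerate ((toMult B).comp Φ) := h

theorem exists_approx_unit (A : Type u) [NonUnitalCommCStarAlgebra A] :
    ∃ l : Filter A, l.NeBot ∧ (∀ᶠ e in l, ‖e‖ ≤ 1) ∧ ∀ a : A, Tendsto (fun e => e * a) l (𝓝 a) := by
  let _ : PartialOrder A := CStarAlgebra.spectralOrder A
  have : StarOrderedRing A := CStarAlgebra.spectralOrderedRing A
  have h := CStarAlgebra.increasingApproximateUnit A
  exact ⟨_, h.neBot, h.eventually_norm, fun a => h.tendsto_mul_right a⟩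

theorem nondegenerate_id : Nondegenerate (NonUnitalStarAlgHom.id ℂ A) := by
  obtain ⟨l, hl, -, h⟩ := exists_approx_unit A
  intro a
  exact mem_closure_of_tendsto (h a) (Eventually.of_forall fun e => Submodule.subset_span ⟨e, a, rfl⟩)

theorem dense_induction {s : Set B} (h : Dense (Submodule.span ℂ s : Set B))
    (V : Submodule ℂ B) (hV : IsClosed (V : Set B)) (hs : s ⊆ V) (b : B) : b ∈ V := by
  have : closure (Submodule.span ℂ s : Set B) ⊆ V :=
    closure_minimal (SetLike.coe_subset_coe.mpr (Submodule.span_le.mpr hs)) hV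
  exact this (h b)

theorem mult_eq_of_fst_eq {Φ : A →⋆ₙₐ[ℂ] 𝓜(ℂ, B)} (h : MultNondegenerate Φ) {x y : B}
    (hxy : ∀ a, (Φ a).fst x = (Φ a).fst y) : x = y := by
  refine eq_of_forall_mul_eq fun c => ?_
  let V : Submodule ℂ B := LinearMap.eqLocus ((LinearMap.mul ℂ B).flip x) ((LinearMap.mul ℂ B).flip y)
  refine dense_induction h V (isClosed_eq (continuous_mul_const x) (continuous_mul_const y)) ?_ c
  rintro _ ⟨a, b, rfl⟩
  change (Φ a).fst b * x = (Φ a).fst b * y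
  rw [← mult_fst_mul, mult_fst_mul', hxy, ← mult_fst_mul', mult_fst_mul]

theorem norm_le_of_fst_eq {Φ : A →⋆ₙₐ[ℂ] 𝓜(ℂ, B)} (h : MultNondegenerate Φ) (m : 𝓜(ℂ, A)) {x y : B}
    (hxy : ∀ a, (Φ a).fst y = (Φ (m.fst a)).fst x) : ‖y‖ ≤ ‖m‖ * ‖x‖ := by
  obtain ⟨l, hl, hl1, hl2⟩ := exists_approx_unit A
  have hΦ : ∀ a b, ‖(Φ a).fst b‖ ≤ ‖a‖ * ‖b‖ := fun a b => by
    refine ((Φ a).fst.le_opNorm b).trans ?_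
    rw [DoubleCentralizer.norm_fst]
    gcongr
    exact NonUnitalStarAlgHom.norm_apply_le Φ a
  have key : ∀ y : B, Tendsto (fun e => (Φ e).fst y) l (𝓝 y) := by
    let V : Submodule ℂ B :=
      { carrier := {y | Tendsto (fun e => (Φ e).fst y) l (𝓝 y)}
        add_mem' := fun {a b} ha hb => by
          simpa using Tendsto.add ha hb
        zero_mem' := by simp
        smul_mem' := fun c x hx => by
          simpa using Tendsto.const_smul hx c }
    refine dense_induction h V ?_ ?_
    · refine isClosed_of_closure_subset fun y hy => ?_
      change Tendsto _ _ _
      rw [Metric.tendsto_nhds]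
      intro ε hε
      obtain ⟨z, hz, hyz⟩ := Metric.mem_closure_iff.mp hy (ε / 3) (by positivity)
      have hz' : Tendsto (fun e => (Φ e).fst z) l (𝓝 z) := hz
      filter_upwards [hl1, Metric.tendsto_nhds.mp hz' (ε / 3) (by positivity)] with e he1 he2
      have h1 : dist ((Φ e).fst y) ((Φ e).fst z) ≤ dist y z := by
        rw [dist_eq_norm, dist_eq_norm, ← map_sub]
        refine (hΦ _ _).trans ?_
        nlinarith [norm_nonneg (y - z)]
      have h2 := dist_triangle4 ((Φ e).fst y) ((Φ e).fst z) z y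
      rw [dist_comm z y] at h2
      linarith
    · rintro _ ⟨a, b, rfl⟩
      have : Tendsto (fun e => (Φ (e * a)).fst b) l (𝓝 ((Φ a).fst b)) := by
        have h1 := hl2 a
        rw [tendsto_iff_norm_sub_tendsto_zero] at h1 ⊢
        refine squeeze_zero (fun _ => norm_nonneg _) (fun e => ?_)
          (by simpa using h1.mul_const ‖b‖)
        have h2 := hΦ (e * a - a) b
        rwa [map_sub] at h2
      refine this.congr fun e => ?_
      rw [map_mul]; rfl
  refine le_of_tendsto (key y).norm ?_
  filter_upwards [hl1] with e he
  rw [hxy]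
  refine (hΦ _ _).trans ?_
  gcongr
  refine (m.fst.le_opNorm e).trans ?_
  rw [DoubleCentralizer.norm_fst]
  nlinarith [norm_nonneg m]

theorem exists_fst_eq {Φ : A →⋆ₙₐ[ℂ] 𝓜(ℂ, B)} (h : MultNondegenerate Φ) (m : 𝓜(ℂ, A)) (x : B) :
    ∃ y : B, ∀ a, (Φ a).fst y = (Φ (m.fst a)).fst x := by
  let S : Submodule ℂ (B × B) :=
    { carrier := {p | ∀ a, (Φ a).fst p.2 = (Φ (m.fst a)).fst p.1}
      add_mem' := fun {p q} hp hq a => by simp [hp a, hq a]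
      zero_mem' := fun a => by simp
      smul_mem' := fun c p hp a => by simp [hp a] }
  have hS : IsClosed (S : Set (B × B)) := by
    have : (S : Set (B × B)) = ⋂ a, {p | (Φ a).fst p.2 = (Φ (m.fst a)).fst p.1} := by
      ext p; simp [S]
    rw [this]
    exact isClosed_iInter fun a => isClosed_eq
      ((Φ a).fst.continuous.comp continuous_snd) ((Φ (m.fst a)).fst.continuous.comp continuous_fst)
  have : CompleteSpace S := hS.completeSpace_coe
  let f : S →L[ℂ] B := (ContinuousLinearMap.fst ℂ B B).comp S.subtypeL
  have hf : AntilipschitzWith (max 1 ‖m‖₊) f := by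
    refine AddMonoidHomClass.antilipschitz_of_bound f fun p => ?_
    have h1 : ‖p.1.2‖ ≤ ‖m‖ * ‖p.1.1‖ := norm_le_of_fst_eq h m p.2
    change max ‖p.1.1‖ ‖p.1.2‖ ≤ max 1 ‖m‖ * ‖p.1.1‖
    refine max_le ?_ (h1.trans ?_)
    · nlinarith [le_max_left 1 ‖m‖, norm_nonneg p.1.1]
    · gcongr; exact le_max_right _ _
  have hr : IsClosed (LinearMap.range f.toLinearMap : Set B) :=
    hf.isClosed_range f.uniformContinuous
  have := dense_induction h (LinearMap.range f.toLinearMap) hr ?_ x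
  · obtain ⟨p, rfl⟩ := this
    exact ⟨p.1.2, p.2⟩
  · rintro _ ⟨a, b, rfl⟩
    refine ⟨⟨((Φ a).fst b, (Φ (m.fst a)).fst b), fun a' => ?_⟩, rfl⟩
    change (Φ a').fst ((Φ (m.fst a)).fst b) = (Φ (m.fst a')).fst ((Φ a).fst b)
    rw [← mult_mul_apply, ← mult_mul_apply, ← map_mul, ← map_mul, ← mult_fst_mul, ← mult_fst_mul']

theorem exists_mult_eq {Φ : A →⋆ₙₐ[ℂ] 𝓜(ℂ, B)} (h : MultNondegenerate Φ) (m : 𝓜(ℂ, A)) :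
    ∃ n : 𝓜(ℂ, B), ∀ a, n * Φ a = Φ (m.fst a) := by
  choose T hT using exists_fst_eq h m
  let L : B →L[ℂ] B := LinearMap.mkContinuous
    { toFun := T
      map_add' := fun x y => mult_eq_of_fst_eq h fun a => by simp [hT]
      map_smul' := fun c x => mult_eq_of_fst_eq h fun a => by simp [hT] } ‖m‖
    fun x => norm_le_of_fst_eq h m (hT x)
  have hL : ∀ x, L x = T x := fun _ => rfl
  have hc : ∀ x y : B, L x * y = x * L y := fun x y => mult_eq_of_fst_eq h fun a => by
    rw [mult_fst_mul, mult_fst_mul', hL, hL, hT, hT, ← mult_fst_mul, mult_fst_mul']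
  refine ⟨⟨(L, L), hc⟩, fun a => mult_ext fun b => ?_⟩
  change T ((Φ a).fst b) = _
  refine mult_eq_of_fst_eq h fun a' => ?_
  rw [hT, ← mult_mul_apply, ← mult_mul_apply, ← map_mul, ← map_mul, ← mult_fst_mul,
    ← mult_fst_mul']

theorem mult_eq_of_mul_eq {Φ : A →⋆ₙₐ[ℂ] 𝓜(ℂ, B)} (h : MultNondegenerate Φ) {m n : 𝓜(ℂ, B)}
    (hmn : ∀ a, m * Φ a = n * Φ a) : m = n :=
  mult_ext fun b => mult_eq_of_fst_eq h fun a => by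
    rw [← mult_mul_apply, ← mult_mul_apply, mul_comm, hmn, mul_comm]

/-- A nondegenerate `*`-homomorphism `Φ : A → M(B)` extends uniquely to a unital
`*`-homomorphism `Mult(Φ) : M(A) → M(B)`. -/
theorem existsUnique_multExt {Φ : A →⋆ₙₐ[ℂ] 𝓜(ℂ, B)} (h : MultNondegenerate Φ) :
    ∃! E : 𝓜(ℂ, A) →⋆ₐ[ℂ] 𝓜(ℂ, B), ∀ a, E (toMult A a) = Φ a := by
  choose E hE using exists_mult_eq h
  refine ⟨
    { toFun := E
      map_one' := mult_eq_of_mul_eq h fun a => by rw [hE, one_mul]; rfl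
      map_mul' := fun m n => mult_eq_of_mul_eq h fun a => by
        rw [hE, mult_mul_apply, mul_assoc, hE, hE]
      map_zero' := mult_eq_of_mul_eq h fun a => by
        rw [hE, zero_mul]; exact map_zero Φ
      map_add' := fun m n => mult_eq_of_mul_eq h fun a => by
        rw [hE, add_mul, hE, hE, ← map_add]; rfl
      commutes' := fun r => mult_eq_of_mul_eq h fun a => by
        rw [hE, Algebra.algebraMap_eq_smul_one, Algebra.algebraMap_eq_smul_one, smul_mul_assoc,
          one_mul, ← map_smul]; rfl
      map_star' := fun m => mult_eq_of_mul_eq h fun a => by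
        rw [hE, mul_comm, ← star_star (Φ a), ← star_mul, ← map_star, hE, ← map_star,
          DoubleCentralizer.star_fst, mult_snd_eq_fst] }, fun a => ?_, ?_⟩
  · exact mult_eq_of_mul_eq h fun b => by
      change E _ * _ = _
      rw [hE, ← map_mul]; rfl
  · intro F hF
    refine StarAlgHom.ext fun m => mult_eq_of_mul_eq h fun a => ?_
    change F m * _ = E m * _
    rw [hE, ← hF, ← map_mul, mult_mul_toMult, hF]

/-- The unital extension `Mult(Φ) : M(A) → M(B)` of a nondegenerate `*`-homomorphism
`Φ : A → M(B)`. -/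
def multExt (Φ : A →⋆ₙₐ[ℂ] 𝓜(ℂ, B)) (h : MultNondegenerate Φ) : 𝓜(ℂ, A) →⋆ₐ[ℂ] 𝓜(ℂ, B) :=
  (existsUnique_multExt h).choose

theorem multExt_toMult (Φ : A →⋆ₙₐ[ℂ] 𝓜(ℂ, B)) (h : MultNondegenerate Φ) (a : A) :
    multExt Φ h (toMult A a) = Φ a :=
  (existsUnique_multExt h).choose_spec.1 a

theorem multExt_unique {Φ : A →⋆ₙₐ[ℂ] 𝓜(ℂ, B)} (h : MultNondegenerate Φ)
    (E : 𝓜(ℂ, A) →⋆ₐ[ℂ] 𝓜(ℂ, B)) (hE : ∀ a, E (toMult A a) = Φ a) : E = multExt Φ h :=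
  (existsUnique_multExt h).choose_spec.2 E hE

theorem multExt_mul (Φ : A →⋆ₙₐ[ℂ] 𝓜(ℂ, B)) (h : MultNondegenerate Φ) (m : 𝓜(ℂ, A)) (a : A) :
    multExt Φ h m * Φ a = Φ (m.fst a) := by
  rw [← multExt_toMult Φ h, ← multExt_toMult Φ h, ← map_mul, mult_mul_toMult]

theorem starHom_continuous {A B : Type*} [NonUnitalCStarAlgebra A] [NonUnitalCStarAlgebra B]
    (Φ : A →⋆ₙₐ[ℂ] B) : Continuous Φ :=
  AddMonoidHomClass.continuous_of_bound Φ 1 fun a => by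
    rw [one_mul]
    exact NonUnitalStarAlgHom.norm_apply_le Φ a

theorem nondegenerate_comp {Φ : A →⋆ₙₐ[ℂ] B} {Ψ : B →⋆ₙₐ[ℂ] C} (hΦ : Nondegenerate Φ)
    (hΨ : Nondegenerate Ψ) : Nondegenerate (Ψ.comp Φ) := by
  intro c
  refine dense_induction hΨ (Submodule.span ℂ _).topologicalClosure
    (Submodule.isClosed_topologicalClosure _) ?_ c
  rintro _ ⟨b, c, rfl⟩
  let V : Submodule ℂ B := (Submodule.span ℂ {x : C | ∃ a c, x = (Ψ.comp Φ) a * c}).topologicalClosure.comap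
    ((LinearMap.mul ℂ C).flip c ∘ₗ (Ψ : B →ₗ[ℂ] C))
  refine dense_induction hΦ V ?_ ?_ b
  · refine (Submodule.isClosed_topologicalClosure _).preimage ?_
    exact (starHom_continuous Ψ).mul continuous_const
  · rintro _ ⟨a, b, rfl⟩
    refine Submodule.le_topologicalClosure _ (Submodule.subset_span ⟨a, Ψ b * c, ?_⟩)
    change Ψ (Φ a * b) * c = Ψ (Φ a) * (Ψ b * c)
    rw [map_mul, mul_assoc]

/-- The composition `Mult(Ψ) ∘ Φ : A → M(C)` of `Φ : A → M(B)` and `Ψ : B → M(C)`. -/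
def multComp (Ψ : B →⋆ₙₐ[ℂ] 𝓜(ℂ, C)) (hΨ : MultNondegenerate Ψ) (Φ : A →⋆ₙₐ[ℂ] 𝓜(ℂ, B)) :
    A →⋆ₙₐ[ℂ] 𝓜(ℂ, C) :=
  ((multExt Ψ hΨ).toNonUnitalStarAlgHom).comp Φ

theorem multComp_apply (Ψ : B →⋆ₙₐ[ℂ] 𝓜(ℂ, C)) (hΨ : MultNondegenerate Ψ)
    (Φ : A →⋆ₙₐ[ℂ] 𝓜(ℂ, B)) (a : A) : multComp Ψ hΨ Φ a = multExt Ψ hΨ (Φ a) := rfl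

theorem multNondegenerate_comp {Ψ : B →⋆ₙₐ[ℂ] 𝓜(ℂ, C)} (hΨ : MultNondegenerate Ψ)
    {Φ : A →⋆ₙₐ[ℂ] 𝓜(ℂ, B)} (hΦ : MultNondegenerate Φ) :
    MultNondegenerate (multComp Ψ hΨ Φ) := by
  intro c
  refine dense_induction hΨ (Submodule.span ℂ _).topologicalClosure
    (Submodule.isClosed_topologicalClosure _) ?_ c
  rintro _ ⟨b, c, rfl⟩
  let ev : 𝓜(ℂ, C) →ₗ[ℂ] C :=
    { toFun := fun m => m.fst c
      map_add' := fun _ _ => rfl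
      map_smul' := fun _ _ => rfl }
  have hev : Continuous ev := by
    refine AddMonoidHomClass.continuous_of_bound ev ‖c‖ fun m => ?_
    rw [mul_comm, ← DoubleCentralizer.norm_fst]
    exact m.fst.le_opNorm c
  let V : Submodule ℂ B := (Submodule.span ℂ
    {x : C | ∃ a c, x = (multComp Ψ hΨ Φ a).fst c}).topologicalClosure.comap (ev ∘ₗ (Ψ : B →ₗ[ℂ] 𝓜(ℂ, C)))
  refine dense_induction hΦ V ?_ ?_ b
  · refine (Submodule.isClosed_topologicalClosure _).preimage ?_
    exact hev.comp (starHom_continuous Ψ)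
  · rintro _ ⟨a, b, rfl⟩
    refine Submodule.le_topologicalClosure _ (Submodule.subset_span ⟨a, (Ψ b).fst c, ?_⟩)
    change (Ψ ((Φ a).fst b)).fst c = _
    rw [multComp_apply, ← mult_mul_apply, multExt_mul]

theorem multExt_id (h : MultNondegenerate (toMult A)) :
    multExt (toMult A) h = StarAlgHom.id ℂ 𝓜(ℂ, A) :=
  (multExt_unique h _ fun _ => rfl).symm

theorem multExt_multComp (Ψ : B →⋆ₙₐ[ℂ] 𝓜(ℂ, C)) (hΨ : MultNondegenerate Ψ)
    (Φ : A →⋆ₙₐ[ℂ] 𝓜(ℂ, B)) (hΦ : MultNondegenerate Φ)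
    (h : MultNondegenerate (multComp Ψ hΨ Φ)) :
    multExt (multComp Ψ hΨ Φ) h = (multExt Ψ hΨ).comp (multExt Φ hΦ) :=
  (multExt_unique h _ fun a => by
    rw [StarAlgHom.comp_apply, multExt_toMult, multComp_apply]).symm

theorem multNondegenerate_toMult (A : Type u) [NonUnitalCommCStarAlgebra A] :
    MultNondegenerate (toMult A) := nondegenerate_id

theorem nondegenerate_of_unital {A B : Type u} [CommCStarAlgebra A] [CommCStarAlgebra B]
    (Φ : A →⋆ₐ[ℂ] B) : Nondegenerate (Φ.toNonUnitalStarAlgHom) := fun b =>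
  subset_closure (Submodule.subset_span ⟨1, b, by
    change b = Φ 1 * b
    rw [map_one, one_mul]⟩)

end Multiplier

section States

/-- A state on a C⋆-algebra: a bounded linear functional which is nonnegative on the nonnegative
elements `star a * a` and has operator norm one. -/
structure IsState {A : Type u} [NonUnitalCommCStarAlgebra A] (τ : A →L[ℂ] ℂ) : Prop where
  nonneg : ∀ a : A, 0 ≤ τ (star a * a)
  norm_eq_one : ‖τ‖ = 1

open Classical in
/-- The extension of a state of `A` to a state of the multiplier algebra `M(A)` (every state has
exactly one; the value is `0` for functionals which have none). -/
def multState {A : Type u} [NonUnitalCommCStarAlgebra A] (τ : A →L[ℂ] ℂ) : 𝓜(ℂ, A) →L[ℂ] ℂ :=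
  if h : ∃ σ : 𝓜(ℂ, A) →L[ℂ] ℂ, IsState σ ∧ ∀ a, σ (toMult A a) = τ a then h.choose else 0

/-- The extension `a + c ↦ τ a + c` of a functional to the unitization. -/
def unitState {A : Type u} [NonUnitalCommCStarAlgebra A] (τ : A →L[ℂ] ℂ) :
    Unitization ℂ A →L[ℂ] ℂ where
  toFun x := x.fst + τ x.snd
  map_add' x y := by simp; ring
  map_smul' c x := by simp; ring
  cont := Unitization.continuous_fst.add (τ.continuous.comp Unitization.continuous_snd)

end States

section Measures

/-- The `σ`-algebra generated by the bounded continuous functions. -/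
@[reducible]
def baireB (X : Type u) [TopologicalSpace X] : MeasurableSpace X :=
  ⨆ f : X →ᵇ ℂ, (borel ℂ).comap f

/-- The `σ`-algebra generated by the compactly supported continuous functions. -/
@[reducible]
def baireC (X : Type u) [TopologicalSpace X] : MeasurableSpace X :=
  ⨆ f : C_c(X, ℂ), (borel ℂ).comap f

/-- A Radon probability measure on the measurable space `(X, m)`: a probability measure which is
inner regular with respect to the measurable compact `Gδ` sets. -/
@[ext]
structure RadonProb (X : Type u) [TopologicalSpace X] (m : MeasurableSpace X) where
  measure : @Measure X m
  prob : IsProbabilityMeasure measure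
  radon : measure.InnerRegularWRT (fun K => MeasurableSet[m] K ∧ IsCompact K ∧ IsGδ K)
    (fun E => MeasurableSet[m] E)

attribute [instance] RadonProb.prob

/-- The map `f` carries `μ` to `ν`. -/
def PreservesPrb {X Y : Type u} [TopologicalSpace X] [TopologicalSpace Y] {mX : MeasurableSpace X}
    {mY : MeasurableSpace Y} (f : X → Y) (μ : RadonProb X mX) (ν : RadonProb Y mY) : Prop :=
  ∀ E, MeasurableSet[mY] E → μ.measure (f ⁻¹' E) = ν.measure E

variable {X Y Z : Type u} [TopologicalSpace X] [TopologicalSpace Y] [TopologicalSpace Z]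

theorem baireB_le_borel : baireB X ≤ borel X := by
  refine iSup_le fun f => ?_
  rw [← measurable_iff_comap_le]
  borelize X
  exact f.continuous.measurable

theorem baireC_le_baireB : baireC X ≤ baireB X := by
  refine iSup_le fun f => ?_
  obtain ⟨C, hC⟩ := f.hasCompactSupport.exists_bound_of_continuous f.continuous
  exact le_iSup (fun f : X →ᵇ ℂ => (borel ℂ).comap f) (BoundedContinuousFunction.ofNormedAddCommGroup f f.continuous C hC)

theorem baireC_eq_baireB [CompactSpace X] : baireB X = baireC X := by
  refine le_antisymm (iSup_le fun f => ?_) baireC_le_baireB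
  exact le_iSup (fun f : C_c(X, ℂ) => (borel ℂ).comap f)
    ⟨f.toContinuousMap, HasCompactSupport.of_compactSpace _⟩

theorem measurable_baireB (f : X →ᵇ ℂ) : Measurable[baireB X] f :=
  measurable_iff_comap_le.mpr ((le_of_eq (by rw [BorelSpace.measurable_eq (α := ℂ)])).trans
    (le_iSup (fun f : X →ᵇ ℂ => (borel ℂ).comap f) f))

theorem measurable_baireC (f : C_c(X, ℂ)) : Measurable[baireC X] f :=
  measurable_iff_comap_le.mpr ((le_of_eq (by rw [BorelSpace.measurable_eq (α := ℂ)])).trans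
    (le_iSup (fun f : C_c(X, ℂ) => (borel ℂ).comap f) f))

theorem measurable_to_baireB {X : Type u} {m : MeasurableSpace X} {T : X → Y}
    (h : ∀ f : Y →ᵇ ℂ, Measurable[m] (f ∘ T)) : Measurable[m, baireB Y] T := by
  rw [measurable_iff_comap_le, baireB, MeasurableSpace.comap_iSup]
  refine iSup_le fun f => ?_
  rw [MeasurableSpace.comap_comp, ← measurable_iff_comap_le]
  have := h f
  rwa [BorelSpace.measurable_eq (α := ℂ)] at this

theorem measurable_continuousMap (T : C(X, Y)) : Measurable[baireB X, baireB Y] T :=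
  measurable_to_baireB fun f => measurable_baireB (f.compContinuous T)

theorem measurable_proper (T : C(X, Y)) [T2Space Y] (hT : ∀ K, IsCompact K → IsCompact (T ⁻¹' K)) :
    Measurable[baireC X, baireC Y] T := by
  rw [measurable_iff_comap_le, baireC.eq_def Y, MeasurableSpace.comap_iSup]
  refine iSup_le fun f => ?_
  rw [MeasurableSpace.comap_comp]
  refine le_iSup (fun f : C_c(X, ℂ) => (borel ℂ).comap f)
    ⟨f.toContinuousMap.comp T, ?_⟩
  refine HasCompactSupport.intro' (hT _ f.hasCompactSupport)
    ((isClosed_tsupport f).preimage T.continuous) fun x hx => ?_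
  exact image_eq_zero_of_notMem_tsupport (f := f) hx

theorem measurable_zeroAtInfty (f : C₀(X, ℂ)) : Measurable[baireC X] f := by
  let g : ℕ → C(X, ℂ) := fun n =>
    ⟨fun x => ((max (‖f x‖ - 1 / (n + 1 : ℝ)) 0 / max ‖f x‖ (1 / (n + 1 : ℝ)) : ℝ) : ℂ) * f x, by
      have h1 : ∀ x, max ‖f x‖ (1 / (n + 1 : ℝ)) ≠ 0 := fun x =>
        (lt_max_of_lt_right (by positivity)).ne'
      fun_prop (disch := exact h1)⟩
  have hg : ∀ n, HasCompactSupport (g n) := by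
    intro n
    have h0 : (0 : ℝ) < 1 / (n + 1 : ℝ) := by positivity
    have h1 := f.zero_at_infty'
    rw [Metric.tendsto_nhds] at h1
    have h2 := h1 _ h0
    rw [Filter.Eventually, Filter.mem_cocompact] at h2
    obtain ⟨K, hK, hKs⟩ := h2
    have hc : IsClosed {x | 1 / (n + 1 : ℝ) ≤ ‖f x‖} :=
      isClosed_le continuous_const f.continuous.norm
    refine HasCompactSupport.intro' (hK.of_isClosed_subset hc fun x hx => ?_) hc fun x hx => ?_
    · by_contra hxK
      have := hKs hxK
      simp only [Set.mem_ofPred_eq, dist_zero_right] at this hx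
      exact absurd this (not_lt.mpr hx)
    · simp only [Set.mem_ofPred_eq, not_le] at hx
      change ((max (‖f x‖ - 1 / (n + 1 : ℝ)) 0 / max ‖f x‖ (1 / (n + 1 : ℝ)) : ℝ) : ℂ) * f x = 0
      rw [max_eq_right (by linarith)]
      simp
  refine @measurable_of_tendsto_metrizable X ℂ (baireC X) _ _ _ _ (fun n => g n) f
    (fun n => measurable_baireC ⟨g n, hg n⟩) ?_
  rw [tendsto_pi_nhds]
  intro x
  rcases eq_or_ne (f x) 0 with h | h
  · refine tendsto_const_nhds.congr fun n => ?_
    change f x = _ * f x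
    rw [h, mul_zero]
  have h3 : Tendsto (fun n : ℕ => 1 / ((n : ℝ) + 1)) atTop (𝓝 0) :=
    tendsto_one_div_add_atTop_nhds_zero_nat
  have h4 : 0 < ‖f x‖ := norm_pos_iff.mpr h
  have h5 : Tendsto (fun n : ℕ => max (‖f x‖ - 1 / ((n : ℝ) + 1)) 0 / max ‖f x‖ (1 / ((n : ℝ) + 1)))
      atTop (𝓝 (max (‖f x‖ - 0) 0 / max ‖f x‖ 0)) :=
    ((tendsto_const_nhds.sub h3).max tendsto_const_nhds).div (tendsto_const_nhds.max h3)
      (by rw [max_eq_left h4.le]; exact h4.ne')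
  rw [sub_zero, max_eq_left h4.le, div_self h4.ne'] at h5
  have h6 := ((Complex.continuous_ofReal.tendsto _).comp h5).mul_const (f x)
  rw [Complex.ofReal_one, one_mul] at h6
  exact h6

end Measures

section Functionals

variable {X Y Z : Type u} [TopologicalSpace X] [TopologicalSpace Y] [TopologicalSpace Z]

theorem integral_preserves {mX : MeasurableSpace X} {mY : MeasurableSpace Y} {T : X → Y}
    {μ : RadonProb X mX} {ν : RadonProb Y mY} (h : PreservesPrb T μ ν) (hT : Measurable T)
    {f : Y → ℂ} (hf : Measurable f) : ∫ x, f (T x) ∂μ.measure = ∫ y, f y ∂ν.measure := by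
  have : μ.measure.map T = ν.measure := Measure.ext fun E hE => by rw [Measure.map_apply hT hE, h E hE]
  rw [← this, integral_map hT.aemeasurable hf.stronglyMeasurable.aestronglyMeasurable]

/-- Integration against a probability measure, as a bounded functional on a normed space `E` of
bounded measurable functions. -/
def integralCLM {X E : Type u} [NormedAddCommGroup E] [NormedSpace ℂ E] {m : MeasurableSpace X}
    (μ : Measure X) [IsProbabilityMeasure μ] (ev : E →ₗ[ℂ] (X → ℂ)) (hm : ∀ e, Measurable (ev e))
    (hb : ∀ e x, ‖ev e x‖ ≤ ‖e‖) : E →L[ℂ] ℂ :=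
  have hi : ∀ e, Integrable (ev e) μ := fun e =>
    Integrable.of_bound (hm e).stronglyMeasurable.aestronglyMeasurable ‖e‖
      (Eventually.of_forall (hb e))
  LinearMap.mkContinuous
    { toFun := fun e => ∫ x, ev e x ∂μ
      map_add' := fun e f => by
        rw [map_add]
        exact integral_add (hi e) (hi f)
      map_smul' := fun c e => by
        rw [map_smul]
        exact integral_const_mul c _ } 1
    fun e => by
      rw [one_mul]
      exact (norm_integral_le_of_norm_le_const (Eventually.of_forall (hb e))).trans (by simp)

theorem integralCLM_norm_le {X E : Type u} [NormedAddCommGroup E] [NormedSpace ℂ E]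
    {m : MeasurableSpace X} (μ : Measure X) [IsProbabilityMeasure μ] (ev : E →ₗ[ℂ] (X → ℂ))
    (hm : ∀ e, Measurable (ev e)) (hb : ∀ e x, ‖ev e x‖ ≤ ‖e‖) :
    ‖integralCLM μ ev hm hb‖ ≤ 1 :=
  LinearMap.mkContinuous_norm_le _ zero_le_one fun e => by
    rw [one_mul]
    exact (norm_integral_le_of_norm_le_const (Eventually.of_forall (hb e))).trans (by simp)

theorem integral_star_mul_nonneg {X : Type u} {m : MeasurableSpace X} (μ : Measure X) (f : X → ℂ) :
    0 ≤ ∫ x, star (f x) * f x ∂μ :=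
  integral_nonneg fun x => star_mul_self_nonneg (f x)

/-- The functional `f ↦ ∫ f dμ` on `C(X)`, for compact `X`. -/
def intC [CompactSpace X] (μ : RadonProb X (baireB X)) : C(X, ℂ) →L[ℂ] ℂ :=
  integralCLM μ.measure (ContinuousMap.coeFnLinearMap ℂ)
    (fun f => measurable_baireB (BoundedContinuousFunction.mkOfCompact f))
    (fun f x => f.norm_coe_le_norm x)

/-- The functional `f ↦ ∫ f dμ` on `C_b(X)`. -/
def intCb (μ : RadonProb X (baireB X)) : (X →ᵇ ℂ) →L[ℂ] ℂ :=
  integralCLM μ.measure { toFun := fun f => f, map_add' := fun _ _ => rfl, map_smul' := fun _ _ => rfl }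
    measurable_baireB (fun f x => f.norm_coe_le_norm x)

theorem norm_zeroAtInfty_le (f : C₀(X, ℂ)) (x : X) : ‖f x‖ ≤ ‖f‖ := by
  rw [← ZeroAtInftyContinuousMap.norm_toBCF_eq_norm]
  exact f.toBCF.norm_coe_le_norm x

/-- The functional `f ↦ ∫ f dμ` on `C₀(X)`, for `μ` defined on any `σ`-algebra containing `baireC X`
(such as `baireC X` or `baireB X`). -/
def intC0 {m : MeasurableSpace X} (hm : baireC X ≤ m) (μ : RadonProb X m) : C₀(X, ℂ) →L[ℂ] ℂ :=
  integralCLM μ.measure { toFun := fun f => f, map_add' := fun _ _ => rfl, map_smul' := fun _ _ => rfl }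
    (fun f => (measurable_zeroAtInfty f).mono hm le_rfl) norm_zeroAtInfty_le

theorem intC_apply [CompactSpace X] (μ : RadonProb X (baireB X)) (f : C(X, ℂ)) :
    intC μ f = ∫ x, f x ∂μ.measure := rfl

theorem intCb_apply (μ : RadonProb X (baireB X)) (f : X →ᵇ ℂ) :
    intCb μ f = ∫ x, f x ∂μ.measure := rfl

theorem intC0_apply {m : MeasurableSpace X} (hm : baireC X ≤ m) (μ : RadonProb X m) (f : C₀(X, ℂ)) :
    intC0 hm μ f = ∫ x, f x ∂μ.measure := rfl

theorem nonempty_of_radonProb {m : MeasurableSpace X} (μ : RadonProb X m) : Nonempty X :=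
  μ.measure.nonempty_of_neZero

theorem intC_isState [CompactSpace X] (μ : RadonProb X (baireB X)) : IsState (intC μ) := by
  refine ⟨fun a => integral_star_mul_nonneg μ.measure a, le_antisymm (integralCLM_norm_le _ _ _ _) ?_⟩
  have := nonempty_of_radonProb μ
  have h := (intC μ).le_opNorm 1
  rw [intC_apply] at h
  simpa using h

theorem intCb_isState (μ : RadonProb X (baireB X)) : IsState (intCb μ) := by
  refine ⟨fun a => integral_star_mul_nonneg μ.measure a, le_antisymm (integralCLM_norm_le _ _ _ _) ?_⟩
  have := nonempty_of_radonProb μ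
  have h := (intCb μ).le_opNorm 1
  rw [intCb_apply] at h
  simpa using h

theorem exists_cutoff [LocallyCompactSpace X] [T2Space X] {K : Set X} (hK : IsCompact K) :
    ∃ e : C₀(X, ℂ), ∃ r : X → ℝ, (∀ x, e x = r x) ∧ (∀ x, 0 ≤ r x) ∧ (∀ x, r x ≤ 1) ∧ ∀ x ∈ K, r x = 1 := by
  obtain ⟨f, h1, -, h2, h3⟩ := exists_continuous_one_zero_of_isCompact hK isClosed_empty
    (Set.disjoint_empty K)
  refine ⟨⟨⟨fun x => (f x : ℂ), by fun_prop⟩, ?_⟩, f, fun _ => rfl, fun x => (h3 x).1,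
    fun x => (h3 x).2, h1⟩
  have h4 : HasCompactSupport fun x => (f x : ℂ) := h2.comp_left (g := fun r : ℝ => (r : ℂ)) rfl
  exact h4.is_zero_at_infty

theorem norm_zeroAtInfty_le_iff (f : C₀(X, ℂ)) {C : ℝ} (hC : 0 ≤ C) (h : ∀ x, ‖f x‖ ≤ C) :
    ‖f‖ ≤ C := by
  rw [← ZeroAtInftyContinuousMap.norm_toBCF_eq_norm]
  exact (BoundedContinuousFunction.norm_le hC).mpr h

theorem intC0_isState [LocallyCompactSpace X] [T2Space X] {m : MeasurableSpace X}
    (hm : baireC X ≤ m) (μ : RadonProb X m) : IsState (intC0 hm μ) := by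
  refine ⟨fun a => integral_star_mul_nonneg μ.measure a, le_antisymm (integralCLM_norm_le _ _ _ _) ?_⟩
  refine le_of_forall_lt fun c hc => ?_
  obtain ⟨d, hcd, hd⟩ := exists_between (max_lt hc zero_lt_one)
  obtain ⟨K, -, ⟨hKm, hK, -⟩, hdK⟩ := μ.radon (MeasurableSet.univ) (ENNReal.ofReal d) (by
    rw [measure_univ]
    exact ENNReal.ofReal_lt_one.mpr hd)
  obtain ⟨e, r, he, hr0, hr1, hrK⟩ := exists_cutoff hK
  have he1 : ‖e‖ ≤ 1 := norm_zeroAtInfty_le_iff e zero_le_one fun x => by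
    rw [he, Complex.norm_real, Real.norm_of_nonneg (hr0 x)]
    exact hr1 x
  have hrm : Measurable r := by
    have h : Measurable fun x => (e x).re :=
      Complex.measurable_re.comp ((measurable_zeroAtInfty e).mono hm le_rfl)
    simpa [he] using h
  have hri : Integrable r μ.measure := Integrable.of_bound hrm.aestronglyMeasurable 1
    (Eventually.of_forall fun x => by rw [Real.norm_of_nonneg (hr0 x)]; exact hr1 x)
  have h1 : intC0 hm μ e = ((∫ x, r x ∂μ.measure : ℝ) : ℂ) := by
    rw [intC0_apply, ← integral_complex_ofReal]
    exact integral_congr_ae (Eventually.of_forall he)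
  have h2 : μ.measure.real K ≤ ∫ x, r x ∂μ.measure := by
    rw [← integral_indicator_one hKm]
    refine integral_mono ((integrable_const (1 : ℝ)).indicator hKm) hri fun x => ?_
    by_cases hx : x ∈ K
    · simp [hx, hrK x hx]
    · simpa [hx] using hr0 x
  have hd0 : 0 ≤ d := (le_max_right c 0).trans hcd.le
  have h3 : d < μ.measure.real K := by
    rw [Measure.real, ← ENNReal.toReal_ofReal hd0]
    exact (ENNReal.toReal_lt_toReal ENNReal.ofReal_ne_top (measure_ne_top _ _)).mpr hdK
  have h4 := (intC0 hm μ).le_opNorm e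
  rw [h1, Complex.norm_real, Real.norm_eq_abs] at h4
  have h5 := le_abs_self (∫ x, r x ∂μ.measure)
  have h6 : ‖intC0 hm μ‖ * ‖e‖ ≤ ‖intC0 hm μ‖ * 1 := by gcongr
  have h7 := le_max_left c 0
  linarith

/-- The product of a bounded continuous function and a function vanishing at infinity. -/
def bcfMulC0 (h : X →ᵇ ℂ) (f : C₀(X, ℂ)) : C₀(X, ℂ) where
  toContinuousMap := h.toContinuousMap * f.toContinuousMap
  zero_at_infty' := by
    have h1 : Tendsto (fun x => ‖h‖ * ‖f x‖) (cocompact X) (𝓝 0) := by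
      simpa using f.zero_at_infty'.norm.const_mul ‖h‖
    refine squeeze_zero_norm (fun x => ?_) h1
    change ‖h x * f x‖ ≤ _
    rw [norm_mul]
    gcongr
    exact h.norm_coe_le_norm x

theorem bcfMulC0_apply (h : X →ᵇ ℂ) (f : C₀(X, ℂ)) (x : X) : bcfMulC0 h f x = h x * f x := rfl

/-- Multiplication by a bounded continuous function, as a bounded operator on `C₀(X)`. -/
def bcfMulCLM (h : X →ᵇ ℂ) : C₀(X, ℂ) →L[ℂ] C₀(X, ℂ) :=
  LinearMap.mkContinuous
    { toFun := bcfMulC0 h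
      map_add' := fun f g => ZeroAtInftyContinuousMap.ext fun x => mul_add _ _ _
      map_smul' := fun c f => ZeroAtInftyContinuousMap.ext fun x => mul_left_comm _ _ _ } ‖h‖
    fun f => norm_zeroAtInfty_le_iff _ (by positivity) fun x => by
      change ‖h x * f x‖ ≤ _
      rw [norm_mul]
      gcongr
      · exact h.norm_coe_le_norm x
      · exact norm_zeroAtInfty_le f x

/-- The canonical `*`-homomorphism `C_b(X) → M(C₀(X))`. -/
def bcfMult (X : Type u) [TopologicalSpace X] : (X →ᵇ ℂ) →⋆ₐ[ℂ] 𝓜(ℂ, C₀(X, ℂ)) where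
  toFun h :=
    { fst := bcfMulCLM h
      snd := bcfMulCLM h
      central := fun f g => ZeroAtInftyContinuousMap.ext fun x => by
        change h x * f x * g x = f x * (h x * g x)
        ring }
  map_one' := mult_ext fun f => ZeroAtInftyContinuousMap.ext fun x => one_mul _
  map_zero' := mult_ext fun f => ZeroAtInftyContinuousMap.ext fun x => zero_mul _
  map_mul' h k := mult_ext fun f => ZeroAtInftyContinuousMap.ext fun x => mul_assoc _ _ _
  map_add' h k := mult_ext fun f => ZeroAtInftyContinuousMap.ext fun x => add_mul _ _ _
  commutes' c := mult_ext fun f => ZeroAtInftyContinuousMap.ext fun x => by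
    rw [Algebra.algebraMap_eq_smul_one, Algebra.algebraMap_eq_smul_one]
    change (c • (1 : ℂ)) * f x = c • f x
    rw [smul_mul_assoc, one_mul]
  map_star' h := mult_ext fun f => ZeroAtInftyContinuousMap.ext fun x => by
    rw [DoubleCentralizer.star_fst]
    change star (h x) * f x = star (h x * star (f x))
    rw [star_mul', star_star]

theorem bcfMult_fst (h : X →ᵇ ℂ) (f : C₀(X, ℂ)) (x : X) :
    (bcfMult X h).fst f x = h x * f x := rfl

theorem bcfMult_toBCF (f : C₀(X, ℂ)) : bcfMult X f.toBCF = toMult C₀(X, ℂ) f :=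
  mult_ext fun _ => rfl

/-- Pullback `f ↦ f ∘ T` along a continuous proper map, from `C₀(Y)` to `C₀(X)`. -/
def c0Comp [T2Space Y] (T : C(X, Y)) (hT : ∀ K, IsCompact K → IsCompact (T ⁻¹' K)) :
    C₀(Y, ℂ) →⋆ₙₐ[ℂ] C₀(X, ℂ) where
  toFun f := f.comp
    { toFun := T
      continuous_toFun := T.continuous
      cocompact_tendsto' := CocompactMap.tendsto_of_forall_preimage hT }
  map_smul' _ _ := rfl
  map_zero' := rfl
  map_add' _ _ := rfl
  map_mul' _ _ := rfl
  map_star' _ := rfl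

/-- Pullback `f ↦ f ∘ T` along a continuous map, from `C₀(Y)` to `M(C₀(X))`. -/
def c0MultComp (T : C(X, Y)) : C₀(Y, ℂ) →⋆ₙₐ[ℂ] 𝓜(ℂ, C₀(X, ℂ)) where
  toFun f := bcfMult X (f.toBCF.compContinuous T)
  map_smul' c f := map_smul (bcfMult X) c (f.toBCF.compContinuous T)
  map_zero' := map_zero (bcfMult X)
  map_add' f g := map_add (bcfMult X) (f.toBCF.compContinuous T) (g.toBCF.compContinuous T)
  map_mul' f g := map_mul (bcfMult X) (f.toBCF.compContinuous T) (g.toBCF.compContinuous T)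
  map_star' f := map_star (bcfMult X) (f.toBCF.compContinuous T)

theorem c0MultComp_apply (T : C(X, Y)) (f : C₀(Y, ℂ)) :
    c0MultComp T f = bcfMult X (f.toBCF.compContinuous T) := rfl

theorem c0MultComp_nondegenerate [LocallyCompactSpace Y] [T2Space Y] (T : C(X, Y)) :
    MultNondegenerate (c0MultComp T) := by
  intro b
  rw [Metric.mem_closure_iff]
  intro ε hε
  have h1 := b.zero_at_infty'
  rw [Metric.tendsto_nhds] at h1
  have h2 := h1 (ε / 2) (by positivity)
  rw [Filter.Eventually, Filter.mem_cocompact] at h2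
  obtain ⟨K, hK, hKs⟩ := h2
  obtain ⟨e, r, he, hr0, hr1, hrK⟩ := exists_cutoff (hK.image T.continuous)
  refine ⟨(c0MultComp T e).fst b, Submodule.subset_span ⟨e, b, rfl⟩, ?_⟩
  rw [dist_eq_norm]
  refine (norm_zeroAtInfty_le_iff _ (by positivity : 0 ≤ ε / 2) fun x => ?_).trans_lt (by linarith)
  change ‖b x - e (T x) * b x‖ ≤ ε / 2
  rw [he]
  by_cases hx : x ∈ K
  · rw [hrK _ ⟨x, hx, rfl⟩]
    simp only [Complex.ofReal_one, one_mul, sub_self, norm_zero]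
    positivity
  · have h3 : ‖b x‖ < ε / 2 := by simpa using hKs hx
    have h4 : b x - (r (T x) : ℂ) * b x = ((1 - r (T x) : ℝ) : ℂ) * b x := by push_cast; ring
    rw [h4, norm_mul, Complex.norm_real, Real.norm_of_nonneg (by linarith [hr1 (T x)])]
    nlinarith [hr0 (T x), hr1 (T x), norm_nonneg (b x)]

theorem c0Comp_nondegenerate [LocallyCompactSpace Y] [T2Space Y] (T : C(X, Y))
    (hT : ∀ K, IsCompact K → IsCompact (T ⁻¹' K)) : Nondegenerate (c0Comp T hT) :=
  c0MultComp_nondegenerate T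

theorem multExt_c0MultComp [LocallyCompactSpace Y] [T2Space Y] (T : C(X, Y)) (h : Y →ᵇ ℂ) :
    multExt (c0MultComp T) (c0MultComp_nondegenerate T) (bcfMult Y h) =
      bcfMult X (h.compContinuous T) := by
  refine mult_eq_of_mul_eq (c0MultComp_nondegenerate T) fun a => ?_
  rw [multExt_mul, c0MultComp_apply, c0MultComp_apply, ← map_mul]
  rfl

theorem c0MultComp_id : c0MultComp (ContinuousMap.id X) = toMult C₀(X, ℂ) :=
  NonUnitalStarAlgHom.ext fun f => bcfMult_toBCF f

theorem c0MultComp_comp [LocallyCompactSpace Y] [T2Space Y] (S : C(Y, Z)) (T : C(X, Y)) :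
    c0MultComp (S.comp T) = multComp (c0MultComp T) (c0MultComp_nondegenerate T) (c0MultComp S) :=
  NonUnitalStarAlgHom.ext fun f => (multExt_c0MultComp T (f.toBCF.compContinuous S)).symm

end Functionals

section Spectrum

variable {A B C : Type u} [NonUnitalCommCStarAlgebra A] [NonUnitalCommCStarAlgebra B]
  [NonUnitalCommCStarAlgebra C]

/-- The Gelfand spectrum: the nonzero characters, with the topology of pointwise convergence. -/
abbrev Spec (A : Type u) [NonUnitalCommCStarAlgebra A] : Type u := WeakDual.characterSpace ℂ A

theorem spec_norm_le (φ : Spec A) (a : A) : ‖φ a‖ ≤ ‖a‖ := by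
  have h := AlgHom.norm_apply_le_self
    (Unitization.lift (WeakDual.CharacterSpace.toNonUnitalAlgHom φ)) (a : Unitization ℂ A)
  rw [Unitization.norm_inr] at h
  simpa [Unitization.lift] using h

theorem isCompact_spec_union_zero (A : Type u) [NonUnitalCommCStarAlgebra A] :
    IsCompact (WeakDual.characterSpace ℂ A ∪ {0}) := by
  refine (WeakDual.isCompact_closedBall (𝕜 := ℂ) (E := A) 0 1).of_isClosed_subset
    (WeakDual.CharacterSpace.union_zero_isClosed ℂ A) ?_
  rintro φ (h | h)
  · refine mem_closedBall_zero_iff.mpr (ContinuousLinearMap.opNorm_le_bound _ zero_le_one fun a => ?_)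
    rw [one_mul]
    exact spec_norm_le ⟨φ, h⟩ a
  · rw [Set.mem_singleton_iff.mp h]
    change (0 : StrongDual ℂ A) ∈ Metric.closedBall (0 : StrongDual ℂ A) 1
    simp

instance : T2Space (Spec A) := inferInstance

instance : LocallyCompactSpace (Spec A) := by
  have h1 : CompactSpace ↥(WeakDual.characterSpace ℂ A ∪ {0}) :=
    isCompact_iff_compactSpace.mp (isCompact_spec_union_zero A)
  let i : Spec A → ↥(WeakDual.characterSpace ℂ A ∪ {0}) := Set.inclusion Set.subset_union_left
  have h2 : Topology.IsEmbedding i := Topology.IsEmbedding.inclusion Set.subset_union_left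
  have h3 : IsOpen (Set.range i) := by
    have : Set.range i =
        {φ : ↥(WeakDual.characterSpace ℂ A ∪ {0}) | (φ : WeakDual ℂ A) ≠ 0} := by
      ext φ
      constructor
      · rintro ⟨ψ, rfl⟩
        exact ψ.2.1
      · intro h
        rcases φ.2 with h' | h'
        · exact ⟨⟨φ, h'⟩, rfl⟩
        · exact absurd h' h
    rw [this]
    exact isOpen_ne_fun continuous_subtype_val continuous_const
  exact (Topology.IsOpenEmbedding.mk h2 h3).locallyCompactSpace

theorem continuous_spec_apply (a : A) : Continuous fun φ : Spec A => φ a :=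
  (WeakDual.eval_continuous a).comp continuous_subtype_val

theorem continuous_to_spec {X : Type*} [TopologicalSpace X] {T : X → Spec A}
    (h : ∀ a, Continuous fun x => T x a) : Continuous T :=
  Continuous.subtype_mk (WeakDual.continuous_of_continuous_eval h) _

theorem spec_exists_ne_zero (φ : Spec A) : ∃ a, φ a ≠ 0 := by
  by_contra! h
  exact φ.2.1 (ContinuousLinearMap.ext h)

theorem spec_map_mul (φ : Spec A) (a b : A) : φ (a * b) = φ a * φ b := φ.2.2 a b

/-- `Spec(Φ)`: the character `λ ∘ Φ` of `A`, for a nondegenerate `Φ : A → B`. -/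
def specMap (Φ : A →⋆ₙₐ[ℂ] B) (h : Nondegenerate Φ) : C(Spec B, Spec A) where
  toFun φ :=
    ⟨(φ : WeakDual ℂ B).comp (⟨(Φ : A →ₗ[ℂ] B), starHom_continuous Φ⟩ : A →L[ℂ] B), by
      intro h0
      refine φ.2.1 (ContinuousLinearMap.ext fun b => ?_)
      refine dense_induction h (LinearMap.ker (φ : WeakDual ℂ B).toLinearMap)
        (φ : WeakDual ℂ B).isClosed_ker ?_ b
      rintro _ ⟨a, b, rfl⟩
      have h1 : φ (Φ a) = 0 := DFunLike.congr_fun h0 a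
      change φ (Φ a * b) = 0
      rw [spec_map_mul, h1, zero_mul], fun a b => by
      change φ (Φ (a * b)) = φ (Φ a) * φ (Φ b)
      rw [map_mul, spec_map_mul]⟩
  continuous_toFun := continuous_to_spec fun a => continuous_spec_apply (Φ a)

theorem specMap_apply (Φ : A →⋆ₙₐ[ℂ] B) (h : Nondegenerate Φ) (φ : Spec B) (a : A) :
    specMap Φ h φ a = φ (Φ a) := rfl

theorem specMap_proper (Φ : A →⋆ₙₐ[ℂ] B) (h : Nondegenerate Φ) (K : Set (Spec A))
    (hK : IsCompact K) : IsCompact (specMap Φ h ⁻¹' K) := by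
  let F : WeakDual ℂ B → WeakDual ℂ A :=
    fun φ => φ.comp (⟨(Φ : A →ₗ[ℂ] B), starHom_continuous Φ⟩ : A →L[ℂ] B)
  have hF : Continuous F := WeakDual.continuous_of_continuous_eval fun a => WeakDual.eval_continuous (Φ a)
  have hK' : IsClosed ((↑) '' K : Set (WeakDual ℂ A)) := (hK.image continuous_subtype_val).isClosed
  rw [Subtype.isCompact_iff]
  refine ((isCompact_spec_union_zero B).inter_right (hK'.preimage hF)).of_isClosed_subset ?_ ?_
  · have : ((↑) '' (specMap Φ h ⁻¹' K) : Set (WeakDual ℂ B)) =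
        (WeakDual.characterSpace ℂ B ∪ {0}) ∩ F ⁻¹' ((↑) '' K) := by
      ext φ
      constructor
      · rintro ⟨φ, hφ, rfl⟩
        exact ⟨Or.inl φ.2, ⟨_, hφ, rfl⟩⟩
      · rintro ⟨h1 | h1, ψ, hψ, h2⟩
        · exact ⟨⟨φ, h1⟩, by
            have : specMap Φ h ⟨φ, h1⟩ = ψ := Subtype.ext h2.symm
            rwa [Set.mem_preimage, this], rfl⟩
        · refine absurd ?_ ψ.2.1
          rw [h2, Set.mem_singleton_iff.mp h1]
          rfl
    rw [this]
    exact (WeakDual.CharacterSpace.union_zero_isClosed ℂ B).inter (hK'.preimage hF)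
  · rintro _ ⟨φ, hφ, rfl⟩
    exact ⟨Or.inl φ.2, ⟨_, hφ, rfl⟩⟩

/-- The value at `m` of the extension of the character `φ` of `B` to the multiplier algebra
`M(B)`: the quotient `φ (m b) / φ b`, which does not depend on the choice of `b` with `φ b ≠ 0`. -/
def specEval (φ : Spec B) (m : 𝓜(ℂ, B)) : ℂ :=
  φ (m.fst (spec_exists_ne_zero φ).choose) / φ (spec_exists_ne_zero φ).choose

theorem specEval_mul (φ : Spec B) (m : 𝓜(ℂ, B)) (b : B) : specEval φ m * φ b = φ (m.fst b) := by
  have h := (spec_exists_ne_zero φ).choose_spec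
  rw [specEval, div_mul_eq_mul_div, div_eq_iff h, ← spec_map_mul, ← spec_map_mul, ← mult_fst_mul,
    ← mult_fst_mul, mul_comm]

theorem specEval_eq {φ : Spec B} {m : 𝓜(ℂ, B)} {b : B} (hb : φ b ≠ 0) {z : ℂ}
    (h : z * φ b = φ (m.fst b)) : specEval φ m = z := by
  rw [← specEval_mul] at h
  exact (mul_right_cancel₀ hb h).symm

theorem specEval_map_mul (φ : Spec B) (m n : 𝓜(ℂ, B)) :
    specEval φ (m * n) = specEval φ m * specEval φ n := by
  obtain ⟨b, hb⟩ := spec_exists_ne_zero φ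
  refine specEval_eq hb ?_
  rw [mul_assoc, specEval_mul, specEval_mul, mult_mul_apply]

theorem specEval_toMult (φ : Spec B) (b : B) : specEval φ (toMult B b) = φ b := by
  obtain ⟨c, hc⟩ := spec_exists_ne_zero φ
  refine specEval_eq hc ?_
  rw [toMult_fst, spec_map_mul]

/-- `Spec(Φ)` for a nondegenerate `Φ : A → M(B)`: the character of `A` that takes `a` to the value
at `Φ a` of the extension of the character `φ` of `B` to `M(B)`. -/
def specMultMap (Φ : A →⋆ₙₐ[ℂ] 𝓜(ℂ, B)) (h : MultNondegenerate Φ) : C(Spec B, Spec A) where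
  toFun φ :=
    ⟨(⟨{ toFun := fun a => specEval φ (Φ a)
         map_add' := fun a b => by
          obtain ⟨c, hc⟩ := spec_exists_ne_zero φ
          refine specEval_eq hc ?_
          rw [add_mul, specEval_mul, specEval_mul, ← map_add, map_add Φ]
          rfl
         map_smul' := fun z b => by
          obtain ⟨c, hc⟩ := spec_exists_ne_zero φ
          refine specEval_eq hc ?_
          rw [RingHom.id_apply, smul_mul_assoc, specEval_mul, ← map_smul, map_smul Φ]
          rfl }, by
        have hev (c : B) : Continuous fun m : 𝓜(ℂ, B) => m.fst c := by
          let ev : 𝓜(ℂ, B) →ₗ[ℂ] B :=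
            { toFun := fun m => m.fst c
              map_add' := fun _ _ => rfl
              map_smul' := fun _ _ => rfl }
          refine AddMonoidHomClass.continuous_of_bound ev ‖c‖ fun m => ?_
          rw [mul_comm, ← DoubleCentralizer.norm_fst]
          exact m.fst.le_opNorm c
        exact ((map_continuous φ).comp ((hev _).comp (starHom_continuous Φ))).div_const _⟩ :
          A →L[ℂ] ℂ), by
      intro h0
      refine φ.2.1 (ContinuousLinearMap.ext fun b => ?_)
      refine dense_induction h (LinearMap.ker (φ : WeakDual ℂ B).toLinearMap)
        (φ : WeakDual ℂ B).isClosed_ker ?_ b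
      rintro _ ⟨a, b, rfl⟩
      have h1 : specEval φ (Φ a) = 0 := DFunLike.congr_fun h0 a
      change φ ((Φ a).fst b) = 0
      rw [← specEval_mul, h1, zero_mul], fun a b => by
      change specEval φ (Φ (a * b)) = specEval φ (Φ a) * specEval φ (Φ b)
      rw [map_mul, specEval_map_mul]⟩
  continuous_toFun := continuous_to_spec fun a => by
    change Continuous fun φ : Spec B => specEval φ (Φ a)
    rw [continuous_iff_continuousAt]
    intro φ
    obtain ⟨c, hc⟩ := spec_exists_ne_zero φ
    have h1 : ContinuousAt (fun ψ : Spec B => ψ ((Φ a).fst c) / ψ c) φ :=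
      (continuous_spec_apply _).continuousAt.div (continuous_spec_apply _).continuousAt hc
    refine h1.congr ?_
    filter_upwards [(continuous_spec_apply c).continuousAt.eventually_ne hc] with ψ hψ
    rw [← specEval_mul, mul_div_assoc, div_self hψ, mul_one]

theorem specMultMap_apply (Φ : A →⋆ₙₐ[ℂ] 𝓜(ℂ, B)) (h : MultNondegenerate Φ) (φ : Spec B) (a : A) :
    specMultMap Φ h φ a = specEval φ (Φ a) := rfl

theorem specMultMap_toMult (h : MultNondegenerate (toMult A)) :
    specMultMap (toMult A) h = ContinuousMap.id (Spec A) :=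
  ContinuousMap.ext fun φ => WeakDual.CharacterSpace.ext fun a => specEval_toMult φ a

theorem specEval_multExt (Ψ : B →⋆ₙₐ[ℂ] 𝓜(ℂ, C)) (hΨ : MultNondegenerate Ψ) (φ : Spec C)
    (m : 𝓜(ℂ, B)) : specEval φ (multExt Ψ hΨ m) = specEval (specMultMap Ψ hΨ φ) m := by
  obtain ⟨b, hb⟩ := spec_exists_ne_zero (specMultMap Ψ hΨ φ)
  refine (specEval_eq hb ?_).symm
  rw [specMultMap_apply, specMultMap_apply, ← specEval_map_mul, multExt_mul]

theorem specMultMap_comp (Ψ : B →⋆ₙₐ[ℂ] 𝓜(ℂ, C)) (hΨ : MultNondegenerate Ψ)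
    (Φ : A →⋆ₙₐ[ℂ] 𝓜(ℂ, B)) (hΦ : MultNondegenerate Φ)
    (h : MultNondegenerate (multComp Ψ hΨ Φ)) :
    specMultMap (multComp Ψ hΨ Φ) h = (specMultMap Φ hΦ).comp (specMultMap Ψ hΨ) :=
  ContinuousMap.ext fun φ => WeakDual.CharacterSpace.ext fun a =>
    specEval_multExt Ψ hΨ φ (Φ a)

end Spectrum

section TopologicalCategories

variable {X Y Z : Type u} [TopologicalSpace X] [TopologicalSpace Y] [TopologicalSpace Z]

theorem PreservesPrb.id {m : MeasurableSpace X} (μ : RadonProb X m) :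
    PreservesPrb (ContinuousMap.id X) μ μ := fun _ _ => rfl

theorem PreservesPrb.comp {mX : MeasurableSpace X} {mY : MeasurableSpace Y}
    {mZ : MeasurableSpace Z} {μ : RadonProb X mX} {ν : RadonProb Y mY} {ρ : RadonProb Z mZ}
    {T : C(X, Y)} {S : C(Y, Z)} (hS : PreservesPrb S ν ρ) (hT : PreservesPrb T μ ν)
    (hSm : Measurable S) : PreservesPrb (S.comp T) μ ρ := fun E hE =>
  (hT _ (hSm hE)).trans (hS E hE)

/-- A compact Hausdorff space with a Radon probability measure on its Baire `σ`-algebra. -/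
structure CHPrb : Type (u + 1) where
  carrier : Type u
  [top : TopologicalSpace carrier]
  [compact : CompactSpace carrier]
  [t2 : T2Space carrier]
  prb : RadonProb carrier (baireB carrier)

attribute [instance] CHPrb.top CHPrb.compact CHPrb.t2

/-- Continuous measure-preserving maps. -/
@[ext]
structure CHPrb.Hom (X Y : CHPrb.{u}) : Type u where
  map : C(X.carrier, Y.carrier)
  preserves : PreservesPrb map X.prb Y.prb

instance : Category CHPrb.{u} where
  Hom := CHPrb.Hom
  id X := ⟨ContinuousMap.id _, PreservesPrb.id _⟩
  comp f g := ⟨g.map.comp f.map, g.preserves.comp f.preserves (measurable_continuousMap g.map)⟩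

/-- A compact Hausdorff space with a distinguished point and a Radon probability measure. -/
structure CHptPrb : Type (u + 1) where
  space : CHPrb.{u}
  pt : space.carrier

/-- Continuous measure-preserving maps which preserve the distinguished point. -/
@[ext]
structure CHptPrb.Hom (X Y : CHptPrb.{u}) : Type u where
  hom : X.space ⟶ Y.space
  map_pt : hom.map X.pt = Y.pt

instance : Category CHptPrb.{u} where
  Hom := CHptPrb.Hom
  id X := ⟨𝟙 X.space, rfl⟩
  comp f g := ⟨f.hom ≫ g.hom, (congrArg g.hom.map f.map_pt).trans g.map_pt⟩

/-- A locally compact Hausdorff space with a Radon probability measure on the `σ`-algebra generated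
by the compactly supported continuous functions. -/
structure LCHprPrb : Type (u + 1) where
  carrier : Type u
  [top : TopologicalSpace carrier]
  [locallyCompact : LocallyCompactSpace carrier]
  [t2 : T2Space carrier]
  prb : RadonProb carrier (baireC carrier)

attribute [instance] LCHprPrb.top LCHprPrb.locallyCompact LCHprPrb.t2

/-- Proper continuous measure-preserving maps. -/
@[ext]
structure LCHprPrb.Hom (X Y : LCHprPrb.{u}) : Type u where
  map : C(X.carrier, Y.carrier)
  proper : ∀ K, IsCompact K → IsCompact (map ⁻¹' K)
  preserves : PreservesPrb map X.prb Y.prb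

instance : Category LCHprPrb.{u} where
  Hom := LCHprPrb.Hom
  id X := ⟨ContinuousMap.id _, fun _ hK => hK, PreservesPrb.id _⟩
  comp f g := ⟨g.map.comp f.map, fun K hK => f.proper _ (g.proper K hK),
    g.preserves.comp f.preserves (measurable_proper g.map g.proper)⟩

/-- A locally compact Hausdorff space with a Radon probability measure on the `σ`-algebra generated
by the bounded continuous functions. -/
structure LCHPrb : Type (u + 1) where
  carrier : Type u
  [top : TopologicalSpace carrier]
  [locallyCompact : LocallyCompactSpace carrier]
  [t2 : T2Space carrier]
  prb : RadonProb carrier (baireB carrier)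

attribute [instance] LCHPrb.top LCHPrb.locallyCompact LCHPrb.t2

/-- Continuous measure-preserving maps. -/
@[ext]
structure LCHPrb.Hom (X Y : LCHPrb.{u}) : Type u where
  map : C(X.carrier, Y.carrier)
  preserves : PreservesPrb map X.prb Y.prb

instance : Category LCHPrb.{u} where
  Hom := LCHPrb.Hom
  id X := ⟨ContinuousMap.id _, PreservesPrb.id _⟩
  comp f g := ⟨g.map.comp f.map, g.preserves.comp f.preserves (measurable_continuousMap g.map)⟩

end TopologicalCategories

section AlgebraCategories

/-- A unital commutative C⋆-algebra with a state. -/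
structure CStarUnitTr : Type (u + 1) where
  carrier : Type u
  [alg : CommCStarAlgebra carrier]
  state : carrier →L[ℂ] ℂ
  isState : IsState state

attribute [instance] CStarUnitTr.alg

/-- Unital `*`-homomorphisms which preserve the state. -/
@[ext]
structure CStarUnitTr.Hom (A B : CStarUnitTr.{u}) : Type u where
  map : A.carrier →⋆ₐ[ℂ] B.carrier
  trace : ∀ a, B.state (map a) = A.state a

instance : Category CStarUnitTr.{u} where
  Hom := CStarUnitTr.Hom
  id A := ⟨StarAlgHom.id ℂ _, fun _ => rfl⟩
  comp f g := ⟨g.map.comp f.map, fun a => (g.trace (f.map a)).trans (f.trace a)⟩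

/-- A unital commutative C⋆-algebra with a state and a unital `*`-homomorphism to `ℂ`. -/
structure CStarUnitInfTr : Type (u + 1) where
  alg : CStarUnitTr.{u}
  pt : alg.carrier →⋆ₐ[ℂ] ℂ

/-- Unital `*`-homomorphisms which preserve the state and the homomorphism to `ℂ`. -/
@[ext]
structure CStarUnitInfTr.Hom (A B : CStarUnitInfTr.{u}) : Type u where
  hom : A.alg ⟶ B.alg
  map_pt : ∀ a, B.pt (hom.map a) = A.pt a

instance : Category CStarUnitInfTr.{u} where
  Hom := CStarUnitInfTr.Hom
  id A := ⟨𝟙 A.alg, fun _ => rfl⟩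
  comp f g := ⟨f.hom ≫ g.hom, fun a => (g.map_pt (f.hom.map a)).trans (f.map_pt a)⟩

/-- A commutative C⋆-algebra, not necessarily unital, with a state: the objects of the category
whose morphisms are nondegenerate `*`-homomorphisms. -/
structure CStarNdTr : Type (u + 1) where
  carrier : Type u
  [alg : NonUnitalCommCStarAlgebra carrier]
  state : carrier →L[ℂ] ℂ
  isState : IsState state

attribute [instance] CStarNdTr.alg

/-- Nondegenerate `*`-homomorphisms `A → B` which preserve the state. -/
@[ext]
structure CStarNdTr.Hom (A B : CStarNdTr.{u}) : Type u where
  map : A.carrier →⋆ₙₐ[ℂ] B.carrier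
  nondegenerate : Nondegenerate map
  trace : ∀ a, B.state (map a) = A.state a

instance : Category CStarNdTr.{u} where
  Hom := CStarNdTr.Hom
  id A := ⟨NonUnitalStarAlgHom.id ℂ _, nondegenerate_id, fun _ => rfl⟩
  comp f g := ⟨g.map.comp f.map, nondegenerate_comp f.nondegenerate g.nondegenerate,
    fun a => (g.trace (f.map a)).trans (f.trace a)⟩

/-- A commutative C⋆-algebra, not necessarily unital, with a state: the objects of the category
whose morphisms take values in multiplier algebras. -/
structure CStarMultTr : Type (u + 1) where
  carrier : Type u
  [alg : NonUnitalCommCStarAlgebra carrier]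
  state : carrier →L[ℂ] ℂ
  isState : IsState state

attribute [instance] CStarMultTr.alg

/-- Nondegenerate `*`-homomorphisms `Φ : A → M(B)` such that `Mult(Φ) : M(A) → M(B)` preserves the
extensions of the states to the multiplier algebras. -/
@[ext]
structure CStarMultTr.Hom (A B : CStarMultTr.{u}) : Type u where
  map : A.carrier →⋆ₙₐ[ℂ] 𝓜(ℂ, B.carrier)
  nondegenerate : MultNondegenerate map
  trace : ∀ m, multState B.state (multExt map nondegenerate m) = multState A.state m

instance : Category CStarMultTr.{u} where
  Hom := CStarMultTr.Hom
  id A := ⟨toMult A.carrier, multNondegenerate_toMult _, fun m => by rw [multExt_id]; rfl⟩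
  comp f g := ⟨multComp g.map g.nondegenerate f.map,
    multNondegenerate_comp g.nondegenerate f.nondegenerate, fun m => by
      rw [multExt_multComp _ _ _ f.nondegenerate, StarAlgHom.comp_apply, g.trace, f.trace]⟩
  id_comp f := CStarMultTr.Hom.ext (NonUnitalStarAlgHom.ext fun a =>
    multExt_toMult f.map f.nondegenerate a)
  comp_id f := CStarMultTr.Hom.ext (NonUnitalStarAlgHom.ext fun a => by
    rw [multComp_apply, multExt_id]; rfl)
  assoc f g h := CStarMultTr.Hom.ext (NonUnitalStarAlgHom.ext fun a => by
    rw [multComp_apply, multComp_apply, multComp_apply,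
      multExt_multComp _ _ _ g.nondegenerate]; rfl)

end AlgebraCategories

section WellDefinedness

/-- The Radon probability measure `μ` on the spectrum of `A` represents the functional `τ`. -/
def Represents {A : Type u} [NonUnitalCommCStarAlgebra A] {m : MeasurableSpace (Spec A)}
    (μ : RadonProb (Spec A) m) (τ : A →L[ℂ] ℂ) : Prop :=
  ∀ a, ∫ φ, φ a ∂μ.measure = τ a

/-- The assertions which say that the functors below are well defined, that is, that their values on
objects and morphisms are objects and morphisms of the target categories. They are claims of the
theorem (they form the first component of its conclusion), and they are never assumed to hold. -/
structure WellDefined : Prop where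
  /-- Baire probability measures on compact Hausdorff spaces are Radon, so that their
  pushforwards to compactifications are objects of `CHPrb`. -/
  radon_compact : ∀ (K : Type u) [TopologicalSpace K] [CompactSpace K] [T2Space K]
    (μ : @Measure K (baireB K)), IsProbabilityMeasure μ →
    μ.InnerRegularWRT (fun E => MeasurableSet[baireB K] E ∧ IsCompact E ∧ IsGδ E)
      (fun E => MeasurableSet[baireB K] E)
  /-- The canonical extension of a Radon probability measure from the `σ`-algebra generated by the
  compactly supported functions to the one generated by the bounded functions. -/
  extension : ∀ X : LCHprPrb.{u}, ∃! ν : RadonProb X.carrier (baireB X.carrier),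
    ∀ E, MeasurableSet[baireC X.carrier] E → ν.measure E = X.prb.measure E
  extension_map : ∀ (X Y : LCHprPrb.{u}) (T : X ⟶ Y) (μ : RadonProb X.carrier (baireB X.carrier))
    (ν : RadonProb Y.carrier (baireB Y.carrier)),
    (∀ E, MeasurableSet[baireC X.carrier] E → μ.measure E = X.prb.measure E) →
    (∀ E, MeasurableSet[baireC Y.carrier] E → ν.measure E = Y.prb.measure E) →
    PreservesPrb T.map μ ν
  /-- States extend to states of the unitization and, uniquely, to states of the multiplier
  algebra. -/
  unit_state : ∀ A : CStarNdTr.{u}, IsState (unitState A.state)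
  mult_state : ∀ A : CStarMultTr.{u}, ∃! σ : 𝓜(ℂ, A.carrier) →L[ℂ] ℂ,
    IsState σ ∧ ∀ a, σ (toMult A.carrier a) = A.state a
  /-- A nondegenerate state-preserving `A → B` is also a morphism of the category in which the
  morphisms have values in multiplier algebras. -/
  nd_trace : ∀ (A B : CStarNdTr.{u}) (f : A ⟶ B) (m : 𝓜(ℂ, A.carrier)),
    multState B.state (multExt ((toMult B.carrier).comp f.map)
      (multNondegenerate_toMult_comp f.nondegenerate) m) = multState A.state m
  /-- The pullback `C₀(Y) → M(C₀(X))` along a continuous measure-preserving map is a morphism. -/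
  c0_trace : ∀ (X Y : LCHPrb.{u}) (T : X ⟶ Y) (m : 𝓜(ℂ, C₀(Y.carrier, ℂ))),
    multState (intC0 baireC_le_baireB X.prb)
      (multExt (c0MultComp T.map) (c0MultComp_nondegenerate T.map) m) =
      multState (intC0 baireC_le_baireB Y.prb) m
  /-- Every state is represented by a unique Radon probability measure on the spectrum, and the maps
  `Spec(Φ)` preserve these measures. -/
  riesz_unit : ∀ A : CStarUnitTr.{u}, ∃! μ : RadonProb (Spec A.carrier) (baireB (Spec A.carrier)),
    Represents μ A.state
  riesz_unit_map : ∀ (A B : CStarUnitTr.{u}) (f : A ⟶ B)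
    (μ : RadonProb (Spec A.carrier) (baireB (Spec A.carrier)))
    (ν : RadonProb (Spec B.carrier) (baireB (Spec B.carrier))),
    Represents μ A.state → Represents ν B.state →
    PreservesPrb (specMap f.map.toNonUnitalStarAlgHom (nondegenerate_of_unital f.map)) ν μ
  riesz_nd : ∀ A : CStarNdTr.{u}, ∃! μ : RadonProb (Spec A.carrier) (baireC (Spec A.carrier)),
    Represents μ A.state
  riesz_nd_map : ∀ (A B : CStarNdTr.{u}) (f : A ⟶ B)
    (μ : RadonProb (Spec A.carrier) (baireC (Spec A.carrier)))
    (ν : RadonProb (Spec B.carrier) (baireC (Spec B.carrier))),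
    Represents μ A.state → Represents ν B.state →
    PreservesPrb (specMap f.map f.nondegenerate) ν μ
  riesz_mult : ∀ A : CStarMultTr.{u}, ∃! μ : RadonProb (Spec A.carrier) (baireB (Spec A.carrier)),
    Represents μ A.state
  riesz_mult_map : ∀ (A B : CStarMultTr.{u}) (f : A ⟶ B)
    (μ : RadonProb (Spec A.carrier) (baireB (Spec A.carrier)))
    (ν : RadonProb (Spec B.carrier) (baireB (Spec B.carrier))),
    Represents μ A.state → Represents ν B.state →
    PreservesPrb (specMultMap f.map f.nondegenerate) ν μ

theorem WellDefined.isState_multState (H : WellDefined.{u}) (A : CStarMultTr.{u}) :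
    IsState (multState A.state) ∧ ∀ a, multState A.state (toMult A.carrier a) = A.state a := by
  have h := (H.mult_state A).exists
  rw [multState, dif_pos h]
  exact h.choose_spec

/-- The pushforward of a Radon probability measure under a measurable map to a compact Hausdorff
space. -/
def RadonProb.push (H : WellDefined.{u}) {X K : Type u} [TopologicalSpace X] [TopologicalSpace K]
    [CompactSpace K] [T2Space K] {m : MeasurableSpace X} (μ : RadonProb X m) (T : X → K)
    (hT : Measurable[m, baireB K] T) : RadonProb K (baireB K) :=
  let _ : MeasurableSpace K := baireB K
  have h : IsProbabilityMeasure (μ.measure.map T) :=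
    Measure.isProbabilityMeasure_map hT.aemeasurable
  { measure := μ.measure.map T
    prob := h
    radon := H.radon_compact K _ h }

theorem RadonProb.push_apply (H : WellDefined.{u}) {X K : Type u} [TopologicalSpace X]
    [TopologicalSpace K] [CompactSpace K] [T2Space K] {m : MeasurableSpace X} (μ : RadonProb X m)
    (T : X → K) (hT : Measurable[m, baireB K] T) {E : Set K} (hE : MeasurableSet[baireB K] E) :
    (μ.push H T hT).measure E = μ.measure (T ⁻¹' E) :=
  @Measure.map_apply X K m (baireB K) μ.measure T hT E hE

/-- Transport of a Radon probability measure along an equality of `σ`-algebras. -/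
def RadonProb.cast {X : Type u} [TopologicalSpace X] {m m' : MeasurableSpace X} (h : m = m')
    (μ : RadonProb X m) : RadonProb X m' := h ▸ μ

theorem RadonProb.cast_apply {X : Type u} [TopologicalSpace X] {m m' : MeasurableSpace X}
    (h : m = m') (μ : RadonProb X m) (E : Set X) : (μ.cast h).measure E = μ.measure E := by
  subst h
  rfl

end WellDefinedness

section VerticalFunctors

/-- The functor `C : CHPrb ⥤ CStarUnitTrᵒᵖ`. -/
def funcC : CHPrb.{u} ⥤ CStarUnitTr.{u}ᵒᵖ where
  obj X := Opposite.op
    { carrier := C(X.carrier, ℂ)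
      state := intC X.prb
      isState := intC_isState X.prb }
  map {X Y} T := Quiver.Hom.op
    { map := ContinuousMap.compStarAlgHom' ℂ ℂ T.map
      trace := fun f => integral_preserves T.preserves (measurable_continuousMap T.map)
        (measurable_baireB (BoundedContinuousFunction.mkOfCompact f)) }

/-- The functor `C : CHptPrb ⥤ CStarUnitInfTrᵒᵖ`; the distinguished point `x` gives the
homomorphism `f ↦ f x`. -/
def funcCpt : CHptPrb.{u} ⥤ CStarUnitInfTr.{u}ᵒᵖ where
  obj X := Opposite.op
    { alg := (funcC.obj X.space).unop
      pt := ContinuousMap.evalStarAlgHom ℂ ℂ X.pt }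
  map {X Y} T := Quiver.Hom.op
    { hom := (funcC.map T.hom).unop
      map_pt := fun (f : C(Y.space.carrier, ℂ)) => congrArg (fun y => f y) T.map_pt }

/-- The functor `C₀ : LCHprPrb ⥤ CStarNdTrᵒᵖ`. -/
def funcC0pr : LCHprPrb.{u} ⥤ CStarNdTr.{u}ᵒᵖ where
  obj X := Opposite.op
    { carrier := C₀(X.carrier, ℂ)
      state := intC0 le_rfl X.prb
      isState := intC0_isState le_rfl X.prb }
  map {X Y} T := Quiver.Hom.op
    { map := c0Comp T.map T.proper
      nondegenerate := c0Comp_nondegenerate T.map T.proper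
      trace := fun f => integral_preserves T.preserves (measurable_proper T.map T.proper)
        (measurable_zeroAtInfty f) }

/-- The functor `C₀ : LCHPrb ⥤ CStarMultTrᵒᵖ`. -/
def funcC0 (H : WellDefined.{u}) : LCHPrb.{u} ⥤ CStarMultTr.{u}ᵒᵖ where
  obj X := Opposite.op
    { carrier := C₀(X.carrier, ℂ)
      state := intC0 baireC_le_baireB X.prb
      isState := intC0_isState baireC_le_baireB X.prb }
  map {X Y} T := Quiver.Hom.op
    { map := c0MultComp T.map
      nondegenerate := c0MultComp_nondegenerate T.map
      trace := H.c0_trace X Y T }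
  map_id _ := congrArg Quiver.Hom.op (CStarMultTr.Hom.ext c0MultComp_id)
  map_comp T S := congrArg Quiver.Hom.op (CStarMultTr.Hom.ext (c0MultComp_comp S.map T.map))

/-- The functor `Riesz : CStarUnitTrᵒᵖ ⥤ CHPrb`: the spectrum with the Radon probability measure
which represents the state. -/
def rieszUnit (H : WellDefined.{u}) : CStarUnitTr.{u}ᵒᵖ ⥤ CHPrb.{u} where
  obj A :=
    { carrier := Spec A.unop.carrier
      prb := (H.riesz_unit A.unop).choose }
  map {A B} f :=
    { map := specMap f.unop.map.toNonUnitalStarAlgHom (nondegenerate_of_unital f.unop.map)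
      preserves := H.riesz_unit_map B.unop A.unop f.unop _ _ (H.riesz_unit B.unop).choose_spec.1
        (H.riesz_unit A.unop).choose_spec.1 }

/-- A unital `*`-homomorphism to `ℂ`, as a point of the spectrum. -/
def specPoint {A : Type u} [CommCStarAlgebra A] (φ : A →⋆ₐ[ℂ] ℂ) : Spec A :=
  ⟨(⟨(φ : A →ₗ[ℂ] ℂ), starHom_continuous φ.toNonUnitalStarAlgHom⟩ : A →L[ℂ] ℂ), fun h => by
    have h1 : φ 1 = 0 := DFunLike.congr_fun h 1
    rw [map_one] at h1
    exact one_ne_zero h1, map_mul φ⟩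

/-- The functor `Riesz : CStarUnitInfTrᵒᵖ ⥤ CHptPrb`. -/
def rieszUnitInf (H : WellDefined.{u}) : CStarUnitInfTr.{u}ᵒᵖ ⥤ CHptPrb.{u} where
  obj A :=
    { space := (rieszUnit H).obj (Opposite.op A.unop.alg)
      pt := specPoint A.unop.pt }
  map {A B} f :=
    { hom := (rieszUnit H).map f.unop.hom.op
      map_pt := WeakDual.CharacterSpace.ext fun a => f.unop.map_pt a }

/-- The functor `Riesz : CStarNdTrᵒᵖ ⥤ LCHprPrb`. -/
def rieszNd (H : WellDefined.{u}) : CStarNdTr.{u}ᵒᵖ ⥤ LCHprPrb.{u} where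
  obj A :=
    { carrier := Spec A.unop.carrier
      prb := (H.riesz_nd A.unop).choose }
  map {A B} f :=
    { map := specMap f.unop.map f.unop.nondegenerate
      proper := specMap_proper f.unop.map f.unop.nondegenerate
      preserves := H.riesz_nd_map B.unop A.unop f.unop _ _ (H.riesz_nd B.unop).choose_spec.1
        (H.riesz_nd A.unop).choose_spec.1 }

/-- The functor `Riesz : CStarMultTrᵒᵖ ⥤ LCHPrb`. -/
def rieszMult (H : WellDefined.{u}) : CStarMultTr.{u}ᵒᵖ ⥤ LCHPrb.{u} where
  obj A :=
    { carrier := Spec A.unop.carrier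
      prb := (H.riesz_mult A.unop).choose }
  map {A B} f :=
    { map := specMultMap f.unop.map f.unop.nondegenerate
      preserves := H.riesz_mult_map B.unop A.unop f.unop _ _ (H.riesz_mult B.unop).choose_spec.1
        (H.riesz_mult A.unop).choose_spec.1 }
  map_id _ := LCHPrb.Hom.ext (specMultMap_toMult (multNondegenerate_toMult _))
  map_comp f g := LCHPrb.Hom.ext (specMultMap_comp _ _ _ g.unop.nondegenerate
    (multNondegenerate_comp f.unop.nondegenerate g.unop.nondegenerate))

end VerticalFunctors

section HorizontalFunctors

/-- The homomorphism `a + c ↦ c` on the unitization. -/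
def unitPt (A : Type u) [NonUnitalCommCStarAlgebra A] : Unitization ℂ A →⋆ₐ[ℂ] ℂ :=
  { Unitization.fstHom ℂ A with map_star' := fun _ => rfl }

theorem starMap_fst {A B : Type u} [NonUnitalCommCStarAlgebra A] [NonUnitalCommCStarAlgebra B]
    (Φ : A →⋆ₙₐ[ℂ] B) (x : Unitization ℂ A) : (Unitization.starMap Φ x).fst = x.fst := by
  induction x with
  | inl_add_inr r a =>
    rw [map_add, Unitization.starMap_inl, Unitization.starMap_inr, Unitization.algebraMap_eq_inl]
    simp

theorem starMap_snd {A B : Type u} [NonUnitalCommCStarAlgebra A] [NonUnitalCommCStarAlgebra B]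
    (Φ : A →⋆ₙₐ[ℂ] B) (x : Unitization ℂ A) : (Unitization.starMap Φ x).snd = Φ x.snd := by
  induction x with
  | inl_add_inr r a =>
    rw [map_add, Unitization.starMap_inl, Unitization.starMap_inr, Unitization.algebraMap_eq_inl]
    simp

/-- The functor `Unit`, which adjoins a unit: the state is extended by `a + c ↦ τ a + c`, and the
homomorphism to `ℂ` is `a + c ↦ c`. -/
def funcUnit (H : WellDefined.{u}) : CStarNdTr.{u} ⥤ CStarUnitInfTr.{u} where
  obj A :=
    { alg :=
        { carrier := Unitization ℂ A.carrier
          state := unitState A.state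
          isState := H.unit_state A }
      pt := unitPt A.carrier }
  map {A B} f :=
    { hom :=
        { map := Unitization.starMap f.map
          trace := fun x => by
            change (Unitization.starMap f.map x).fst + B.state (Unitization.starMap f.map x).snd =
              x.fst + A.state x.snd
            rw [← f.trace, starMap_fst, starMap_snd] }
      map_pt := fun x => by
        exact starMap_fst f.map x }
  map_id _ := CStarUnitInfTr.Hom.ext (CStarUnitTr.Hom.ext Unitization.starMap_id)
  map_comp f g := CStarUnitInfTr.Hom.ext (CStarUnitTr.Hom.ext Unitization.starMap_comp)

/-- The forgetful functor from nondegenerate homomorphisms `A → B` to homomorphisms `A → M(B)`. -/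
def ndToMult (H : WellDefined.{u}) : CStarNdTr.{u} ⥤ CStarMultTr.{u} where
  obj A :=
    { carrier := A.carrier
      state := A.state
      isState := A.isState }
  map {A B} f :=
    { map := (toMult B.carrier).comp f.map
      nondegenerate := multNondegenerate_toMult_comp f.nondegenerate
      trace := H.nd_trace A B f }
  map_comp {_ _ C} f g := CStarMultTr.Hom.ext (NonUnitalStarAlgHom.ext fun a =>
    (multExt_toMult ((toMult C.carrier).comp g.map)
      (multNondegenerate_toMult_comp g.nondegenerate) (f.map a)).symm)

/-- The functor `Mult`: the multiplier algebra, with the unique extension of the state. -/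
def funcMult (H : WellDefined.{u}) : CStarMultTr.{u} ⥤ CStarUnitTr.{u} where
  obj A :=
    { carrier := 𝓜(ℂ, A.carrier)
      state := multState A.state
      isState := (H.isState_multState A).1 }
  map f :=
    { map := multExt f.map f.nondegenerate
      trace := f.trace }
  map_id _ := CStarUnitTr.Hom.ext (multExt_id (multNondegenerate_toMult _))
  map_comp f g := CStarUnitTr.Hom.ext (multExt_multComp _ _ _ f.nondegenerate
    (multNondegenerate_comp g.nondegenerate f.nondegenerate))

/-- The forgetful functor which drops the homomorphism to `ℂ`. -/
def unitInfToUnit : CStarUnitInfTr.{u} ⥤ CStarUnitTr.{u} where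
  obj A := A.alg
  map f := f.hom

/-- The forgetful functor from unital algebras to possibly nonunital ones. -/
def unitToNd : CStarUnitTr.{u} ⥤ CStarNdTr.{u} where
  obj A :=
    { carrier := A.carrier
      state := A.state
      isState := A.isState }
  map f :=
    { map := f.map.toNonUnitalStarAlgHom
      nondegenerate := nondegenerate_of_unital f.map
      trace := f.trace }

/-- The forgetful functor which regards a unital homomorphism `Φ : A → B` as the homomorphism
`A → B → M(B)`. -/
def unitToMult (H : WellDefined.{u}) : CStarUnitTr.{u} ⥤ CStarMultTr.{u} where
  obj A :=
    { carrier := A.carrier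
      state := A.state
      isState := A.isState }
  map {A B} f :=
    { map := (toMult B.carrier).comp f.map.toNonUnitalStarAlgHom
      nondegenerate := multNondegenerate_toMult_comp (nondegenerate_of_unital f.map)
      trace := H.nd_trace (unitToNd.obj A) (unitToNd.obj B) (unitToNd.map f) }
  map_comp {_ _ C} f g := CStarMultTr.Hom.ext (NonUnitalStarAlgHom.ext fun a =>
    (multExt_toMult ((toMult C.carrier).comp g.map.toNonUnitalStarAlgHom)
      (multNondegenerate_toMult_comp (nondegenerate_of_unital g.map)) (f.map a)).symm)

theorem measurable_onePoint_coe (X : Type u) [TopologicalSpace X] [T2Space X] :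
    Measurable[baireC X, baireB (OnePoint X)] ((↑) : X → OnePoint X) := by
  refine measurable_to_baireB fun f => ?_
  let g : C₀(X, ℂ) :=
    { toFun := fun x => f x - f OnePoint.infty
      continuous_toFun := (f.continuous.comp OnePoint.continuous_coe).sub continuous_const
      zero_at_infty' := by
        have h := (f.continuous.tendsto OnePoint.infty).comp (OnePoint.tendsto_coe_infty (X := X))
        rw [coclosedCompact_eq_cocompact] at h
        simpa using h.sub_const (f OnePoint.infty) }
  have h := (measurable_zeroAtInfty g).add_const (f OnePoint.infty)
  have h1 : (fun x => g x + f OnePoint.infty) = f ∘ ((↑) : X → OnePoint X) :=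
    funext fun x => sub_add_cancel (f x) (f OnePoint.infty)
  rwa [h1] at h

/-- The functor `Alex`: the one-point compactification, with the pushforward of the measure; the
distinguished point is the point at infinity. -/
def funcAlex (H : WellDefined.{u}) : LCHprPrb.{u} ⥤ CHptPrb.{u} where
  obj X :=
    { space :=
        { carrier := OnePoint X.carrier
          prb := X.prb.push H (↑) (measurable_onePoint_coe X.carrier) }
      pt := OnePoint.infty }
  map {X Y} T :=
    { hom :=
        { map := ⟨OnePoint.map T.map, OnePoint.continuous_map T.map.continuous (by
            rw [coclosedCompact_eq_cocompact, coclosedCompact_eq_cocompact]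
            exact CocompactMap.tendsto_of_forall_preimage T.proper)⟩
          preserves := fun E hE => by
            rw [RadonProb.push_apply _ _ _ _ hE, RadonProb.push_apply]
            · exact T.preserves _ (measurable_onePoint_coe Y.carrier hE)
            · exact measurable_continuousMap ⟨OnePoint.map T.map, _⟩ hE }
      map_pt := rfl }
  map_id X := CHptPrb.Hom.ext (CHPrb.Hom.ext (ContinuousMap.ext fun x => by
    induction x using OnePoint.rec <;> rfl))
  map_comp f g := CHptPrb.Hom.ext (CHPrb.Hom.ext (ContinuousMap.ext fun x => by
    induction x using OnePoint.rec <;> rfl))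

/-- Pullback of bounded continuous functions. -/
def bcfComp {X Y : Type u} [TopologicalSpace X] [TopologicalSpace Y] (T : C(X, Y)) :
    (Y →ᵇ ℂ) →⋆ₐ[ℂ] (X →ᵇ ℂ) where
  toFun f := f.compContinuous T
  map_one' := rfl
  map_mul' _ _ := rfl
  map_zero' := rfl
  map_add' _ _ := rfl
  commutes' _ := rfl
  map_star' _ := rfl

/-- The functor `C_b : LCHPrb ⥤ CStarUnitTrᵒᵖ`. -/
def funcCb : LCHPrb.{u} ⥤ CStarUnitTr.{u}ᵒᵖ where
  obj X := Opposite.op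
    { carrier := X.carrier →ᵇ ℂ
      state := intCb X.prb
      isState := intCb_isState X.prb }
  map {X Y} T := Quiver.Hom.op
    { map := bcfComp T.map
      trace := fun f => integral_preserves T.preserves (measurable_continuousMap T.map)
        (measurable_baireB f) }

/-- Evaluation, as a map from `X` to the spectrum of `C_b(X)`. -/
def evSpec (X : Type u) [TopologicalSpace X] : C(X, Spec (X →ᵇ ℂ)) where
  toFun x := ⟨BoundedContinuousFunction.evalCLM ℂ x, fun h => by
    have h1 : (1 : ℂ) = 0 := DFunLike.congr_fun h (1 : X →ᵇ ℂ)
    exact one_ne_zero h1, fun _ _ => rfl⟩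
  continuous_toFun := continuous_to_spec fun f => f.continuous

/-- The functor `β`: the Stone–Čech compactification, as the spectrum of `C_b(X)`, with the
pushforward of the measure. -/
def funcBeta (H : WellDefined.{u}) : LCHPrb.{u} ⥤ CHPrb.{u} where
  obj X :=
    { carrier := Spec (X.carrier →ᵇ ℂ)
      prb := X.prb.push H (evSpec X.carrier) (measurable_continuousMap _) }
  map {X Y} T :=
    { map := specMap (bcfComp T.map).toNonUnitalStarAlgHom (nondegenerate_of_unital _)
      preserves := fun E hE => by
        rw [RadonProb.push_apply _ _ _ _ hE, RadonProb.push_apply]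
        · exact T.preserves _ (measurable_continuousMap (evSpec Y.carrier) hE)
        · exact measurable_continuousMap _ hE }

/-- The forgetful functor which drops the distinguished point. -/
def chptToCH : CHptPrb.{u} ⥤ CHPrb.{u} where
  obj X := X.space
  map f := f.hom

/-- The forgetful functor from compact spaces to locally compact spaces and proper maps. -/
def chToLCHpr : CHPrb.{u} ⥤ LCHprPrb.{u} where
  obj X :=
    { carrier := X.carrier
      prb := X.prb.cast baireC_eq_baireB }
  map {X Y} f :=
    { map := f.map
      proper := fun _ hK => (hK.isClosed.preimage f.map.continuous).isCompact
      preserves := fun E hE => by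
        rw [RadonProb.cast_apply, RadonProb.cast_apply]
        exact f.preserves E (by rwa [baireC_eq_baireB]) }

/-- The forgetful functor from compact spaces to locally compact spaces and continuous maps. -/
def chToLCH : CHPrb.{u} ⥤ LCHPrb.{u} where
  obj X :=
    { carrier := X.carrier
      prb := X.prb }
  map f :=
    { map := f.map
      preserves := f.preserves }

/-- The forgetful functor from locally compact spaces and proper maps to locally compact spaces and
continuous maps, which replaces the measure by its canonical extension. -/
def lchprToLCH (H : WellDefined.{u}) : LCHprPrb.{u} ⥤ LCHPrb.{u} where
  obj X :=
    { carrier := X.carrier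
      prb := (H.extension X).choose }
  map {X Y} f :=
    { map := f.map
      preserves := H.extension_map X Y f _ _ (H.extension X).choose_spec.1
        (H.extension Y).choose_spec.1 }

end HorizontalFunctors

/-- The functors `F : C ⥤ Dᵒᵖ` and `G : Dᵒᵖ ⥤ C` form a duality of categories: both composites are
naturally isomorphic to identity functors. -/
def IsDuality {C D : Type (u + 1)} [Category.{u} C] [Category.{u} D] (F : C ⥤ Dᵒᵖ) (G : Dᵒᵖ ⥤ C) :
    Prop :=
  Nonempty (F ⋙ G ≅ 𝟭 C) ∧ Nonempty (G ⋙ F ≅ 𝟭 Dᵒᵖ)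

end

end RieszDuality

open RieszDuality

/-! Two classical facts carry the theorem. By Gelfand duality a commutative C⋆-algebra is `C₀` of
its spectrum, and by Riesz–Markov–Kakutani a state on `C₀(X)` is integration against a unique Radon
probability measure. The rest is the control of Baire measures and of multiplier algebras that makes
both facts functorial.

Measures. A set in a `σ`-algebra generated by continuous functions depends on countably many of
them, so it is the preimage of a Borel set of `ℕ → ℂ` under a continuous map. Inner regularity by
closed `Gδ` sets is therefore automatic, and being Radon amounts to tightness (`RadonProb.ofTight`).
Conversely, compact `Gδ` sets are level sets of compactly supported functions, so a Radon
probability measure is determined by its integrals of `C₀` functions (`RadonProb.ext_of_integral`).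
Preservation of measures thus becomes an identity of integrals (`PreservesPrb.of_integral`), and
uniqueness of representing measures and of extensions follows as well.

Algebras. The nonunital Gelfand theorem (`gelfand_bijective`) and the homeomorphism of `X` with
`Spec C₀(X)` (`evSpec₀_surjective`) are reduced to the unital case through the unitization and the
one-point compactification. Characters extend to multipliers, which identifies `M(C₀(X))` with
`C_b(X)` (`bcfMult_bijective`). Integrating the extended characters extends a state to `M(A)`. This
extension is unique because `A` is an ideal of `M(A)` on which the state already has norm one
(`IsState.eq_of_ideal`). Hence it suffices to check compatibility with states on `A`
(`multState_multExt`).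

Categories. Evaluation and the Gelfand transform are natural isomorphisms, and full faithfulness of
the vertical functors follows formally. The upward squares are concrete isomorphisms: `C(X⁺)` is the
unitization of `C₀(X)`, and both `M(C₀(X))` and `C(βX)` are `C_b(X)`. The downward squares follow
from them by `mateIso`. Fullness of the forgetful functors on algebras holds because nondegenerate
homomorphisms between unital algebras are unital and `M(B) = B` for unital `B`. -/

namespace RieszDuality

noncomputable section

/-! ### Baire measures: regularity, uniqueness, pushforward and extension. -/

section BaireMeasures

/-- A set which is measurable for the `σ`-algebra generated by a family of functions depends on
countably many members of the family only. -/
theorem exists_preimage_of_measurableSet_iSup {ι X : Type*} [Nonempty ι] (f : ι → X → ℂ) {E : Set X}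
    (hE : MeasurableSet[⨆ i, (borel ℂ).comap (f i)] E) :
    ∃ (s : ℕ → ι) (B : Set (ℕ → ℂ)), MeasurableSet B ∧ E = (fun x n => f (s n) x) ⁻¹' B := by
  rw [MeasurableSpace.measurableSet_iSup] at hE
  induction hE with
  | basic E h =>
    obtain ⟨i, B, hB, rfl⟩ := h
    rw [← BorelSpace.measurable_eq (α := ℂ)] at hB
    exact ⟨fun _ => i, (fun z => z 0) ⁻¹' B, measurable_pi_apply 0 hB, rfl⟩
  | empty => exact ⟨fun _ => Classical.arbitrary ι, ∅, MeasurableSet.empty, rfl⟩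
  | compl E _ ih =>
    obtain ⟨s, B, hB, rfl⟩ := ih
    exact ⟨s, Bᶜ, hB.compl, rfl⟩
  | iUnion E _ ih =>
    choose s B hB h using ih
    -- The pairing function merges countably many index sequences into one; the `n`-th set then
    -- reads only the coordinates `Nat.pair n m`.
    refine ⟨fun k => s k.unpair.1 k.unpair.2,
      ⋃ n, (fun z m => z (Nat.pair n m)) ⁻¹' B n, MeasurableSet.iUnion fun n =>
        (measurable_pi_lambda _ fun m => measurable_pi_apply (Nat.pair n m)) (hB n), ?_⟩
    ext x
    simp only [Set.mem_iUnion, Set.mem_preimage, Nat.unpair_pair]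
    exact exists_congr fun n => by rw [h n]; rfl

/-- The `σ`-algebra `m` is generated by continuous complex functions. -/
def IsGeneratedByContinuous {X : Type u} [TopologicalSpace X] (m : MeasurableSpace X) : Prop :=
  ∃ (ι : Type u) (_ : Nonempty ι) (f : ι → C(X, ℂ)), m = ⨆ i, (borel ℂ).comap (f i)

theorem isGeneratedByContinuous_baireB (X : Type u) [TopologicalSpace X] :
    IsGeneratedByContinuous (baireB X) :=
  ⟨X →ᵇ ℂ, inferInstance, fun f => f.toContinuousMap, rfl⟩

theorem isGeneratedByContinuous_baireC (X : Type u) [TopologicalSpace X] :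
    IsGeneratedByContinuous (baireC X) :=
  ⟨C_c(X, ℂ), inferInstance, fun f => f.toContinuousMap, rfl⟩

variable {X Y : Type u} [TopologicalSpace X] [TopologicalSpace Y]

/-- `E` is the preimage of a Borel set under a continuous map to the metrizable space `ℕ → ℂ`. The
pushforward of `μ` there is inner regular for closed sets, closed sets are `Gδ`, and both properties
pull back. -/
theorem IsGeneratedByContinuous.exists_isClosed_isGδ {m : MeasurableSpace X}
    (hm : IsGeneratedByContinuous m) (μ : Measure X) [IsFiniteMeasure μ] {E : Set X}
    (hE : MeasurableSet E) {r : ENNReal} (hr : r < μ E) :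
    ∃ F ⊆ E, MeasurableSet F ∧ IsClosed F ∧ IsGδ F ∧ r < μ F := by
  obtain ⟨ι, hι, f, hm⟩ := hm
  obtain ⟨s, B, hB, rfl⟩ := exists_preimage_of_measurableSet_iSup (fun i => f i)
    (hm ▸ hE : MeasurableSet[⨆ i, (borel ℂ).comap (f i)] E)
  let T : X → ℕ → ℂ := fun x n => f (s n) x
  have hTc : Continuous T := continuous_pi fun n => (f (s n)).continuous
  have hT : Measurable T := measurable_pi_lambda _ fun n => by
    rw [measurable_iff_comap_le, BorelSpace.measurable_eq (α := ℂ), hm]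
    exact le_iSup (fun i => (borel ℂ).comap (f i)) (s n)
  change r < μ (T ⁻¹' B) at hr
  rw [← Measure.map_apply hT hB] at hr
  obtain ⟨C, hCB, hC, hrC⟩ := hB.exists_lt_isClosed_of_ne_top (measure_ne_top _ _) hr
  rw [Measure.map_apply hT hC.measurableSet] at hrC
  exact ⟨T ⁻¹' C, Set.preimage_mono hCB, hT hC.measurableSet, hC.preimage hTc,
    hC.isGδ.preimage hTc, hrC⟩

/-- A probability measure on a `σ`-algebra generated by continuous functions which is tight with
respect to compact `Gδ` sets is a Radon measure. -/
def RadonProb.ofTight {m : MeasurableSpace X} (hm : IsGeneratedByContinuous m) (μ : Measure X)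
    [hμ : IsProbabilityMeasure μ]
    (h : ∀ ε, ε ≠ 0 → ∃ K, MeasurableSet K ∧ IsCompact K ∧ IsGδ K ∧ μ Kᶜ < ε) : RadonProb X m where
  measure := μ
  prob := hμ
  radon E hE r hr := by
    obtain ⟨F, hFE, hFm, hF, hFG, hrF⟩ := hm.exists_isClosed_isGδ μ hE hr
    -- The tolerance is the surplus of `μ F` over `r`, so that cutting `F` down to `K` keeps the
    -- measure above `r`.
    obtain ⟨K, hKm, hK, hKG, hKε⟩ := h (μ F - r) (tsub_pos_of_lt hrF).ne'
    refine ⟨F ∩ K, Set.inter_subset_left.trans hFE, ⟨hFm.inter hKm, hK.inter_left hF,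
      hFG.inter hKG⟩, ?_⟩
    have h1 : μ F ≤ μ (F ∩ K) + μ Kᶜ := by
      refine (measure_mono fun x hx => ?_).trans (measure_union_le _ _)
      by_cases hxK : x ∈ K
      · exact Or.inl ⟨hx, hxK⟩
      · exact Or.inr hxK
    by_contra! h2
    have h3 : μ F < r + (μ F - r) :=
      h1.trans_lt (ENNReal.add_lt_add_of_le_of_lt ((h2.trans_lt hr).trans_le le_top).ne h2 hKε)
    rw [add_tsub_cancel_of_le hrF.le] at h3
    exact h3.false

/-- Converse to `RadonProb.ofTight`: tightness is inner regularity applied to the whole space. -/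
theorem RadonProb.exists_compl_lt {m : MeasurableSpace X} (μ : RadonProb X m) {ε : ENNReal}
    (hε : ε ≠ 0) : ∃ K, MeasurableSet K ∧ IsCompact K ∧ IsGδ K ∧ μ.measure Kᶜ < ε := by
  obtain ⟨K, -, ⟨hKm, hK, hKG⟩, h⟩ := μ.radon.exists_subset_lt_add
    ⟨MeasurableSet.empty, isCompact_empty, IsGδ.empty⟩ MeasurableSet.univ (measure_ne_top _ _) hε
  refine ⟨K, hKm, hK, hKG, ?_⟩
  rw [← measure_add_measure_compl hKm] at h
  exact lt_of_add_lt_add_left h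

section LocallyCompact

variable [LocallyCompactSpace X] [T2Space X]

/-- Urysohn's lemma for a compact `Gδ` set gives a compactly supported function which equals one
exactly on that set. -/
theorem measurableSet_baireC_of_isCompact_isGδ {K : Set X} (hK : IsCompact K) (hKG : IsGδ K) :
    MeasurableSet[baireC X] K := by
  obtain ⟨f, hfK, -, hf, -⟩ := exists_continuous_one_zero_of_isCompact_of_isGδ hK hKG isClosed_empty
    (Set.disjoint_empty K)
  let g : C_c(X, ℂ) := ⟨⟨fun x => (f x : ℂ), by fun_prop⟩, hf.comp_left (g := fun r : ℝ => (r : ℂ)) rfl⟩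
  have h : K = g ⁻¹' {1} := by
    rw [hfK]
    ext x
    change f x = 1 ↔ (f x : ℂ) = 1
    norm_cast
  rw [h]
  exact measurable_baireC g (measurableSet_singleton 1)

/-- The level set at height one of a compactly supported Urysohn function for `K` is closed, a `Gδ`,
and contained in the support. -/
theorem exists_isCompact_isGδ_superset {K : Set X} (hK : IsCompact K) :
    ∃ L, K ⊆ L ∧ IsCompact L ∧ IsGδ L := by
  obtain ⟨f, hfK, -, hf, -⟩ := exists_continuous_one_zero_of_isCompact hK isClosed_empty
    (Set.disjoint_empty K)
  refine ⟨f ⁻¹' {1}, hfK, hf.isCompact.of_isClosed_subset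
    (isClosed_singleton.preimage f.continuous) fun x hx => subset_tsupport f ?_,
    isClosed_singleton.isGδ.preimage f.continuous⟩
  rw [Set.mem_preimage, Set.mem_singleton_iff] at hx
  simp [hx]

/-- If a Urysohn function `f` equals one exactly on `K`, its powers converge pointwise to the
indicator of `K`, and dominated convergence turns equality of integrals into equality of the
measures of `K`. -/
theorem measure_eq_of_integral_eq {m : MeasurableSpace X} (hm : baireC X ≤ m) (μ ν : Measure X)
    [IsProbabilityMeasure μ] [IsProbabilityMeasure ν]
    (h : ∀ f : C₀(X, ℂ), ∫ x, f x ∂μ = ∫ x, f x ∂ν) {K : Set X} (hK : IsCompact K) (hKG : IsGδ K) :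
    μ K = ν K := by
  obtain ⟨f, hfK, -, hf, hf1⟩ := exists_continuous_one_zero_of_isCompact_of_isGδ hK hKG
    isClosed_empty (Set.disjoint_empty K)
  have hKm : MeasurableSet K := hm _ (measurableSet_baireC_of_isCompact_isGδ hK hKG)
  -- The exponent is `n + 1` because the zeroth power is the constant one, which need not vanish at
  -- infinity.
  let g (n : ℕ) : C₀(X, ℂ) := ⟨⟨fun x => (f x : ℂ) ^ (n + 1), by fun_prop⟩,
    (hf.comp_left (g := fun r : ℝ => (r : ℂ) ^ (n + 1)) (by simp)).is_zero_at_infty⟩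
  have key (ρ : Measure X) [IsProbabilityMeasure ρ] :
      Tendsto (fun n => ∫ x, g n x ∂ρ) atTop (𝓝 (∫ x, K.indicator 1 x ∂ρ)) := by
    refine tendsto_integral_of_dominated_convergence (fun _ => 1) (fun n =>
      ((measurable_zeroAtInfty (g n)).mono hm le_rfl).aestronglyMeasurable)
      (integrable_const _) (fun n => Eventually.of_forall fun x => ?_)
      (Eventually.of_forall fun x => ?_)
    · change ‖(f x : ℂ) ^ (n + 1)‖ ≤ 1
      rw [norm_pow, Complex.norm_real, Real.norm_of_nonneg (hf1 x).1]
      exact pow_le_one₀ (hf1 x).1 (hf1 x).2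
    · change Tendsto (fun n => (f x : ℂ) ^ (n + 1)) _ _
      by_cases hx : x ∈ K
      · have : f x = 1 := by rwa [hfK] at hx
        simp [hx, this]
      · have h1 : f x ≠ 1 := by rwa [hfK] at hx
        rw [Set.indicator_of_notMem hx]
        refine (tendsto_pow_atTop_nhds_zero_of_norm_lt_one ?_).comp (tendsto_add_atTop_nat 1)
        rw [Complex.norm_real, Real.norm_of_nonneg (hf1 x).1]
        exact lt_of_le_of_ne (hf1 x).2 h1
  have h1 := tendsto_nhds_unique (key μ) ((key ν).congr fun n => (h (g n)).symm)
  rw [integral_indicator hKm, integral_indicator hKm] at h1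
  simp only [Pi.one_apply, integral_const, MeasurableSet.univ, measureReal_restrict_apply,
    Set.univ_inter, Complex.real_smul, mul_one, Complex.ofReal_inj] at h1
  exact (measureReal_eq_measureReal_iff (measure_ne_top _ _) (measure_ne_top _ _)).mp h1

theorem RadonProb.ext_of_isCompact_isGδ {X : Type u} [TopologicalSpace X] {m : MeasurableSpace X}
    {μ ν : RadonProb X m}
    (h : ∀ K, IsCompact K → IsGδ K → MeasurableSet K → μ.measure K = ν.measure K) : μ = ν :=
  RadonProb.ext (Measure.ext fun _ hE => μ.radon.eq_of_innerRegularWRT_of_forall_eq ν.radon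
    (fun K hK => h K hK.2.1 hK.2.2 hK.1) hE)

/-- The uniqueness half of the Riesz theorem: integrals determine the measures of compact `Gδ` sets,
and inner regularity determines the others. -/
theorem RadonProb.ext_of_integral {m : MeasurableSpace X} (hm : baireC X ≤ m) {μ ν : RadonProb X m}
    (h : ∀ f : C₀(X, ℂ), ∫ x, f x ∂μ.measure = ∫ x, f x ∂ν.measure) : μ = ν :=
  RadonProb.ext_of_isCompact_isGδ fun _ hK hKG _ =>
    measure_eq_of_integral_eq hm μ.measure ν.measure h hK hKG

/-- Compact `Gδ` sets already lie in the smaller `σ`-algebra; hence an extension to a larger one is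
unique among Radon measures. -/
theorem RadonProb.ext_of_baireC {m : MeasurableSpace X} {μ ν : RadonProb X m}
    (h : ∀ E, MeasurableSet[baireC X] E → μ.measure E = ν.measure E) : μ = ν :=
  RadonProb.ext_of_isCompact_isGδ fun _ hK hKG _ =>
    h _ (measurableSet_baireC_of_isCompact_isGδ hK hKG)

/-- The pushforward of a Radon probability measure along a continuous map. -/
def RadonProb.map {mY : MeasurableSpace Y} {mX : MeasurableSpace X}
    (hX : baireC X ≤ mX) (μ : RadonProb Y mY) (T : C(Y, X)) (hT : Measurable T)
    (hX' : IsGeneratedByContinuous mX) : RadonProb X mX :=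
  have : IsProbabilityMeasure (μ.measure.map T) := Measure.isProbabilityMeasure_map hT.aemeasurable
  RadonProb.ofTight hX' (μ.measure.map T) fun ε hε => by
    obtain ⟨K, -, hK, -, hKε⟩ := μ.exists_compl_lt hε
    -- The image of `K` is compact but possibly neither `Gδ` nor measurable, so it is enlarged.
    obtain ⟨L, hKL, hL, hLG⟩ := exists_isCompact_isGδ_superset (hK.image T.continuous)
    have hLm := hX _ (measurableSet_baireC_of_isCompact_isGδ hL hLG)
    refine ⟨L, hLm, hL, hLG, ?_⟩
    rw [Measure.map_apply hT hLm.compl]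
    exact (measure_mono fun x (hx : T x ∉ L) hxK => hx (hKL ⟨x, hxK, rfl⟩)).trans_lt hKε

/-- A continuous map preserves Radon probability measures if it preserves the integrals of
functions which vanish at infinity. -/
theorem PreservesPrb.of_integral {mY : MeasurableSpace Y}
    {mX : MeasurableSpace X} (hX : baireC X ≤ mX) (hX' : IsGeneratedByContinuous mX)
    {μ : RadonProb Y mY} {ν : RadonProb X mX} {T : C(Y, X)} (hT : Measurable T)
    (h : ∀ f : C₀(X, ℂ), ∫ y, f (T y) ∂μ.measure = ∫ x, f x ∂ν.measure) : PreservesPrb T μ ν := by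
  -- The pushforward is itself Radon, so agreement of `C₀` integrals identifies it with `ν`.
  have h1 : μ.map hX T hT hX' = ν := RadonProb.ext_of_integral hX fun f => by
    rw [← h]
    exact integral_map hT.aemeasurable
      ((measurable_zeroAtInfty f).mono hX le_rfl).aestronglyMeasurable
  intro E hE
  rw [← h1]
  exact (Measure.map_apply hT hE).symm

/-- The trace of `baireB X` on a compact set which belongs to `baireC X` is contained in
`baireC X`. -/
theorem measurableSet_inter_of_isCompact {E K : Set X} (hE : MeasurableSet[baireB X] E)
    (hK : IsCompact K) (hKm : MeasurableSet[baireC X] K) : MeasurableSet[baireC X] (E ∩ K) := by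
  rw [baireB, MeasurableSpace.measurableSet_iSup] at hE
  induction hE with
  | basic E h =>
    obtain ⟨f, B, hB, rfl⟩ := h
    obtain ⟨e, heK, -, he, -⟩ := exists_continuous_one_zero_of_isCompact hK isClosed_empty
      (Set.disjoint_empty K)
    -- Multiplying by a cutoff which is one on `K` makes `f` compactly supported without changing
    -- its trace on `K`.
    let g : C_c(X, ℂ) := ⟨⟨fun x => (e x : ℂ) * f x, by fun_prop⟩,
      (he.comp_left (g := fun r : ℝ => (r : ℂ)) rfl).mul_right⟩
    have h : f ⁻¹' B ∩ K = g ⁻¹' B ∩ K := by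
      ext x
      refine and_congr_left fun hx => ?_
      have h1 : e x = 1 := heK hx
      change f x ∈ B ↔ (e x : ℂ) * f x ∈ B
      rw [h1, Complex.ofReal_one, one_mul]
    rw [h]
    rw [← BorelSpace.measurable_eq (α := ℂ)] at hB
    exact MeasurableSet.inter (measurable_baireC g hB) hKm
  | empty => rw [Set.empty_inter]; exact @MeasurableSet.empty _ (baireC X)
  | compl E _ ih =>
    -- Complements are taken inside `K`, since `E` itself need not belong to `baireC X`.
    have h : Eᶜ ∩ K = K \ (E ∩ K) := by ext x; simp; tauto
    rw [h]
    exact MeasurableSet.diff hKm ih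
  | iUnion E _ ih =>
    rw [Set.iUnion_inter]
    exact MeasurableSet.iUnion ih

/-- By tightness `μ` is carried by a countable union `S` of compact sets of `baireC X`, and the two
`σ`-algebras have the same trace on `S`. A map which is the identity on `S` and constant elsewhere
is therefore measurable from the small to the large `σ`-algebra, and the pushforward of `μ` along it
is the extension. -/
theorem exists_extension (μ : RadonProb X (baireC X)) :
    ∃ ν : RadonProb X (baireB X), ∀ E, MeasurableSet[baireC X] E → ν.measure E = μ.measure E := by
  classical
  choose K hKm hK hKG hKε using fun n : ℕ => μ.exists_compl_lt (ε := ((n : ENNReal) + 1)⁻¹)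
    (by simp)
  let S : Set X := ⋃ n, K n
  have hS : MeasurableSet[baireC X] S := MeasurableSet.iUnion hKm
  have hS0 : μ.measure Sᶜ = 0 := by
    refine le_antisymm (ge_of_tendsto' (f := fun n : ℕ => ((n : ENNReal) + 1)⁻¹) (x := atTop) ?_ fun n =>
      (measure_mono (Set.compl_subset_compl.mpr (Set.subset_iUnion K n))).trans (hKε n).le) zero_le
    have h := ENNReal.tendsto_inv_nat_nhds_zero.comp (tendsto_add_atTop_nat 1)
    simpa [Function.comp_def] using h
  have : Nonempty X := nonempty_of_radonProb μ
  -- The value off `S` is irrelevant, because the complement of `S` is a null set.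
  let T : X → X := fun x => if x ∈ S then x else Classical.arbitrary X
  have hT1 : ∀ x ∈ S, T x = x := fun x hx => if_pos hx
  have hT : Measurable[baireC X, baireB X] T := by
    intro E hE
    have h1 : MeasurableSet[baireC X] (E ∩ S) := by
      rw [Set.inter_iUnion]
      exact MeasurableSet.iUnion fun n => measurableSet_inter_of_isCompact hE (hK n) (hKm n)
    by_cases hE0 : Classical.arbitrary X ∈ E
    · have : T ⁻¹' E = (E ∩ S) ∪ Sᶜ := by
        ext x
        by_cases hx : x ∈ S <;> simp [T, hx, hE0]
      rw [this]
      exact h1.union hS.compl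
    · have : T ⁻¹' E = E ∩ S := by
        ext x
        by_cases hx : x ∈ S <;> simp [T, hx, hE0]
      rwa [this]
  have hTE (E : Set X) : μ.measure (T ⁻¹' E) = μ.measure E := by
    refine measure_congr ?_
    have h : ∀ᵐ x ∂μ.measure, x ∈ S := by rw [ae_iff]; exact hS0
    filter_upwards [h] with x hx
    change (T x ∈ E) = (x ∈ E)
    rw [hT1 x hx]
  let ν : @Measure X (baireB X) := @Measure.map X X (baireC X) (baireB X) T μ.measure
  have hν (E : Set X) (hE : MeasurableSet[baireB X] E) : ν E = μ.measure E := by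
    rw [← hTE]
    exact @Measure.map_apply X X (baireC X) (baireB X) μ.measure T hT E hE
  have : IsProbabilityMeasure ν := ⟨by rw [hν _ MeasurableSet.univ, measure_univ]⟩
  refine ⟨RadonProb.ofTight (isGeneratedByContinuous_baireB X) ν fun ε hε => ?_, fun E hE =>
    hν E (baireC_le_baireB _ hE)⟩
  obtain ⟨K, hKm, hK, hKG, hKε⟩ := μ.exists_compl_lt hε
  have hKm' := baireC_le_baireB _ hKm
  exact ⟨K, hKm', hK, hKG, by rwa [hν _ hKm'.compl]⟩

end LocallyCompact

/-- Functions in `C₀(X)` are already `baireC X`-measurable, so their integrals see only the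
restriction of `ν`. -/
theorem integral_eq_of_baireC {μ : RadonProb X (baireC X)} {ν : RadonProb X (baireB X)}
    (h : ∀ E, MeasurableSet[baireC X] E → ν.measure E = μ.measure E) (f : C₀(X, ℂ)) :
    ∫ x, f x ∂ν.measure = ∫ x, f x ∂μ.measure := by
  have h1 : μ.measure = ν.measure.trim baireC_le_baireB :=
    @Measure.ext X (baireC X) _ _ fun E hE => by rw [trim_measurableSet_eq _ hE, h E hE]
  rw [h1, ← integral_trim baireC_le_baireB (measurable_zeroAtInfty f).stronglyMeasurable]

end BaireMeasures

/-! ### Gelfand theory without a unit. -/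

section Gelfand

variable {A B : Type u} [NonUnitalCommCStarAlgebra A] [NonUnitalCommCStarAlgebra B]

/-- The extension of a character of `A` to the unitization of `A`. -/
def specLift (φ : Spec A) : Unitization ℂ A →ₐ[ℂ] ℂ :=
  Unitization.lift (WeakDual.CharacterSpace.toNonUnitalAlgHom φ)

theorem specLift_inr (φ : Spec A) (a : A) : specLift φ (a : Unitization ℂ A) = φ a := by
  simp [specLift, Unitization.lift]

theorem specLift_apply (φ : Spec A) (x : Unitization ℂ A) : specLift φ x = x.fst + φ x.snd := by
  induction x with
  | inl_add_inr r a =>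
    rw [map_add, specLift_inr, ← Unitization.algebraMap_eq_inl, AlgHom.commutes]
    simp [Unitization.algebraMap_eq_inl]

/-- This is inherited from the extension to the unitization, where characters of a unital C⋆-algebra
preserve the involution. -/
theorem spec_map_star (φ : Spec A) (a : A) : φ (star a) = star (φ a) := by
  rw [← specLift_inr, ← specLift_inr, Unitization.inr_star]
  exact map_star (specLift φ) _

/-- A closed condition inside the compact space of characters together with zero; as `ε > 0`, it
excludes zero. This is why Gelfand transforms vanish at infinity. -/
theorem isCompact_spec_norm_ge (a : A) {ε : ℝ} (hε : 0 < ε) : IsCompact {φ : Spec A | ε ≤ ‖φ a‖} := by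
  have hc : IsClosed {φ : WeakDual ℂ A | ε ≤ ‖φ a‖} :=
    isClosed_le continuous_const (WeakDual.eval_continuous a).norm
  rw [Subtype.isCompact_iff]
  convert (isCompact_spec_union_zero A).inter_right hc using 1
  ext φ
  constructor
  · rintro ⟨φ, hφ, rfl⟩
    exact ⟨Or.inl φ.2, hφ⟩
  · rintro ⟨h | h, h'⟩
    · exact ⟨⟨φ, h⟩, h', rfl⟩
    · rw [Set.mem_singleton_iff.mp h] at h'
      have h0 : ε ≤ ‖(0 : ℂ)‖ := h'
      rw [norm_zero] at h0
      exact absurd h0 (not_le.mpr hε)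

/-- The Gelfand transform of a commutative C⋆-algebra, not necessarily unital. -/
def gelfand (A : Type u) [NonUnitalCommCStarAlgebra A] : A →⋆ₙₐ[ℂ] C₀(Spec A, ℂ) where
  toFun a :=
    { toFun := fun φ => φ a
      continuous_toFun := continuous_spec_apply a
      zero_at_infty' := by
        rw [Metric.tendsto_nhds]
        intro ε hε
        filter_upwards [(isCompact_spec_norm_ge a hε).compl_mem_cocompact] with φ hφ
        rw [dist_zero_right]
        exact not_le.mp hφ }
  map_smul' c a := ZeroAtInftyContinuousMap.ext fun φ => map_smul (φ : WeakDual ℂ A) c a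
  map_zero' := ZeroAtInftyContinuousMap.ext fun φ => map_zero (φ : WeakDual ℂ A)
  map_add' a b := ZeroAtInftyContinuousMap.ext fun φ => map_add (φ : WeakDual ℂ A) a b
  map_mul' a b := ZeroAtInftyContinuousMap.ext fun φ => spec_map_mul φ a b
  map_star' a := ZeroAtInftyContinuousMap.ext fun φ => spec_map_star φ a

/-- The restriction of a character of the unitization of `A` to `A`; it may vanish. -/
def unitizationRestrict (ψ : WeakDual.characterSpace ℂ (Unitization ℂ A)) : WeakDual ℂ A :=
  (ψ : WeakDual ℂ (Unitization ℂ A)).comp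
    (⟨(Unitization.inrNonUnitalStarAlgHom ℂ A : A →ₗ[ℂ] Unitization ℂ A),
      Unitization.isometry_inr.continuous⟩ : A →L[ℂ] Unitization ℂ A)

theorem unitizationRestrict_apply (ψ : WeakDual.characterSpace ℂ (Unitization ℂ A)) (a : A) :
    unitizationRestrict ψ a = ψ (a : Unitization ℂ A) := rfl

theorem unitizationRestrict_mem (ψ : WeakDual.characterSpace ℂ (Unitization ℂ A)) :
    unitizationRestrict ψ ∈ WeakDual.characterSpace ℂ A ∪ {0} := by
  by_cases h : unitizationRestrict ψ = 0
  · exact Or.inr h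
  · refine Or.inl ⟨h, fun a b => ?_⟩
    rw [unitizationRestrict_apply, Unitization.inr_mul, map_mul]
    rfl

open Classical in
/-- The extension of a function on the spectrum by zero. -/
def specExtend (f : C₀(Spec A, ℂ)) (η : WeakDual ℂ A) : ℂ :=
  if h : η ∈ WeakDual.characterSpace ℂ A then f ⟨η, h⟩ else 0

theorem specExtend_coe (f : C₀(Spec A, ℂ)) (φ : Spec A) : specExtend f φ = f φ := dif_pos φ.2

theorem specExtend_zero (f : C₀(Spec A, ℂ)) : specExtend f 0 = 0 := dif_neg fun h => h.1 rfl

/-- The zero functional plays the role of the point at infinity: near a character all points are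
nonzero and continuity of `f` applies, whereas at zero vanishing at infinity is exactly what is
needed. -/
theorem continuousOn_specExtend (f : C₀(Spec A, ℂ)) :
    ContinuousOn (specExtend f) (WeakDual.characterSpace ℂ A ∪ {0}) := by
  rintro η (hη | hη)
  · have h1 : ContinuousOn (specExtend f) (WeakDual.characterSpace ℂ A) := by
      rw [continuousOn_iff_continuous_domRestrict]
      exact f.continuous.congr fun φ => (specExtend_coe f φ).symm
    refine (h1 η hη).mono_of_mem_nhdsWithin ?_
    have h2 : {η : WeakDual ℂ A | η ≠ 0} ∈ 𝓝 η := isOpen_ne.mem_nhds hη.1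
    filter_upwards [mem_nhdsWithin_of_mem_nhds h2, self_mem_nhdsWithin] with ξ h3 h4
    exact h4.resolve_right h3
  · rw [Set.mem_singleton_iff.mp hη]
    change Tendsto _ _ _
    rw [specExtend_zero, Metric.tendsto_nhds]
    intro ε hε
    have h1 := f.zero_at_infty'
    rw [Metric.tendsto_nhds] at h1
    obtain ⟨K, hK, hKf⟩ := Filter.mem_cocompact.mp (h1 ε hε)
    have h2 : IsClosed ((↑) '' K : Set (WeakDual ℂ A)) := (hK.image continuous_subtype_val).isClosed
    -- A compact set of characters stays away from the zero functional, so functionals near zero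
    -- avoid the set where `f` may be large.
    have h3 : ((↑) '' K : Set (WeakDual ℂ A))ᶜ ∈ 𝓝 0 := h2.isOpen_compl.mem_nhds (by
      rintro ⟨φ, -, hφ⟩
      exact φ.2.1 hφ)
    refine mem_nhdsWithin_of_mem_nhds ?_
    filter_upwards [h3] with ξ hξ
    by_cases h : ξ ∈ WeakDual.characterSpace ℂ A
    · rw [specExtend, dif_pos h]
      exact hKf fun hK' => hξ ⟨_, hK', rfl⟩
    · rw [specExtend, dif_neg h, dist_self]
      exact hε

theorem continuous_unitizationRestrict :
    Continuous (unitizationRestrict : WeakDual.characterSpace ℂ (Unitization ℂ A) → WeakDual ℂ A) :=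
  WeakDual.continuous_of_continuous_eval fun a =>
    (WeakDual.eval_continuous (a : Unitization ℂ A)).comp continuous_subtype_val

/-- Reduction to the unital theorem for the unitization, whose characters restrict on `A` to
characters or to zero. For injectivity, all these restrictions kill `a`. For surjectivity, `f` is
extended by zero and pulled back to the spectrum of the unitization, where it is the transform of
some `x`; the character `a + c ↦ c` then shows that `x` lies in `A`. -/
theorem gelfand_bijective : Function.Bijective (gelfand A) := by
  constructor
  · rw [injective_iff_map_eq_zero]
    intro a ha
    apply Unitization.inr_injective (R := ℂ)
    rw [Unitization.inr_zero]
    apply (gelfandStarTransform (Unitization ℂ A)).injective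
    rw [map_zero]
    ext ψ
    change unitizationRestrict ψ a = 0
    rcases unitizationRestrict_mem ψ with h | h
    · exact DFunLike.congr_fun ha (⟨_, h⟩ : Spec A)
    · rw [Set.mem_singleton_iff.mp h]
      rfl
  · intro f
    let F : C(WeakDual.characterSpace ℂ (Unitization ℂ A), ℂ) :=
      ⟨fun ψ => specExtend f (unitizationRestrict ψ),
        (continuousOn_specExtend f).comp_continuous continuous_unitizationRestrict
          unitizationRestrict_mem⟩
    obtain ⟨x, hx⟩ := (gelfandStarTransform (Unitization ℂ A)).surjective F
    have hx' (ψ : WeakDual.characterSpace ℂ (Unitization ℂ A)) :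
        ψ x = specExtend f (unitizationRestrict ψ) := DFunLike.congr_fun hx ψ
    -- The character `Unitization.fstHom` restricts to zero on `A`, and the extended function is
    -- zero there.
    have h0 : x.fst = 0 := by
      have h := hx' (WeakDual.CharacterSpace.equivAlgHom.symm (Unitization.fstHom ℂ A))
      have h1 : unitizationRestrict
          (WeakDual.CharacterSpace.equivAlgHom.symm (Unitization.fstHom ℂ A)) = 0 :=
        ContinuousLinearMap.ext fun a => rfl
      rw [h1, specExtend_zero] at h
      exact h
    refine ⟨x.snd, ZeroAtInftyContinuousMap.ext fun φ => ?_⟩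
    have h := hx' (WeakDual.CharacterSpace.equivAlgHom.symm (specLift φ))
    have h1 : unitizationRestrict (WeakDual.CharacterSpace.equivAlgHom.symm (specLift φ)) =
        (φ : WeakDual ℂ A) := ContinuousLinearMap.ext fun a => specLift_inr φ a
    rw [h1, specExtend_coe] at h
    rw [← h]
    change φ x.snd = specLift φ x
    rw [specLift_apply, h0, zero_add]

/-- The Gelfand isomorphism. -/
def gelfandEquiv (A : Type u) [NonUnitalCommCStarAlgebra A] : A ≃⋆ₐ[ℂ] C₀(Spec A, ℂ) :=
  StarAlgEquiv.ofBijective (gelfand A) gelfand_bijective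

end Gelfand

/-! ### Evaluation characters: the one-point compactification and the spectrum of `C₀(X)`. -/

section Evaluation

variable (X : Type u) [TopologicalSpace X] [T2Space X]

/-- The extension of a function which vanishes at infinity to the one-point compactification. -/
def onePointExtend : C₀(X, ℂ) →⋆ₙₐ[ℂ] C(OnePoint X, ℂ) where
  toFun f := OnePoint.continuousMapMk f.toContinuousMap 0 (by
    rw [coclosedCompact_eq_cocompact]
    exact f.zero_at_infty')
  map_smul' c f := ContinuousMap.ext fun x => by
    induction x using OnePoint.rec
    · exact (smul_zero c).symm
    · rfl
  map_zero' := ContinuousMap.ext fun x => by induction x using OnePoint.rec <;> rfl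
  map_add' f g := ContinuousMap.ext fun x => by
    induction x using OnePoint.rec
    · exact (add_zero 0).symm
    · rfl
  map_mul' f g := ContinuousMap.ext fun x => by
    induction x using OnePoint.rec
    · exact (mul_zero 0).symm
    · rfl
  map_star' f := ContinuousMap.ext fun x => by
    induction x using OnePoint.rec
    · exact (star_zero ℂ).symm
    · rfl

variable {X}

theorem onePointExtend_infty (f : C₀(X, ℂ)) : onePointExtend X f OnePoint.infty = 0 := rfl

theorem starLift_onePointExtend_apply (x : Unitization ℂ C₀(X, ℂ)) (p : OnePoint X) :
    Unitization.starLift (onePointExtend X) x p = x.fst + onePointExtend X x.snd p := rfl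

/-- The value at infinity is the scalar part; subtracting it leaves a function which vanishes at
infinity. -/
theorem starLift_onePointExtend_bijective :
    Function.Bijective (Unitization.starLift (onePointExtend X)) := by
  constructor
  · rw [injective_iff_map_eq_zero]
    intro x hx
    have h (p : OnePoint X) : x.fst + onePointExtend X x.snd p = 0 := DFunLike.congr_fun hx p
    have h1 : x.fst = 0 := by
      have := h OnePoint.infty
      rwa [onePointExtend_infty, add_zero] at this
    refine Unitization.ext h1 (ZeroAtInftyContinuousMap.ext fun y => ?_)
    have := h y
    rwa [h1, zero_add] at this
  · intro F
    let f : C₀(X, ℂ) :=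
      { toFun := fun x => F x - F OnePoint.infty
        continuous_toFun := (F.continuous.comp OnePoint.continuous_coe).sub continuous_const
        zero_at_infty' := by
          have h := (F.continuous.tendsto OnePoint.infty).comp (OnePoint.tendsto_coe_infty (X := X))
          rw [coclosedCompact_eq_cocompact] at h
          simpa using h.sub_const (F OnePoint.infty) }
    refine ⟨Unitization.inl (F OnePoint.infty) + (f : Unitization ℂ C₀(X, ℂ)),
      ContinuousMap.ext fun p => ?_⟩
    rw [starLift_onePointExtend_apply]
    simp only [Unitization.fst_add, Unitization.fst_inl, Unitization.fst_inr, add_zero,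
      Unitization.snd_add, Unitization.snd_inl, Unitization.snd_inr, zero_add]
    induction p using OnePoint.rec with
    | infty => rw [onePointExtend_infty, add_zero]
    | coe x => exact add_sub_cancel _ _

variable (X) in
/-- The unitization of `C₀(X)` is the algebra of continuous functions on the one-point
compactification of `X`. -/
def unitizationEquiv : Unitization ℂ C₀(X, ℂ) ≃⋆ₐ[ℂ] C(OnePoint X, ℂ) :=
  StarAlgEquiv.ofBijective (Unitization.starLift (onePointExtend X))
    starLift_onePointExtend_bijective

theorem unitizationEquiv_apply (x : Unitization ℂ C₀(X, ℂ)) (p : OnePoint X) :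
    unitizationEquiv X x p = x.fst + onePointExtend X x.snd p := rfl

variable [LocallyCompactSpace X]

theorem exists_zeroAtInfty_separating (x : X) {U : Set X} (hU : U ∈ 𝓝 x) :
    ∃ f : C₀(X, ℂ), f x = 1 ∧ ∀ y ∉ U, f y = 0 := by
  obtain ⟨V, hVU, hV, hxV⟩ := mem_nhds_iff.mp hU
  obtain ⟨f, h1, h0, hf, -⟩ := exists_continuous_one_zero_of_isCompact isCompact_singleton
    hV.isClosed_compl (Set.disjoint_compl_right_iff_subset.mpr (Set.singleton_subset_iff.mpr hxV))
  refine ⟨⟨⟨fun x => (f x : ℂ), by fun_prop⟩,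
    (hf.comp_left (g := fun r : ℝ => (r : ℂ)) rfl).is_zero_at_infty⟩, ?_, fun y hy => ?_⟩
  · change (f x : ℂ) = 1
    rw [h1 rfl]
    norm_num
  · change (f y : ℂ) = 0
    rw [h0 fun h => hy (hVU h)]
    norm_num

variable (X) in
/-- Evaluation, as a map from `X` to the spectrum of `C₀(X)`. -/
def evSpec₀ : C(X, Spec C₀(X, ℂ)) where
  toFun x := ⟨(⟨{ toFun := fun f : C₀(X, ℂ) => f x, map_add' := fun _ _ => rfl,
                  map_smul' := fun _ _ => rfl },
      AddMonoidHomClass.continuous_of_bound (LinearMap.mk ⟨fun f : C₀(X, ℂ) => f x, fun _ _ => rfl⟩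
        fun (_ : ℂ) _ => rfl) 1 fun f => by
          rw [one_mul]
          exact norm_zeroAtInfty_le f x⟩ : C₀(X, ℂ) →L[ℂ] ℂ), by
    refine ⟨fun h => ?_, fun _ _ => rfl⟩
    obtain ⟨f, hf, -⟩ := exists_zeroAtInfty_separating x univ_mem
    have h1 : f x = 0 := DFunLike.congr_fun h f
    exact one_ne_zero (hf.symm.trans h1)⟩
  continuous_toFun := continuous_to_spec fun f => f.continuous

theorem evSpec₀_injective : Function.Injective (evSpec₀ X) := by
  intro x y hxy
  by_contra h
  obtain ⟨f, hf, hf0⟩ := exists_zeroAtInfty_separating x (isOpen_ne.mem_nhds h)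
  have h1 : f x = f y := DFunLike.congr_fun hxy f
  rw [hf, hf0 y fun h => h rfl] at h1
  exact one_ne_zero h1

/-- A function `f` with `f x = 1` that is zero off `U` gives the open set of characters `φ` with `φ
f ≠ 0`, whose preimage is a neighbourhood of `x` inside `U`. -/
theorem evSpec₀_isInducing : Topology.IsInducing (evSpec₀ X) := by
  rw [Topology.isInducing_iff_nhds]
  intro x
  refine le_antisymm (evSpec₀ X).continuous.continuousAt.le_comap fun U hU => ?_
  obtain ⟨f, hf, hf0⟩ := exists_zeroAtInfty_separating x hU
  refine ⟨{φ | φ f ≠ 0}, (isOpen_ne_fun (continuous_spec_apply f) continuous_const).mem_nhds ?_,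
    fun y hy => ?_⟩
  · change f x ≠ 0
    rw [hf]
    exact one_ne_zero
  · by_contra h
    exact hy (hf0 y h)

/-- A character of `C₀(X)` extends to the unitization, which is `C(X⁺)` for the one-point
compactification `X⁺`; there it is evaluation at a point by the compact case. -/
theorem evSpec₀_surjective : Function.Surjective (evSpec₀ X) := by
  intro φ
  let χ : C(OnePoint X, ℂ) →ₐ[ℂ] ℂ :=
    (specLift φ).comp ((unitizationEquiv X).symm : C(OnePoint X, ℂ) →⋆ₐ[ℂ] _).toAlgHom
  obtain ⟨p, hp⟩ := (WeakDual.CharacterSpace.continuousMapEval_bijective (OnePoint X) ℂ).surjective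
    (WeakDual.CharacterSpace.equivAlgHom.symm χ)
  have h (f : C₀(X, ℂ)) : φ f = onePointExtend X f p := by
    have h1 : unitizationEquiv X f p = χ (unitizationEquiv X f) :=
      DFunLike.congr_fun hp (unitizationEquiv X (f : Unitization ℂ C₀(X, ℂ)))
    have h2 : χ (unitizationEquiv X f) = φ f := by
      change specLift φ ((unitizationEquiv X).symm (unitizationEquiv X f)) = _
      rw [StarAlgEquiv.symm_apply_apply, specLift_inr]
    rw [h2, unitizationEquiv_apply, Unitization.fst_inr, zero_add, Unitization.snd_inr] at h1
    exact h1.symm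
  induction p using OnePoint.rec with
  | infty =>
    -- Evaluation at infinity would make `φ` zero on all of `C₀(X)`.
    exact absurd (ContinuousLinearMap.ext h) φ.2.1
  | coe x => exact ⟨x, WeakDual.CharacterSpace.ext fun f => (h f).symm⟩

variable (X) in
/-- A locally compact Hausdorff space is homeomorphic to the spectrum of `C₀(X)`. -/
def homeoSpec₀ : X ≃ₜ Spec C₀(X, ℂ) :=
  (Equiv.ofBijective _ ⟨evSpec₀_injective, evSpec₀_surjective⟩).toHomeomorphOfIsInducing
    evSpec₀_isInducing

end Evaluation

/-! ### Multipliers as bounded continuous functions. -/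

section MultiplierEvaluation

variable {B : Type u} [NonUnitalCommCStarAlgebra B]

/-- The element in the defining quotient varies with the character without any continuity, but a
single `c` with `φ c ≠ 0` serves on a neighbourhood of `φ`. -/
theorem continuous_specEval (m : 𝓜(ℂ, B)) : Continuous fun φ : Spec B => specEval φ m := by
  rw [continuous_iff_continuousAt]
  intro φ
  obtain ⟨c, hc⟩ := spec_exists_ne_zero φ
  have h1 : ContinuousAt (fun ψ : Spec B => ψ (m.fst c) / ψ c) φ :=
    (continuous_spec_apply _).continuousAt.div (continuous_spec_apply _).continuousAt hc
  refine h1.congr ?_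
  filter_upwards [(continuous_spec_apply c).continuousAt.eventually_ne hc] with ψ hψ
  rw [← specEval_mul, mul_div_assoc, div_self hψ, mul_one]

/-- The extension of a character to the multiplier algebra, as a homomorphism. -/
def specEvalHom (φ : Spec B) : 𝓜(ℂ, B) →ₐ[ℂ] ℂ :=
  AlgHom.ofLinearMap
    { toFun := specEval φ
      map_add' := fun m n => by
        obtain ⟨c, hc⟩ := spec_exists_ne_zero φ
        refine specEval_eq hc ?_
        rw [add_mul, specEval_mul, specEval_mul, ← map_add]
        rfl
      map_smul' := fun z m => by
        obtain ⟨c, hc⟩ := spec_exists_ne_zero φ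
        refine specEval_eq hc ?_
        rw [RingHom.id_apply, smul_mul_assoc, specEval_mul, ← map_smul]
        rfl }
    (by
      obtain ⟨c, hc⟩ := spec_exists_ne_zero φ
      exact specEval_eq hc (one_mul _))
    (specEval_map_mul φ)

theorem norm_specEval_le (φ : Spec B) (m : 𝓜(ℂ, B)) : ‖specEval φ m‖ ≤ ‖m‖ := by
  have : Nontrivial 𝓜(ℂ, B) := (specEvalHom φ).toRingHom.domain_nontrivial
  exact AlgHom.norm_apply_le_self (specEvalHom φ) m

theorem specEval_star (φ : Spec B) (m : 𝓜(ℂ, B)) : specEval φ (star m) = star (specEval φ m) :=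
  map_star (specEvalHom φ) m

/-- The bounded continuous function on the spectrum of `B` given by an element of `M(B)`. -/
def specEvalBCF (m : 𝓜(ℂ, B)) : Spec B →ᵇ ℂ :=
  BoundedContinuousFunction.ofNormedAddCommGroup (fun φ => specEval φ m) (continuous_specEval m) ‖m‖
    fun φ => norm_specEval_le φ m

/-- A multiplier `m` acts as multiplication by its values under the extended evaluation characters,
a continuous function bounded by `‖m‖`. Injectivity holds because some `C₀` function takes the value
one at any given point. -/
theorem bcfMult_bijective (X : Type u) [TopologicalSpace X] [LocallyCompactSpace X] [T2Space X] :
    Function.Bijective (bcfMult X) := by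
  constructor
  · intro h k hhk
    ext x
    obtain ⟨f, hf, -⟩ := exists_zeroAtInfty_separating x univ_mem
    have h1 : (bcfMult X h).fst f x = (bcfMult X k).fst f x := by rw [hhk]
    rwa [bcfMult_fst, bcfMult_fst, hf, mul_one, mul_one] at h1
  · intro m
    refine ⟨(specEvalBCF m).compContinuous (evSpec₀ X), mult_ext fun f =>
      ZeroAtInftyContinuousMap.ext fun x => ?_⟩
    rw [bcfMult_fst]
    exact specEval_mul (evSpec₀ X x) m f

/-- The multiplier algebra of `C₀(X)` is `C_b(X)`. -/
def bcfMultEquiv (X : Type u) [TopologicalSpace X] [LocallyCompactSpace X] [T2Space X] :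
    (X →ᵇ ℂ) ≃⋆ₐ[ℂ] 𝓜(ℂ, C₀(X, ℂ)) :=
  StarAlgEquiv.ofBijective (bcfMult X) (bcfMult_bijective X)

end MultiplierEvaluation

/-! ### States as integrals: the Riesz representation. -/

section RieszRepresentation

variable {A B : Type u} [NonUnitalCommCStarAlgebra A] [NonUnitalCommCStarAlgebra B]

/-- Only the lower bound on the norm is at issue, and it passes from `τ` to `σ` because `j` is
contractive. -/
theorem IsState.of_extends {τ : A →L[ℂ] ℂ} (hτ : IsState τ) {σ : B →L[ℂ] ℂ} (j : A →⋆ₙₐ[ℂ] B)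
    (hσ : ∀ b, 0 ≤ σ (star b * b)) (hσ1 : ‖σ‖ ≤ 1) (h : ∀ a, σ (j a) = τ a) : IsState σ := by
  refine ⟨hσ, le_antisymm hσ1 ?_⟩
  rw [← hτ.norm_eq_one]
  refine ContinuousLinearMap.opNorm_le_bound _ (norm_nonneg _) fun a => ?_
  rw [← h]
  refine (σ.le_opNorm _).trans ?_
  gcongr
  exact NonUnitalStarAlgHom.norm_apply_le j a

variable {X : Type u} [TopologicalSpace X]

/-- A compactly supported real function, as a complex function which vanishes at infinity. -/
def complexify : C_c(X, ℝ) →ₗ[ℝ] C₀(X, ℂ) where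
  toFun f := ⟨⟨fun x => (f x : ℂ), by fun_prop⟩,
    (f.hasCompactSupport.comp_left (g := fun r : ℝ => (r : ℂ)) rfl).is_zero_at_infty⟩
  map_add' f g := ZeroAtInftyContinuousMap.ext fun x => Complex.ofReal_add (f x) (g x)
  map_smul' c f := ZeroAtInftyContinuousMap.ext fun x => by
    change ((c * f x : ℝ) : ℂ) = c • (f x : ℂ)
    rw [Complex.ofReal_mul, Complex.real_smul]

theorem complexify_apply (f : C_c(X, ℝ)) (x : X) : complexify f x = f x := rfl

/-- A nonnegative compactly supported function is the square of its square root, which is again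
compactly supported. -/
theorem IsState.complexify_nonneg {θ : C₀(X, ℂ) →L[ℂ] ℂ} (hθ : IsState θ) {f : C_c(X, ℝ)}
    (hf : ∀ x, 0 ≤ f x) : 0 ≤ θ (complexify f) := by
  let g : C₀(X, ℂ) := ⟨⟨fun x => (√(f x) : ℂ), by fun_prop⟩,
    (f.hasCompactSupport.comp_left (g := fun r : ℝ => (√r : ℂ)) (by simp)).is_zero_at_infty⟩
  have h : complexify f = star g * g := ZeroAtInftyContinuousMap.ext fun x => by
    change (f x : ℂ) = star (√(f x) : ℂ) * (√(f x) : ℂ)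
    rw [Complex.star_def, Complex.conj_ofReal, ← Complex.ofReal_mul, Real.mul_self_sqrt (hf x)]
  rw [h]
  exact hθ.nonneg g

/-- A real function is a difference of nonnegative ones, on which the state takes nonnegative real
values. -/
theorem IsState.complexify_im {θ : C₀(X, ℂ) →L[ℂ] ℂ} (hθ : IsState θ) (f : C_c(X, ℝ)) :
    (θ (complexify f)).im = 0 := by
  have h : f = (f ⊔ 0) - ((f ⊔ 0) - f) := by simp
  have h1 := hθ.complexify_nonneg (f := f ⊔ 0) fun x => le_max_right _ _
  have h2 := hθ.complexify_nonneg (f := (f ⊔ 0) - f) fun x => sub_nonneg.mpr (le_max_left _ _)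
  rw [h, map_sub, map_sub, Complex.sub_im, ← (Complex.le_def.mp h1).2, ← (Complex.le_def.mp h2).2]
  simp

/-- The real part of a state, as a positive functional on the compactly supported real functions. -/
def IsState.rePositive {θ : C₀(X, ℂ) →L[ℂ] ℂ} (hθ : IsState θ) : C_c(X, ℝ) →ₚ[ℝ] ℝ :=
  PositiveLinearMap.mk₀ (Complex.reLm ∘ₗ (θ : C₀(X, ℂ) →ₗ[ℂ] ℂ).restrictScalars ℝ ∘ₗ complexify)
    fun _ hf => (Complex.le_def.mp (hθ.complexify_nonneg hf)).1

theorem IsState.rePositive_apply {θ : C₀(X, ℂ) →L[ℂ] ℂ} (hθ : IsState θ) (f : C_c(X, ℝ)) :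
    θ (complexify f) = hθ.rePositive f :=
  Complex.ext rfl (hθ.complexify_im f)

variable [LocallyCompactSpace X] [T2Space X]

/-- With a cutoff `e` which is one where `f` is not small, the error is `(1 - e) f`. Thus identities
for compactly supported real functions extend to `C₀(X)` by linearity and density. -/
theorem exists_complexify_near (f : C₀(X, ℂ)) {ε : ℝ} (hε : 0 < ε) :
    ∃ g h : C_c(X, ℝ), ‖f - (complexify g + Complex.I • complexify h)‖ ≤ ε := by
  have h1 := f.zero_at_infty'
  rw [Metric.tendsto_nhds] at h1
  obtain ⟨K, hK, hKf⟩ := Filter.mem_cocompact.mp (h1 ε hε)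
  obtain ⟨e, he1, -, he, he01⟩ := exists_continuous_one_zero_of_isCompact hK isClosed_empty
    (Set.disjoint_empty K)
  refine ⟨⟨⟨fun x => e x * (f x).re, by fun_prop⟩, he.mul_right⟩,
    ⟨⟨fun x => e x * (f x).im, by fun_prop⟩, he.mul_right⟩,
    norm_zeroAtInfty_le_iff _ hε.le fun x => ?_⟩
  change ‖f x - (((e x * (f x).re : ℝ) : ℂ) + Complex.I * ((e x * (f x).im : ℝ) : ℂ))‖ ≤ ε
  have h2 : f x - (((e x * (f x).re : ℝ) : ℂ) + Complex.I * ((e x * (f x).im : ℝ) : ℂ)) =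
      ((1 - e x : ℝ) : ℂ) * f x := by
    push_cast
    linear_combination -(e x : ℂ) * Complex.re_add_im (f x)
  rw [h2]
  by_cases hx : x ∈ K
  · simp [he1 hx, hε.le]
  · have h3 : ‖f x‖ < ε := by simpa using hKf hx
    rw [norm_mul, Complex.norm_real, Real.norm_of_nonneg (by linarith [(he01 x).2])]
    nlinarith [(he01 x).1, (he01 x).2, norm_nonneg (f x)]

/-- The restriction of a Radon probability measure to the `σ`-algebra generated by the compactly
supported functions. -/
def RadonProb.restrictC (μ : RadonProb X (baireB X)) : RadonProb X (baireC X) :=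
  RadonProb.map le_rfl μ (ContinuousMap.id X) (measurable_id'' baireC_le_baireB)
    (isGeneratedByContinuous_baireC X)

theorem RadonProb.restrictC_apply (μ : RadonProb X (baireB X)) {E : Set X}
    (hE : MeasurableSet[baireC X] E) : μ.restrictC.measure E = μ.measure E :=
  @Measure.map_apply X X (baireB X) (baireC X) μ.measure id (measurable_id'' baireC_le_baireB) E hE

/-- The Riesz–Markov–Kakutani theorem for the real part of `θ` gives a regular Borel measure `ρ`.
The norm of `θ` bounds its mass by one, density extends the representation from compactly supported
functions to `C₀(X)`, and the representation in turn forces mass one. The required measure is the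
restriction of `ρ` to the Baire sets. -/
theorem exists_radonProb_of_isState {θ : C₀(X, ℂ) →L[ℂ] ℂ} (hθ : IsState θ) :
    ∃ μ : RadonProb X (baireB X), ∀ f : C₀(X, ℂ), ∫ x, f x ∂μ.measure = θ f := by
  let _ : MeasurableSpace X := borel X
  have : BorelSpace X := ⟨rfl⟩
  let ρ : Measure X := RealRMK.rieszMeasure hθ.rePositive
  have hρ : ρ.Regular := RealRMK.regular_rieszMeasure _
  -- By inner regularity it suffices to bound `ρ K` for compact `K`, and it is at most the value of
  -- `θ` on a cutoff of norm at most one.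
  have hρ1 : ρ Set.univ ≤ 1 := by
    rw [isOpen_univ.measure_eq_iSup_isCompact]
    refine iSup_le fun K => iSup_le fun _ => iSup_le fun hK => ?_
    obtain ⟨e, he1, -, he, he01⟩ := exists_continuous_one_zero_of_isCompact hK isClosed_empty
      (Set.disjoint_empty K)
    refine (RealRMK.rieszMeasure_le_of_eq_one hθ.rePositive (f := ⟨e, he⟩) (fun x => (he01 x).1)
      hK he1).trans (ENNReal.ofReal_le_one.mpr ?_)
    have h1 : ‖θ (complexify ⟨e, he⟩)‖ ≤ 1 := by
      refine (θ.le_opNorm _).trans ?_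
      rw [hθ.norm_eq_one, one_mul]
      refine norm_zeroAtInfty_le_iff _ zero_le_one fun x => ?_
      rw [complexify_apply, Complex.norm_real]
      exact (Real.norm_of_nonneg (he01 x).1).trans_le (he01 x).2
    rw [hθ.rePositive_apply, Complex.norm_real] at h1
    exact (le_abs_self _).trans h1
  have hfin : IsFiniteMeasure ρ := ⟨hρ1.trans_lt ENNReal.one_lt_top⟩
  have hint (f : C₀(X, ℂ)) : Integrable f ρ :=
    Integrable.of_bound f.continuous.measurable.aestronglyMeasurable ‖f‖
      (Eventually.of_forall (norm_zeroAtInfty_le f))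
  have hbound (f : C₀(X, ℂ)) (C : ℝ) (hC : ∀ x, ‖f x‖ ≤ C) :
      ‖∫ x, f x ∂ρ‖ ≤ C * ρ.real Set.univ :=
    norm_integral_le_of_norm_le_const (Eventually.of_forall hC)
  have hreal (g : C_c(X, ℝ)) : ∫ x, complexify g x ∂ρ = θ (complexify g) := by
    rw [hθ.rePositive_apply, ← RealRMK.integral_rieszMeasure]
    exact integral_complex_ofReal
  have hρ1' : ρ.real Set.univ ≤ 1 := ENNReal.toReal_le_of_le_ofReal zero_le_one (by simpa using hρ1)
  have key (f : C₀(X, ℂ)) : ∫ x, f x ∂ρ = θ f := by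
    rw [← sub_eq_zero, ← norm_le_zero_iff]
    refine le_of_forall_pos_le_add fun ε hε => ?_
    -- Both functionals have norm at most one, so each contributes at most `ε / 2` on the remainder.
    obtain ⟨g, h, hgh⟩ := exists_complexify_near f (half_pos hε)
    set k := complexify g + Complex.I • complexify h with hk
    have h1 : ∫ x, k x ∂ρ = θ k := by
      rw [hk, map_add, map_smul, ← hreal, ← hreal, smul_eq_mul, ← integral_const_mul,
        ← integral_add (hint _) ((hint _).const_mul _)]
      rfl
    have h2 : ∫ x, f x ∂ρ - θ f = ∫ x, (f - k) x ∂ρ - θ (f - k) := by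
      have : ∫ x, (f - k) x ∂ρ = ∫ x, f x ∂ρ - ∫ x, k x ∂ρ := integral_sub (hint f) (hint k)
      rw [this, map_sub, h1]
      ring
    rw [h2, zero_add]
    have h3 := hbound (f - k) (ε / 2) fun x => (norm_zeroAtInfty_le _ x).trans hgh
    have h4 := θ.le_opNorm (f - k)
    rw [hθ.norm_eq_one, one_mul] at h4
    have h5 := norm_sub_le (∫ x, (f - k) x ∂ρ) (θ (f - k))
    nlinarith
  -- Integration against `ρ` has norm at most the mass of `ρ`, and `θ` has norm one.
  have hprob : ρ Set.univ = 1 := by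
    refine le_antisymm hρ1 ?_
    have h1 : ‖θ‖ ≤ ρ.real Set.univ :=
      ContinuousLinearMap.opNorm_le_bound _ measureReal_nonneg fun f => by
        rw [← key, mul_comm]
        exact hbound f _ (norm_zeroAtInfty_le f)
    rw [hθ.norm_eq_one] at h1
    rw [← ENNReal.ofReal_one]
    exact ENNReal.ofReal_le_of_le_toReal h1
  let ν : @Measure X (baireB X) := ρ.trim baireB_le_borel
  have hνE (E : Set X) (hE : MeasurableSet[baireB X] E) : ν E = ρ E :=
    trim_measurableSet_eq baireB_le_borel hE
  have hν : IsProbabilityMeasure ν := ⟨by rw [hνE _ MeasurableSet.univ, hprob]⟩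
  refine ⟨RadonProb.ofTight (isGeneratedByContinuous_baireB X) ν fun ε hε => ?_, fun f => ?_⟩
  · obtain ⟨K, -, hK, hKε⟩ := isOpen_univ.exists_lt_isCompact (μ := ρ)
      (r := 1 - ε) (by
        rw [hprob]
        exact ENNReal.sub_lt_self ENNReal.one_ne_top one_ne_zero hε)
    obtain ⟨L, hKL, hL, hLG⟩ := exists_isCompact_isGδ_superset hK
    have hLm := baireC_le_baireB _ (measurableSet_baireC_of_isCompact_isGδ hL hLG)
    refine ⟨L, hLm, hL, hLG, ?_⟩
    rw [hνE _ hLm.compl]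
    have h1 : 1 < ρ L + ε := by
      have := hKε.trans_le (measure_mono hKL)
      by_contra! h
      exact this.not_ge (ENNReal.le_sub_of_add_le_right
        (ne_top_of_le_ne_top ENNReal.one_ne_top (le_add_self.trans h)) h)
    rw [← hprob, ← measure_add_measure_compl (hL.isClosed.measurableSet)] at h1
    exact lt_of_add_lt_add_left h1
  · rw [← key]
    exact (integral_trim baireB_le_borel
      ((measurable_zeroAtInfty f).mono baireC_le_baireB le_rfl).stronglyMeasurable).symm

/-- Transport along the Gelfand isomorphism moves a state to `C₀(Spec A)`, where the representation
theorem for spaces applies. -/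
theorem IsState.comp_gelfandEquiv_symm {τ : A →L[ℂ] ℂ} (hτ : IsState τ) :
    ∃ θ : C₀(Spec A, ℂ) →L[ℂ] ℂ, IsState θ ∧ ∀ a, θ (gelfand A a) = τ a := by
  let i : C₀(Spec A, ℂ) →⋆ₙₐ[ℂ] A := ((gelfandEquiv A).symm : C₀(Spec A, ℂ) →⋆ₙₐ[ℂ] A)
  let θ : C₀(Spec A, ℂ) →L[ℂ] ℂ :=
    τ.comp (⟨(i : C₀(Spec A, ℂ) →ₗ[ℂ] A), starHom_continuous i⟩ : C₀(Spec A, ℂ) →L[ℂ] A)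
  have h (f : C₀(Spec A, ℂ)) : θ f = τ (i f) := rfl
  have h1 (a : A) : θ (gelfand A a) = τ a := by
    rw [h]
    exact congrArg τ ((gelfandEquiv A).symm_apply_apply a)
  refine ⟨θ, hτ.of_extends (gelfand A) (fun f => ?_) ?_ h1, h1⟩
  · rw [h, map_mul, map_star]
    exact hτ.nonneg _
  · refine ContinuousLinearMap.opNorm_le_bound _ zero_le_one fun f => ?_
    rw [← hτ.norm_eq_one, h]
    refine (τ.le_opNorm _).trans ?_
    gcongr
    exact NonUnitalStarAlgHom.norm_apply_le i f

theorem IsState.exists_represents {τ : A →L[ℂ] ℂ} (hτ : IsState τ) :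
    ∃ μ : RadonProb (Spec A) (baireB (Spec A)), Represents μ τ := by
  obtain ⟨θ, hθ, h⟩ := hτ.comp_gelfandEquiv_symm
  obtain ⟨μ, hμ⟩ := exists_radonProb_of_isState hθ
  exact ⟨μ, fun a => by rw [← h, ← hμ]; rfl⟩

theorem IsState.exists_represents_baireC {τ : A →L[ℂ] ℂ} (hτ : IsState τ) :
    ∃ μ : RadonProb (Spec A) (baireC (Spec A)), Represents μ τ := by
  obtain ⟨μ, hμ⟩ := hτ.exists_represents
  exact ⟨μ.restrictC, fun a => by
    rw [← hμ]
    exact (integral_eq_of_baireC (fun E hE => (μ.restrictC_apply hE).symm) (gelfand A a)).symm⟩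

/-- Every `C₀` function on the spectrum is a Gelfand transform, so a representing measure has all
its `C₀` integrals prescribed. -/
theorem Represents.eq {m : MeasurableSpace (Spec A)} (hm : baireC (Spec A) ≤ m)
    {μ ν : RadonProb (Spec A) m} {τ : A →L[ℂ] ℂ} (hμ : Represents μ τ) (hν : Represents ν τ) :
    μ = ν := by
  refine RadonProb.ext_of_integral hm fun f => ?_
  obtain ⟨a, rfl⟩ := gelfand_bijective.surjective f
  exact (hμ a).trans (hν a).symm

/-- A continuous map into the spectrum preserves the measures if it preserves the integrals of the
Gelfand transforms. -/
theorem Represents.preserves {X : Type u} [TopologicalSpace X]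
    {mY : MeasurableSpace X} {m : MeasurableSpace (Spec A)}
    (hm : baireC (Spec A) ≤ m) (hm' : IsGeneratedByContinuous m) {μ : RadonProb (Spec A) m}
    {ν : RadonProb X mY} {τ : A →L[ℂ] ℂ} (hμ : Represents μ τ) {T : C(X, Spec A)}
    (hT : Measurable T) (h : ∀ a, ∫ y, T y a ∂ν.measure = τ a) : PreservesPrb T ν μ := by
  refine PreservesPrb.of_integral hm hm' hT fun f => ?_
  obtain ⟨a, rfl⟩ := gelfand_bijective.surjective f
  exact (h a).trans (hμ a).symm

end RieszRepresentation

/-! ### Extension of states to the unitization and the multiplier algebra. -/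

section States

variable {A : Type u} [NonUnitalCommCStarAlgebra A]

/-- Characters take one to one, and the representing measure has mass one. -/
theorem IsState.map_one {D : Type u} [CommCStarAlgebra D] {σ : D →L[ℂ] ℂ} (hσ : IsState σ) :
    σ 1 = 1 := by
  obtain ⟨μ, hμ⟩ := hσ.exists_represents
  rw [← hμ]
  have h (φ : Spec D) : φ 1 = 1 := by
    obtain ⟨d, hd⟩ := spec_exists_ne_zero φ
    refine mul_right_cancel₀ hd ?_
    rw [← spec_map_mul, one_mul, one_mul]
  simp [h]

theorem isState_of_map_one {D : Type u} [CommCStarAlgebra D] {σ : D →L[ℂ] ℂ}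
    (h : ∀ d, 0 ≤ σ (star d * d)) (h1 : ∀ d, ‖σ d‖ ≤ ‖d‖) (h2 : σ 1 = 1) : IsState σ := by
  refine ⟨h, le_antisymm (ContinuousLinearMap.opNorm_le_bound _ zero_le_one fun d => ?_) ?_⟩
  · rw [one_mul]
    exact h1 d
  · have : Nontrivial D := ⟨1, 0, fun h => by rw [h, map_zero] at h2; exact zero_ne_one h2⟩
    have h3 := σ.le_opNorm 1
    rwa [h2, norm_one, norm_one, mul_one] at h3

theorem IsState.norm_apply_le {τ : A →L[ℂ] ℂ} (hτ : IsState τ) (a : A) : ‖τ a‖ ≤ ‖a‖ := by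
  have h := τ.le_opNorm a
  rwa [hτ.norm_eq_one, one_mul] at h

/-- An element that nearly attains the norm is multiplied by a phase which makes its value real and
positive. -/
theorem IsState.exists_re_gt {τ : A →L[ℂ] ℂ} (hτ : IsState τ) {r : ℝ} (hr0 : 0 ≤ r) (hr : r < 1) :
    ∃ a, ‖a‖ ≤ 1 ∧ r < (τ a).re := by
  rw [← hτ.norm_eq_one] at hr
  obtain ⟨a, ha, har⟩ := τ.exists_lt_apply_of_lt_opNorm hr
  have h0 : τ a ≠ 0 := norm_pos_iff.mp (hr0.trans_lt har)
  have h1 : (‖τ a‖ : ℂ) ≠ 0 := Complex.ofReal_ne_zero.mpr (norm_ne_zero_iff.mpr h0)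
  refine ⟨(star (τ a) / ‖τ a‖) • a, ?_, ?_⟩
  · rw [norm_smul, norm_div, norm_star, Complex.norm_real, norm_norm,
      div_self (norm_ne_zero_iff.mpr h0), one_mul]
    exact ha.le
  · have h2 : star (τ a) / ‖τ a‖ * τ a = (‖τ a‖ : ℂ) := by
      rw [div_mul_eq_mul_div, div_eq_iff h1, Complex.star_def, Complex.conj_mul', sq]
    rw [map_smul, smul_eq_mul, h2, Complex.ofReal_re]
    exact har

/-- A contraction `b` on which the state is nearly one acts as an approximate unit for the state. On
the spectrum `‖1 - φ b‖ ^ 2 ≤ 2 - 2 * (φ b).re`, because `‖φ b‖ ≤ 1`; integrating over the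
representing measure turns this into a bound by `σ b`. -/
theorem IsState.norm_sub_mul_le {D : Type u} [CommCStarAlgebra D] {σ : D →L[ℂ] ℂ} (hσ : IsState σ)
    (d b : D) (hb : ‖b‖ ≤ 1) {δ : ℝ} (hδ : 0 < δ) (h : 1 - δ ^ 2 / 2 < (σ b).re) :
    ‖σ (d - d * b)‖ ≤ 2 * δ * ‖d‖ := by
  let _ : MeasurableSpace (Spec D) := baireB (Spec D)
  obtain ⟨μ, hμ⟩ := hσ.exists_represents
  rw [← hμ]
  have hi (x : D) : Integrable (fun φ : Spec D => φ x) μ.measure :=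
    Integrable.of_bound ((measurable_zeroAtInfty (gelfand D x)).mono baireC_le_baireB
      le_rfl).aestronglyMeasurable ‖x‖ (Eventually.of_forall fun φ => spec_norm_le φ x)
  have h1 : ∀ φ : Spec D, ‖φ (d - d * b)‖ ≤ ‖d‖ * (δ + (2 - 2 * (φ b).re) / δ) := fun φ => by
    have e1 : φ (d - d * b) = φ d * (1 - φ b) := by
      rw [map_sub, spec_map_mul]
      ring
    rw [e1, norm_mul]
    have h2 : ‖1 - φ b‖ ^ 2 ≤ 2 - 2 * (φ b).re := by
      have h3 : ‖φ b‖ ≤ 1 := (spec_norm_le φ b).trans hb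
      have h4 : ‖φ b‖ ^ 2 ≤ 1 := pow_le_one₀ (norm_nonneg _) h3
      rw [← Complex.normSq_eq_norm_sq, Complex.normSq_apply] at h4 ⊢
      simp
      nlinarith
    gcongr
    · exact spec_norm_le φ d
    -- The inequality `t ≤ δ + t ^ 2 / δ` with `t = ‖1 - φ b‖` linearizes the square and replaces
    -- Cauchy–Schwarz.
    · rw [← sub_le_iff_le_add', le_div_iff₀ hδ]
      nlinarith [sq_nonneg (‖1 - φ b‖ - δ), norm_nonneg (1 - φ b)]
  have hre : Integrable (fun φ : Spec D => (φ b).re) μ.measure := (hi b).re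
  have h2 : Integrable (fun φ : Spec D => ‖d‖ * (δ + (2 - 2 * (φ b).re) / δ)) μ.measure :=
    ((integrable_const δ).add (((integrable_const 2).sub (hre.const_mul 2)).div_const δ)).const_mul _
  refine (norm_integral_le_of_norm_le h2 (Eventually.of_forall h1)).trans ?_
  have h3 : ∫ φ : Spec D, ‖d‖ * (δ + (2 - 2 * (φ b).re) / δ) ∂μ.measure =
      ‖d‖ * (δ + (2 - 2 * (σ b).re) / δ) := by
    have e1 : ∫ φ : Spec D, (φ b).re ∂μ.measure = (σ b).re := by
      rw [← hμ]
      exact integral_re (hi b)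
    have e2 : ∫ φ : Spec D, (2 - 2 * (φ b).re) ∂μ.measure = 2 - 2 * (σ b).re := by
      rw [integral_sub (integrable_const 2) (hre.const_mul 2), integral_const_mul, e1]
      simp
    have e3 : ∫ φ : Spec D, (δ + (2 - 2 * (φ b).re) / δ) ∂μ.measure =
        δ + (2 - 2 * (σ b).re) / δ := by
      refine (integral_add (integrable_const δ)
        (((integrable_const 2).sub (hre.const_mul 2)).div_const δ)).trans ?_
      refine congrArg₂ (· + ·) (by simp) ?_
      rw [← e2, ← integral_div]
      rfl
    rw [integral_const_mul, e3]
  rw [h3]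
  rw [mul_comm]
  gcongr
  have h4 : (2 - 2 * (σ b).re) / δ ≤ δ := by
    rw [div_le_iff₀ hδ]
    nlinarith
  linarith

/-- A state on a unital algebra is determined by its restriction to an ideal on which it is a
state. -/
theorem IsState.eq_of_ideal {D : Type u} [CommCStarAlgebra D] (j : A →⋆ₙₐ[ℂ] D)
    (hj : ∀ d a, ∃ b, d * j a = j b) {τ : A →L[ℂ] ℂ} (hτ : IsState τ) {σ σ' : D →L[ℂ] ℂ}
    (hσ : IsState σ) (hσ' : IsState σ') (h : ∀ a, σ (j a) = τ a) (h' : ∀ a, σ' (j a) = τ a) :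
    σ = σ' := by
  refine ContinuousLinearMap.ext fun d => ?_
  rw [← sub_eq_zero, ← norm_le_zero_iff]
  have key (δ : ℝ) (hδ : 0 < δ) (hδ1 : δ ≤ 1) : ‖σ d - σ' d‖ ≤ 4 * δ * ‖d‖ := by
    -- The value `1 - δ ^ 2 / 2` is the threshold of `IsState.norm_sub_mul_le`; it is nonnegative
    -- since `δ ≤ 1`.
    obtain ⟨a, ha, har⟩ := hτ.exists_re_gt (r := 1 - δ ^ 2 / 2) (by nlinarith) (by nlinarith)
    have hja : ‖j a‖ ≤ 1 := (NonUnitalStarAlgHom.norm_apply_le j a).trans ha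
    have h1 := hσ.norm_sub_mul_le d (j a) hja hδ (by rwa [h])
    have h2 := hσ'.norm_sub_mul_le d (j a) hja hδ (by rwa [h'])
    obtain ⟨b, hb⟩ := hj d a
    -- The product `d * j a` lies in the ideal, where both states agree, and the remainder is small
    -- for each of them.
    have h3 : σ d - σ' d = σ (d - d * j a) - σ' (d - d * j a) := by
      rw [map_sub, map_sub, hb, h, h']
      ring
    rw [h3]
    refine (norm_sub_le _ _).trans ?_
    linarith
  have h1 : Tendsto (fun δ : ℝ => 4 * δ * ‖d‖) (𝓝[>] 0) (𝓝 (4 * 0 * ‖d‖)) :=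
    (((continuous_const.mul continuous_id).mul continuous_const).tendsto 0).mono_left
      nhdsWithin_le_nhds
  rw [mul_zero, zero_mul] at h1
  refine ge_of_tendsto h1 ?_
  filter_upwards [Ioc_mem_nhdsGT (zero_lt_one (α := ℝ))] with δ hδ using key δ hδ.1 hδ.2

theorem IsState.comp_starAlgHom {D D' : Type u} [CommCStarAlgebra D] [CommCStarAlgebra D']
    {σ : D' →L[ℂ] ℂ} (hσ : IsState σ) (Φ : D →⋆ₐ[ℂ] D') :
    ∃ σ' : D →L[ℂ] ℂ, IsState σ' ∧ ∀ d, σ' d = σ (Φ d) := by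
  let σ' : D →L[ℂ] ℂ := σ.comp (⟨(Φ : D →ₗ[ℂ] D'), starHom_continuous Φ.toNonUnitalStarAlgHom⟩ :
    D →L[ℂ] D')
  have h (d : D) : σ' d = σ (Φ d) := rfl
  refine ⟨σ', isState_of_map_one (fun d => ?_) (fun d => ?_) ?_, h⟩
  · rw [h, map_mul, map_star]
    exact hσ.nonneg _
  · rw [h]
    exact (hσ.norm_apply_le _).trans (NonUnitalStarAlgHom.norm_apply_le Φ.toNonUnitalStarAlgHom d)
  · rw [h, _root_.map_one, hσ.map_one]

/-- The extended functional is the integral of the characters of the unitization that extend those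
of `A`, so positivity and contractivity are inherited from characters. -/
theorem isState_unitState {τ : A →L[ℂ] ℂ} (hτ : IsState τ) : IsState (unitState τ) := by
  obtain ⟨μ, hμ⟩ := hτ.exists_represents
  have h (x : Unitization ℂ A) : unitState τ x = ∫ φ, specLift φ x ∂μ.measure := by
    have hi : Integrable (fun φ : Spec A => φ x.snd) μ.measure :=
      Integrable.of_bound ((measurable_zeroAtInfty (gelfand A x.snd)).mono baireC_le_baireB
        le_rfl).aestronglyMeasurable ‖x.snd‖ (Eventually.of_forall fun φ => spec_norm_le φ x.snd)
    change x.fst + τ x.snd = _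
    simp only [specLift_apply]
    rw [integral_add (integrable_const _) hi, hμ]
    simp
  refine isState_of_map_one (fun x => ?_) (fun x => ?_) ?_
  · rw [h]
    refine integral_nonneg fun φ => ?_
    change 0 ≤ specLift φ (star x * x)
    rw [map_mul, map_star]
    exact star_mul_self_nonneg _
  · rw [h]
    refine (norm_integral_le_of_norm_le_const (Eventually.of_forall fun φ =>
      AlgHom.norm_apply_le_self (specLift φ) x)).trans ?_
    simp
  · rw [h]
    simp

/-- The extension is obtained by integrating the extended characters, which form a bounded
continuous function of the character for each multiplier. The integral formula is retained for later
computation. -/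
theorem Represents.exists_multState {τ : A →L[ℂ] ℂ} (hτ : IsState τ)
    {μ : RadonProb (Spec A) (baireB (Spec A))} (hμ : Represents μ τ) :
    ∃ σ : 𝓜(ℂ, A) →L[ℂ] ℂ, (IsState σ ∧ ∀ a, σ (toMult A a) = τ a) ∧
      ∀ m, σ m = ∫ φ, specEval φ m ∂μ.measure := by
  let σ : 𝓜(ℂ, A) →L[ℂ] ℂ := integralCLM μ.measure
    { toFun := fun m φ => specEval φ m
      map_add' := fun m n => funext fun φ => map_add (specEvalHom φ) m n
      map_smul' := fun c m => funext fun φ => map_smul (specEvalHom φ) c m }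
    (fun m => measurable_baireB (specEvalBCF m)) fun m φ => norm_specEval_le φ m
  have h (m : 𝓜(ℂ, A)) : σ m = ∫ φ, specEval φ m ∂μ.measure := rfl
  have h1 (a : A) : σ (toMult A a) = τ a := by
    rw [h, ← hμ]
    simp only [specEval_toMult]
  refine ⟨σ, ⟨hτ.of_extends (toMult A) (fun m => ?_) (integralCLM_norm_le _ _ _ _) h1, h1⟩, h⟩
  rw [h]
  simp only [specEval_map_mul, specEval_star]
  exact integral_star_mul_nonneg μ.measure fun φ => specEval φ m

theorem existsUnique_multState {τ : A →L[ℂ] ℂ} (hτ : IsState τ) :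
    ∃! σ : 𝓜(ℂ, A) →L[ℂ] ℂ, IsState σ ∧ ∀ a, σ (toMult A a) = τ a := by
  obtain ⟨μ, hμ⟩ := hτ.exists_represents
  obtain ⟨σ, hσ, -⟩ := hμ.exists_multState hτ
  exact ⟨σ, hσ, fun σ' hσ' => hτ.eq_of_ideal (toMult A)
    (fun m a => ⟨_, mult_mul_toMult m a⟩) hσ'.1 hσ.1 hσ'.2 hσ.2⟩

theorem multState_spec {τ : A →L[ℂ] ℂ} (hτ : IsState τ) :
    IsState (multState τ) ∧ ∀ a, multState τ (toMult A a) = τ a := by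
  have h := (existsUnique_multState hτ).exists
  rw [multState, dif_pos h]
  exact h.choose_spec

theorem multState_eq {τ : A →L[ℂ] ℂ} (hτ : IsState τ) {σ : 𝓜(ℂ, A) →L[ℂ] ℂ} (hσ : IsState σ)
    (h : ∀ a, σ (toMult A a) = τ a) : multState τ = σ :=
  (existsUnique_multState hτ).unique (multState_spec hτ) ⟨hσ, h⟩

theorem Represents.multState_eq {τ : A →L[ℂ] ℂ} (hτ : IsState τ)
    {μ : RadonProb (Spec A) (baireB (Spec A))} (hμ : Represents μ τ) (m : 𝓜(ℂ, A)) :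
    multState τ m = ∫ φ, specEval φ m ∂μ.measure := by
  obtain ⟨σ, hσ, h⟩ := hμ.exists_multState hτ
  rw [RieszDuality.multState_eq hτ hσ.1 hσ.2, h]

/-- Pulling the state of `M(B)` back along the unital extension gives a state of `M(A)`. If it
extends `τA`, it is the unique such extension, so only elements of `A` need checking. -/
theorem multState_multExt {B : Type u} [NonUnitalCommCStarAlgebra B] {τA : A →L[ℂ] ℂ}
    {τB : B →L[ℂ] ℂ} (hA : IsState τA) (hB : IsState τB) (Φ : A →⋆ₙₐ[ℂ] 𝓜(ℂ, B))
    (hΦ : MultNondegenerate Φ) (h : ∀ a, multState τB (Φ a) = τA a) (m : 𝓜(ℂ, A)) :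
    multState τB (multExt Φ hΦ m) = multState τA m := by
  obtain ⟨σ, hσ, hσ'⟩ := (multState_spec hB).1.comp_starAlgHom (multExt Φ hΦ)
  rw [multState_eq hA hσ fun a => by rw [hσ', multExt_toMult, h], hσ']

variable {X : Type u} [TopologicalSpace X] [LocallyCompactSpace X] [T2Space X]

theorem specEval_bcfMult (x : X) (h : X →ᵇ ℂ) : specEval (evSpec₀ X x) (bcfMult X h) = h x := by
  obtain ⟨b, hb⟩ := spec_exists_ne_zero (evSpec₀ X x)
  exact specEval_eq hb (bcfMult_fst h b x).symm

/-- The pushforward of `μ` under evaluation represents the integration functional on `C₀(X)`, and an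
evaluation character extends to `C_b(X)` as evaluation at the same point. -/
theorem multState_bcfMult (μ : RadonProb X (baireB X)) (h : X →ᵇ ℂ) :
    multState (intC0 baireC_le_baireB μ) (bcfMult X h) = ∫ x, h x ∂μ.measure := by
  let _ : MeasurableSpace X := baireB X
  let _ : MeasurableSpace (Spec C₀(X, ℂ)) := baireB _
  have hT : Measurable (evSpec₀ X) := measurable_continuousMap _
  let ν : RadonProb (Spec C₀(X, ℂ)) (baireB _) := μ.map baireC_le_baireB (evSpec₀ X) hT
    (isGeneratedByContinuous_baireB _)
  have hν (F : Spec C₀(X, ℂ) → ℂ) (hF : Measurable F) :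
      ∫ φ, F φ ∂ν.measure = ∫ x, F (evSpec₀ X x) ∂μ.measure :=
    integral_map hT.aemeasurable hF.aestronglyMeasurable
  have h1 : Represents ν (intC0 baireC_le_baireB μ) := fun f =>
    hν (fun φ => φ f) ((measurable_zeroAtInfty (gelfand _ f)).mono baireC_le_baireB le_rfl)
  rw [h1.multState_eq (intC0_isState _ _),
    hν (fun φ => specEval φ (bcfMult X h)) (measurable_baireB (specEvalBCF _))]
  simp only [specEval_bcfMult]

end States

/-! ### Well-definedness of the functors. -/

theorem wellDefined : WellDefined.{u} where
  radon_compact K _ _ _ μ hμ := (RadonProb.ofTight (isGeneratedByContinuous_baireB K) μ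
    fun ε hε => ⟨Set.univ, MeasurableSet.univ, isCompact_univ, IsGδ.univ, by
      simpa using pos_iff_ne_zero.mpr hε⟩).radon
  extension X := by
    obtain ⟨ν, hν⟩ := exists_extension X.prb
    exact ⟨ν, hν, fun ν' hν' => RadonProb.ext_of_baireC fun E hE => by rw [hν E hE, hν' E hE]⟩
  extension_map X Y T μ ν hμ hν := by
    -- Extended and original measures have the same `C₀` integrals, and `f ∘ T` stays in `C₀`
    -- because `T` is proper.
    refine PreservesPrb.of_integral baireC_le_baireB (isGeneratedByContinuous_baireB _)
      (measurable_continuousMap T.map) fun f => ?_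
    rw [integral_eq_of_baireC hν, ← integral_preserves T.preserves (measurable_proper T.map T.proper)
      (measurable_zeroAtInfty f)]
    exact integral_eq_of_baireC hμ (c0Comp T.map T.proper f)
  unit_state A := isState_unitState A.isState
  mult_state A := existsUnique_multState A.isState
  nd_trace A B f := multState_multExt A.isState B.isState _ _ fun a =>
    ((multState_spec B.isState).2 (f.map a)).trans (f.trace a)
  c0_trace X Y T := multState_multExt (intC0_isState _ _) (intC0_isState _ _) _ _ fun f => by
    rw [c0MultComp_apply, multState_bcfMult]
    exact integral_preserves T.preserves (measurable_continuousMap T.map)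
      ((measurable_zeroAtInfty f).mono baireC_le_baireB le_rfl)
  riesz_unit A := by
    obtain ⟨μ, hμ⟩ := A.isState.exists_represents
    exact ⟨μ, hμ, fun ν hν => hν.eq baireC_le_baireB hμ⟩
  riesz_unit_map A B f μ ν hμ hν :=
    hμ.preserves baireC_le_baireB (isGeneratedByContinuous_baireB _) (measurable_continuousMap _)
      fun a => (hν (f.map a)).trans (f.trace a)
  riesz_nd A := by
    obtain ⟨μ, hμ⟩ := A.isState.exists_represents_baireC
    exact ⟨μ, hμ, fun ν hν => hν.eq le_rfl hμ⟩
  riesz_nd_map A B f μ ν hμ hν :=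
    hμ.preserves le_rfl (isGeneratedByContinuous_baireC _)
      (measurable_proper _ (specMap_proper f.map f.nondegenerate))
      fun a => (hν (f.map a)).trans (f.trace a)
  riesz_mult A := by
    obtain ⟨μ, hμ⟩ := A.isState.exists_represents
    exact ⟨μ, hμ, fun ν hν => hν.eq baireC_le_baireB hμ⟩
  riesz_mult_map A B f μ ν hμ hν :=
    hμ.preserves baireC_le_baireB (isGeneratedByContinuous_baireB _) (measurable_continuousMap _)
      fun a => by
        -- Morphisms preserve states only at the level of multipliers, so `a` is first viewed in
        -- `M(A)`; the state of `M(B)` is then written as an integral of extended characters.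
        rw [← (multState_spec A.isState).2 a, ← f.trace, multExt_toMult, hν.multState_eq B.isState]
        rfl

/-! ### Isomorphisms in the categories of spaces and algebras. -/

section Isomorphisms

/-- A measure-preserving homeomorphism is an isomorphism of `CHPrb`. -/
def CHPrb.isoOfHomeo {X Y : CHPrb.{u}} (e : X.carrier ≃ₜ Y.carrier)
    (h : PreservesPrb e X.prb Y.prb) : X ≅ Y where
  hom := ⟨e, h⟩
  inv := ⟨e.symm, fun E hE => by
    rw [← h _ (measurable_continuousMap (e.symm : C(Y.carrier, X.carrier)) hE)]
    exact congrArg X.prb.measure (by ext; simp)⟩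
  hom_inv_id := CHPrb.Hom.ext (ContinuousMap.ext e.symm_apply_apply)
  inv_hom_id := CHPrb.Hom.ext (ContinuousMap.ext e.apply_symm_apply)

/-- A point-preserving isomorphism of the underlying spaces is an isomorphism of `CHptPrb`. -/
def CHptPrb.isoOfIso {X Y : CHptPrb.{u}} (e : X.space ≅ Y.space) (h : e.hom.map X.pt = Y.pt) :
    X ≅ Y where
  hom := ⟨e.hom, h⟩
  inv := ⟨e.inv, by
    rw [← h]
    exact DFunLike.congr_fun (congrArg CHPrb.Hom.map e.hom_inv_id) X.pt⟩
  hom_inv_id := CHptPrb.Hom.ext e.hom_inv_id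
  inv_hom_id := CHptPrb.Hom.ext e.inv_hom_id

theorem isCompact_preimage_homeo {X Y : Type*} [TopologicalSpace X] [TopologicalSpace Y]
    (e : X ≃ₜ Y) (K : Set Y) (hK : IsCompact K) : IsCompact (e ⁻¹' K) :=
  e.isCompact_preimage.mpr hK

/-- A measure-preserving homeomorphism is an isomorphism of `LCHprPrb`. -/
def LCHprPrb.isoOfHomeo {X Y : LCHprPrb.{u}} (e : X.carrier ≃ₜ Y.carrier)
    (h : PreservesPrb e X.prb Y.prb) : X ≅ Y where
  hom := ⟨e, isCompact_preimage_homeo e, h⟩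
  inv := ⟨e.symm, isCompact_preimage_homeo e.symm, fun E hE => by
    rw [← h _ (measurable_proper (e.symm : C(Y.carrier, X.carrier))
      (isCompact_preimage_homeo e.symm) hE)]
    exact congrArg X.prb.measure (by ext; simp)⟩
  hom_inv_id := LCHprPrb.Hom.ext (ContinuousMap.ext e.symm_apply_apply)
  inv_hom_id := LCHprPrb.Hom.ext (ContinuousMap.ext e.apply_symm_apply)

/-- A measure-preserving homeomorphism is an isomorphism of `LCHPrb`. -/
def LCHPrb.isoOfHomeo {X Y : LCHPrb.{u}} (e : X.carrier ≃ₜ Y.carrier)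
    (h : PreservesPrb e X.prb Y.prb) : X ≅ Y where
  hom := ⟨e, h⟩
  inv := ⟨e.symm, fun E hE => by
    rw [← h _ (measurable_continuousMap (e.symm : C(Y.carrier, X.carrier)) hE)]
    exact congrArg X.prb.measure (by ext; simp)⟩
  hom_inv_id := LCHPrb.Hom.ext (ContinuousMap.ext e.symm_apply_apply)
  inv_hom_id := LCHPrb.Hom.ext (ContinuousMap.ext e.apply_symm_apply)

/-- A state-preserving `*`-isomorphism is an isomorphism of `CStarUnitTr`. -/
def CStarUnitTr.isoOfEquiv {A B : CStarUnitTr.{u}} (e : A.carrier ≃⋆ₐ[ℂ] B.carrier)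
    (h : ∀ a, B.state (e a) = A.state a) : A ≅ B where
  hom := ⟨e, h⟩
  inv := ⟨e.symm, fun b => by
    rw [← h]
    exact congrArg B.state (e.apply_symm_apply b)⟩
  hom_inv_id := CStarUnitTr.Hom.ext (StarAlgHom.ext e.symm_apply_apply)
  inv_hom_id := CStarUnitTr.Hom.ext (StarAlgHom.ext e.apply_symm_apply)

/-- A point-preserving isomorphism of the underlying algebras is an isomorphism of
`CStarUnitInfTr`. -/
def CStarUnitInfTr.isoOfIso {A B : CStarUnitInfTr.{u}} (e : A.alg ≅ B.alg)
    (h : ∀ a, B.pt (e.hom.map a) = A.pt a) : A ≅ B where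
  hom := ⟨e.hom, h⟩
  inv := ⟨e.inv, fun b => by
    rw [← h]
    exact congrArg B.pt (DFunLike.congr_fun (congrArg CStarUnitTr.Hom.map e.inv_hom_id) b)⟩
  hom_inv_id := CStarUnitInfTr.Hom.ext e.hom_inv_id
  inv_hom_id := CStarUnitInfTr.Hom.ext e.inv_hom_id

/-- Products span a dense subspace of `B`, by an approximate unit, and surjectivity takes every left
factor from the range of `Φ`. -/
theorem nondegenerate_of_surjective {A B : Type u} [NonUnitalCommCStarAlgebra A]
    [NonUnitalCommCStarAlgebra B] {Φ : A →⋆ₙₐ[ℂ] B} (h : Function.Surjective Φ) :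
    Nondegenerate Φ := by
  refine nondegenerate_id.mono (SetLike.coe_subset_coe.mpr (Submodule.span_mono ?_))
  rintro _ ⟨a, b, rfl⟩
  obtain ⟨a, rfl⟩ := h a
  exact ⟨a, b, rfl⟩

/-- A state-preserving `*`-isomorphism is an isomorphism of `CStarNdTr`. -/
def CStarNdTr.isoOfEquiv {A B : CStarNdTr.{u}} (e : A.carrier ≃⋆ₐ[ℂ] B.carrier)
    (h : ∀ a, B.state (e a) = A.state a) : A ≅ B where
  hom := ⟨e, nondegenerate_of_surjective e.surjective, h⟩
  inv := ⟨e.symm, nondegenerate_of_surjective e.symm.surjective, fun b => by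
    rw [← h]
    exact congrArg B.state (e.apply_symm_apply b)⟩
  hom_inv_id := CStarNdTr.Hom.ext (NonUnitalStarAlgHom.ext e.symm_apply_apply)
  inv_hom_id := CStarNdTr.Hom.ext (NonUnitalStarAlgHom.ext e.apply_symm_apply)

/-- An object of `CStarMultTr`, as an object of `CStarNdTr`. -/
def CStarMultTr.toNd (A : CStarMultTr.{u}) : CStarNdTr.{u} where
  carrier := A.carrier
  state := A.state
  isState := A.isState

/-- A state-preserving `*`-isomorphism is an isomorphism of `CStarMultTr`. -/
def CStarMultTr.isoOfEquiv {A B : CStarMultTr.{u}} (e : A.carrier ≃⋆ₐ[ℂ] B.carrier)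
    (h : ∀ a, B.state (e a) = A.state a) : A ≅ B :=
  -- A `*`-isomorphism is nondegenerate in both directions, and functors preserve isomorphisms; this
  -- avoids computing composites of multiplier extensions.
  (ndToMult wellDefined).mapIso (CStarNdTr.isoOfEquiv (A := A.toNd) (B := B.toNd) e h)

end Isomorphisms

/-! ### The four dualities. -/

section Dualities

section Preservation

variable {X : Type u} [TopologicalSpace X] [T2Space X]

/-- The Gelfand transform of `f` at evaluation at `x` is `f x` by definition, so the integrals to be
compared coincide. -/
theorem preserves_homeoEval [CompactSpace X] {μ : RadonProb X (baireB X)}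
    {ν : RadonProb (Spec C(X, ℂ)) (baireB _)} (h : Represents ν (intC μ)) :
    PreservesPrb (WeakDual.CharacterSpace.homeoEval X ℂ) μ ν :=
  h.preserves baireC_le_baireB (isGeneratedByContinuous_baireB _)
    (T := (WeakDual.CharacterSpace.homeoEval X ℂ : C(X, Spec C(X, ℂ))))
    (measurable_continuousMap _) fun _ => rfl

variable [LocallyCompactSpace X]

theorem preserves_homeoSpec₀_baireC {μ : RadonProb X (baireC X)}
    {ν : RadonProb (Spec C₀(X, ℂ)) (baireC _)} (h : Represents ν (intC0 le_rfl μ)) :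
    PreservesPrb (homeoSpec₀ X) μ ν :=
  h.preserves le_rfl (isGeneratedByContinuous_baireC _) (T := (homeoSpec₀ X : C(X, Spec C₀(X, ℂ))))
    (measurable_proper _ (isCompact_preimage_homeo (homeoSpec₀ X))) fun _ => rfl

theorem preserves_homeoSpec₀ {μ : RadonProb X (baireB X)}
    {ν : RadonProb (Spec C₀(X, ℂ)) (baireB _)} (h : Represents ν (intC0 baireC_le_baireB μ)) :
    PreservesPrb (homeoSpec₀ X) μ ν :=
  h.preserves baireC_le_baireB (isGeneratedByContinuous_baireB _)
    (T := (homeoSpec₀ X : C(X, Spec C₀(X, ℂ)))) (measurable_continuousMap _) fun _ => rfl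

end Preservation

/-- Compact Hausdorff spaces are naturally isomorphic to the spectra of their algebras of
continuous functions. -/
def unitIsoC : 𝟭 CHPrb.{u} ≅ funcC ⋙ rieszUnit wellDefined :=
  NatIso.ofComponents (fun X => CHPrb.isoOfHomeo
      (Y := (rieszUnit wellDefined).obj (funcC.obj X))
      (WeakDual.CharacterSpace.homeoEval X.carrier ℂ)
      (preserves_homeoEval (wellDefined.riesz_unit (funcC.obj X).unop).choose_spec.1))
    fun _ => rfl

/-- The Gelfand isomorphism of unital algebras. -/
def counitIsoC : rieszUnit wellDefined.{u} ⋙ funcC ≅ 𝟭 _ :=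
  NatIso.ofComponents (fun A => (CStarUnitTr.isoOfEquiv
      (B := (funcC.obj ((rieszUnit wellDefined).obj A)).unop)
      (gelfandStarTransform A.unop.carrier)
      (wellDefined.riesz_unit A.unop).choose_spec.1).op)
    fun _ => rfl

/-- Compact Hausdorff spaces with a distinguished point are naturally isomorphic to the spectra of
their algebras of continuous functions. -/
def unitIsoCpt : 𝟭 CHptPrb.{u} ≅ funcCpt ⋙ rieszUnitInf wellDefined :=
  NatIso.ofComponents (fun X => CHptPrb.isoOfIso
      (Y := (rieszUnitInf wellDefined).obj (funcCpt.obj X)) (unitIsoC.app X.space) rfl)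
    fun _ => rfl

/-- The Gelfand isomorphism of unital algebras with a distinguished character. -/
def counitIsoCpt : rieszUnitInf wellDefined.{u} ⋙ funcCpt ≅ 𝟭 _ :=
  NatIso.ofComponents (fun A => (CStarUnitInfTr.isoOfIso
      (B := (funcCpt.obj ((rieszUnitInf wellDefined).obj A)).unop)
      (counitIsoC.app (Opposite.op A.unop.alg)).unop fun _ => rfl).op)
    fun _ => rfl

/-- Locally compact Hausdorff spaces are naturally isomorphic, for proper maps, to the spectra of
their algebras of functions which vanish at infinity. -/
def unitIsoC0pr : 𝟭 LCHprPrb.{u} ≅ funcC0pr ⋙ rieszNd wellDefined :=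
  NatIso.ofComponents (fun X => LCHprPrb.isoOfHomeo
      (Y := (rieszNd wellDefined).obj (funcC0pr.obj X))
      (homeoSpec₀ X.carrier)
      (preserves_homeoSpec₀_baireC (wellDefined.riesz_nd (funcC0pr.obj X).unop).choose_spec.1))
    fun _ => rfl

/-- The Gelfand isomorphism, for nondegenerate homomorphisms. -/
def counitIsoC0pr : rieszNd wellDefined.{u} ⋙ funcC0pr ≅ 𝟭 _ :=
  NatIso.ofComponents (fun A => (CStarNdTr.isoOfEquiv
      (B := (funcC0pr.obj ((rieszNd wellDefined).obj A)).unop)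
      (gelfandEquiv A.unop.carrier)
      (wellDefined.riesz_nd A.unop).choose_spec.1).op)
    fun _ => rfl

/-- Locally compact Hausdorff spaces are naturally isomorphic, for continuous maps, to the spectra
of their algebras of functions which vanish at infinity. -/
def unitIsoC0 : 𝟭 LCHPrb.{u} ≅ funcC0 wellDefined ⋙ rieszMult wellDefined :=
  NatIso.ofComponents (fun X => LCHPrb.isoOfHomeo
      (Y := (rieszMult wellDefined).obj ((funcC0 wellDefined).obj X))
      (homeoSpec₀ X.carrier)
      (preserves_homeoSpec₀
        (wellDefined.riesz_mult ((funcC0 wellDefined).obj X).unop).choose_spec.1))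
    -- Unlike in the other categories, naturality is not definitional: the spectral map uses
    -- characters extended to multipliers by a quotient.
    fun T => LCHPrb.Hom.ext (ContinuousMap.ext fun x => WeakDual.CharacterSpace.ext fun f =>
      (specEval_bcfMult x (f.toBCF.compContinuous T.map)).symm)

/-- Extended to multipliers, the Gelfand transform sends `m` to multiplication by its values under
the extended characters. Nondegeneracy allows this to be tested after multiplication by the elements
`Φ a`. -/
theorem multExt_gelfand {A : Type u} [NonUnitalCommCStarAlgebra A] (Φ : A →⋆ₙₐ[ℂ] C₀(Spec A, ℂ))
    (hΦ : ∀ a, Φ a = gelfand A a) (h : MultNondegenerate ((toMult C₀(Spec A, ℂ)).comp Φ))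
    (m : 𝓜(ℂ, A)) :
    multExt ((toMult C₀(Spec A, ℂ)).comp Φ) h m = bcfMult (Spec A) (specEvalBCF m) := by
  refine mult_eq_of_mul_eq h fun a => ?_
  rw [multExt_mul]
  change toMult C₀(Spec A, ℂ) (Φ (m.fst a)) = bcfMult _ _ * toMult C₀(Spec A, ℂ) (Φ a)
  rw [mult_mul_toMult, hΦ, hΦ]
  refine congrArg _ (ZeroAtInftyContinuousMap.ext fun φ => ?_)
  rw [bcfMult_fst]
  exact (specEval_mul φ m a).symm

/-- The Gelfand isomorphism, for homomorphisms into multiplier algebras. -/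
def counitIsoC0 : rieszMult wellDefined.{u} ⋙ funcC0 wellDefined ≅ 𝟭 _ :=
  NatIso.ofComponents (fun A => (CStarMultTr.isoOfEquiv
      (B := ((funcC0 wellDefined).obj ((rieszMult wellDefined).obj A)).unop)
      (gelfandEquiv A.unop.carrier)
      (wellDefined.riesz_mult A.unop).choose_spec.1).op)
    fun {A B} f => Quiver.Hom.unop_inj (CStarMultTr.Hom.ext (NonUnitalStarAlgHom.ext fun a => by
      -- One composite is the Gelfand transform seen inside the multipliers, pulled back along the
      -- spectral map; the other is the extended transform of `f a`.
      refine (multExt_toMult _ _ _).trans ?_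
      exact (multExt_gelfand _ (fun _ => rfl) _ (f.unop.map a)).symm))

theorem isDuality_funcC : IsDuality funcC (rieszUnit wellDefined.{u}) :=
  ⟨⟨unitIsoC.symm⟩, ⟨counitIsoC⟩⟩

theorem isDuality_funcCpt : IsDuality funcCpt (rieszUnitInf wellDefined.{u}) :=
  ⟨⟨unitIsoCpt.symm⟩, ⟨counitIsoCpt⟩⟩

theorem isDuality_funcC0pr : IsDuality funcC0pr (rieszNd wellDefined.{u}) :=
  ⟨⟨unitIsoC0pr.symm⟩, ⟨counitIsoC0pr⟩⟩

theorem isDuality_funcC0 : IsDuality (funcC0 wellDefined) (rieszMult wellDefined.{u}) :=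
  ⟨⟨unitIsoC0.symm⟩, ⟨counitIsoC0⟩⟩

/-- The two natural isomorphisms make both functors equivalences of categories. -/
theorem IsDuality.full_faithful {C D : Type (u + 1)} [Category.{u} C] [Category.{u} D]
    {F : C ⥤ Dᵒᵖ} {G : Dᵒᵖ ⥤ C} (h : IsDuality F G) :
    (F.Full ∧ F.Faithful) ∧ (G.Full ∧ G.Faithful) := by
  obtain ⟨⟨η⟩, ⟨ε⟩⟩ := h
  have h1 : F.IsEquivalence := Functor.IsEquivalence.mk' G η.symm ε
  have h2 : G.IsEquivalence := Functor.IsEquivalence.mk' F ε.symm η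
  exact ⟨⟨inferInstance, inferInstance⟩, ⟨inferInstance, inferInstance⟩⟩

end Dualities

/-! ### Fullness and faithfulness of the horizontal functors. -/

section HorizontalFaithfulness

/-- Multiplication by `Φ 1` fixes every product `Φ a * b`, hence by density all of `B`, in
particular the unit. -/
theorem Nondegenerate.map_one {A B : Type u} [CommCStarAlgebra A] [CommCStarAlgebra B]
    {Φ : A →⋆ₙₐ[ℂ] B} (h : Nondegenerate Φ) : Φ 1 = 1 := by
  have h1 (b : B) : Φ 1 * b = b := by
    let V : Submodule ℂ B := LinearMap.eqLocus (LinearMap.mul ℂ B (Φ 1)) LinearMap.id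
    refine dense_induction h V (isClosed_eq (continuous_const_mul (Φ 1)) continuous_id) ?_ b
    rintro _ ⟨a, b, rfl⟩
    change Φ 1 * (Φ a * b) = Φ a * b
    rw [← mul_assoc, ← map_mul, one_mul]
  exact (mul_one _).symm.trans (h1 1)

/-- A nondegenerate `*`-homomorphism between unital algebras, as a unital `*`-homomorphism. -/
def Nondegenerate.toStarAlgHom {A B : Type u} [CommCStarAlgebra A] [CommCStarAlgebra B]
    {Φ : A →⋆ₙₐ[ℂ] B} (h : Nondegenerate Φ) : A →⋆ₐ[ℂ] B where
  toFun := Φ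
  map_one' := h.map_one
  map_mul' := map_mul Φ
  map_zero' := map_zero Φ
  map_add' := map_add Φ
  commutes' r := by
    rw [Algebra.algebraMap_eq_smul_one, Algebra.algebraMap_eq_smul_one, map_smul, h.map_one]
  map_star' := map_star Φ

theorem unitToNd_full : unitToNd.{u}.Full where
  map_surjective f := ⟨⟨Nondegenerate.toStarAlgHom f.nondegenerate, f.trace⟩, rfl⟩

theorem unitToNd_faithful : unitToNd.{u}.Faithful where
  map_injective h := CStarUnitTr.Hom.ext (StarAlgHom.ext fun a =>
    DFunLike.congr_fun (congrArg CStarNdTr.Hom.map h) a)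

theorem toMult_injective (A : Type u) [NonUnitalCommCStarAlgebra A] :
    Function.Injective (toMult A) := fun a b h =>
  eq_of_forall_mul_eq fun c => by
    rw [mul_comm c, mul_comm c, ← toMult_fst, h, toMult_fst]

/-- In a unital algebra a multiplier is multiplication by its value at one. -/
theorem toMult_surjective (A : Type u) [CommCStarAlgebra A] : Function.Surjective (toMult A) :=
  fun m => ⟨m.fst 1, by
    refine mult_ext fun a => ?_
    rw [toMult_fst, ← mult_fst_mul, one_mul]⟩

theorem exists_toMult_comp_eq {A B : Type u} [NonUnitalCommCStarAlgebra A] [CommCStarAlgebra B]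
    (Φ : A →⋆ₙₐ[ℂ] 𝓜(ℂ, B)) : ∃ Ψ : A →⋆ₙₐ[ℂ] B, (toMult B).comp Ψ = Φ := by
  let e : B ≃⋆ₐ[ℂ] 𝓜(ℂ, B) :=
    StarAlgEquiv.ofBijective (toMult B) ⟨toMult_injective _, toMult_surjective _⟩
  let i : 𝓜(ℂ, B) →⋆ₙₐ[ℂ] B := (e.symm : 𝓜(ℂ, B) →⋆ₙₐ[ℂ] B)
  exact ⟨i.comp Φ, NonUnitalStarAlgHom.ext fun a => e.apply_symm_apply (Φ a)⟩

theorem ndToMult_faithful : (ndToMult wellDefined.{u}).Faithful where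
  map_injective h := CStarNdTr.Hom.ext (NonUnitalStarAlgHom.ext fun a =>
    toMult_injective _ (DFunLike.congr_fun (congrArg CStarMultTr.Hom.map h) a))

theorem unitToMult_faithful : (unitToMult wellDefined.{u}).Faithful where
  map_injective h := CStarUnitTr.Hom.ext (StarAlgHom.ext fun a =>
    toMult_injective _ (DFunLike.congr_fun (congrArg CStarMultTr.Hom.map h) a))

/-- A unital algebra is its own multiplier algebra, so `f` takes values in `B`; the condition on
states at multipliers is read off on elements of `A`. -/
theorem ndToMult_map_surjective (A : CStarNdTr.{u}) (B : CStarUnitTr.{u})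
    (f : (ndToMult wellDefined).obj A ⟶ (unitToMult wellDefined).obj B) :
    ∃ g : A ⟶ unitToNd.obj B, (ndToMult wellDefined).map g = f := by
  obtain ⟨Φ, hΦ'⟩ := exists_toMult_comp_eq (B := B.carrier) f.map
  have hΦ (a : A.carrier) : toMult B.carrier (Φ a) = f.map a := DFunLike.congr_fun hΦ' a
  refine ⟨⟨Φ, ?_, fun a => ?_⟩, CStarMultTr.Hom.ext hΦ'⟩
  · have h := f.nondegenerate
    rw [← hΦ'] at h
    exact h
  · have h : multState B.state (toMult B.carrier (Φ a)) = multState A.state (toMult A.carrier a) :=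
      (congrArg (multState B.state) ((hΦ a).trans
        (multExt_toMult f.map f.nondegenerate a).symm)).trans (f.trace (toMult A.carrier a))
    exact ((multState_spec B.isState).2 (Φ a)).symm.trans (h.trans ((multState_spec A.isState).2 a))

theorem unitToMult_full : (unitToMult wellDefined.{u}).Full where
  map_surjective {A B} f := by
    obtain ⟨g, hg⟩ := ndToMult_map_surjective (unitToNd.obj A) B f
    obtain ⟨k, rfl⟩ := unitToNd_full.map_surjective g
    exact ⟨k, hg⟩

/-- A morphism is recovered by restricting its extension from `M(A)` to `A`. -/
theorem funcMult_faithful : (funcMult wellDefined.{u}).Faithful where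
  map_injective {A B f g} h := CStarMultTr.Hom.ext (NonUnitalStarAlgHom.ext fun a => by
    rw [← multExt_toMult f.map f.nondegenerate, ← multExt_toMult g.map g.nondegenerate]
    exact DFunLike.congr_fun (congrArg CStarUnitTr.Hom.map h) (toMult A.carrier a))

theorem funcUnit_faithful : (funcUnit wellDefined.{u}).Faithful where
  map_injective {A B f g} h := CStarNdTr.Hom.ext (NonUnitalStarAlgHom.ext fun a => by
    have h1 := DFunLike.congr_fun (congrArg (fun k => CStarUnitTr.Hom.map (CStarUnitInfTr.Hom.hom k))
      h) (a : Unitization ℂ A.carrier)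
    have h2 := congrArg (fun x : Unitization ℂ B.carrier => x.snd) h1
    exact (starMap_snd f.map _).symm.trans (h2.trans (starMap_snd g.map _)))

theorem unitInfToUnit_faithful : unitInfToUnit.{u}.Faithful where
  map_injective h := CStarUnitInfTr.Hom.ext h

theorem chptToCH_faithful : chptToCH.{u}.Faithful where
  map_injective h := CHptPrb.Hom.ext h

theorem funcAlex_faithful : (funcAlex wellDefined.{u}).Faithful where
  map_injective {X Y S T} h := LCHprPrb.Hom.ext (ContinuousMap.ext fun x => by
    have h1 := DFunLike.congr_fun (congrArg (fun k => CHPrb.Hom.map (CHptPrb.Hom.hom k)) h)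
      (x : OnePoint X.carrier)
    exact OnePoint.coe_injective h1)

theorem lchprToLCH_faithful : (lchprToLCH wellDefined.{u}).Faithful where
  map_injective h := LCHprPrb.Hom.ext (congrArg LCHPrb.Hom.map h)

theorem chToLCHpr_faithful : chToLCHpr.{u}.Faithful where
  map_injective h := CHPrb.Hom.ext (congrArg LCHprPrb.Hom.map h)

theorem chToLCHpr_full : chToLCHpr.{u}.Full where
  map_surjective {X Y} f := ⟨⟨f.map, fun E hE => by
    have h := f.preserves E (by rwa [baireC_eq_baireB] at hE)
    exact (RadonProb.cast_apply _ _ _).symm.trans (h.trans (RadonProb.cast_apply _ _ _))⟩, rfl⟩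

theorem chToLCH_faithful : chToLCH.{u}.Faithful where
  map_injective h := CHPrb.Hom.ext (congrArg LCHPrb.Hom.map h)

theorem chToLCH_full : chToLCH.{u}.Full where
  map_surjective f := ⟨⟨f.map, f.preserves⟩, rfl⟩

theorem eq_of_forall_bcf_eq {X : Type u} [TopologicalSpace X] [LocallyCompactSpace X] [T2Space X]
    {x y : X} (h : ∀ f : X →ᵇ ℂ, f x = f y) : x = y :=
  evSpec₀_injective (WeakDual.CharacterSpace.ext fun f => h f.toBCF)

theorem funcCb_faithful : funcCb.{u}.Faithful where
  map_injective {X Y S T} h := LCHPrb.Hom.ext (ContinuousMap.ext fun x =>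
    eq_of_forall_bcf_eq fun f => by
      have h1 : bcfComp S.map = bcfComp T.map :=
        congrArg (fun k : funcCb.obj X ⟶ funcCb.obj Y => CStarUnitTr.Hom.map k.unop) h
      have h2 := DFunLike.congr_fun h1 f
      exact DFunLike.congr_fun h2 x)

/-- The induced map takes evaluation at `x` to evaluation at the image of `x`, and bounded
continuous functions separate points. -/
theorem funcBeta_faithful : (funcBeta wellDefined.{u}).Faithful where
  map_injective {X Y S T} h := LCHPrb.Hom.ext (ContinuousMap.ext fun x =>
    eq_of_forall_bcf_eq fun f => by
      have h1 := DFunLike.congr_fun (congrArg CHPrb.Hom.map h) (evSpec X.carrier x)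
      exact congrArg (fun φ : Spec (Y.carrier →ᵇ ℂ) => φ f) h1)

end HorizontalFaithfulness

/-! ### The two diagrams. -/

section Diagrams

theorem RadonProb.integral_push {X K : Type u} [TopologicalSpace X] [TopologicalSpace K]
    [CompactSpace K] [T2Space K] {m : MeasurableSpace X} (μ : RadonProb X m) (T : X → K)
    (hT : Measurable[m, baireB K] T) (F : C(K, ℂ)) :
    ∫ y, F y ∂(μ.push wellDefined T hT).measure = ∫ x, F (T x) ∂μ.measure :=
  let _ : MeasurableSpace K := baireB K
  have hF : Measurable F := measurable_baireB (BoundedContinuousFunction.mkOfCompact F)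
  integral_map hT.aemeasurable hF.aestronglyMeasurable

theorem RadonProb.integral_cast {X : Type u} [TopologicalSpace X] {m m' : MeasurableSpace X}
    (h : m = m') (μ : RadonProb X m) (f : X → ℂ) :
    ∫ x, f x ∂(μ.cast h).measure = ∫ x, f x ∂μ.measure := by
  subst h
  rfl

/-- The measure is pushed forward from `X`, so only the values `c + f y` at finite points enter, and
the scalar integrates to itself. -/
theorem intC_push_unitizationEquiv {X : Type u} [TopologicalSpace X] [LocallyCompactSpace X]
    [T2Space X] (μ : RadonProb X (baireC X)) (x : Unitization ℂ C₀(X, ℂ)) :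
    intC (μ.push wellDefined (↑) (measurable_onePoint_coe X)) (unitizationEquiv X x) =
      unitState (intC0 le_rfl μ) x := by
  refine (μ.integral_push (↑) (measurable_onePoint_coe X) (unitizationEquiv X x)).trans ?_
  change ∫ y, (x.fst + x.snd y) ∂μ.measure = x.fst + ∫ y, x.snd y ∂μ.measure
  have hi : Integrable x.snd μ.measure :=
    Integrable.of_bound (measurable_zeroAtInfty x.snd).aestronglyMeasurable ‖x.snd‖
      (Eventually.of_forall (norm_zeroAtInfty_le x.snd))
  rw [integral_add (integrable_const _) hi]
  simp

theorem unitizationEquiv_onePointMap {X Y : Type u} [TopologicalSpace X] [T2Space X]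
    [TopologicalSpace Y] [T2Space Y] (T : C(X, Y)) (hT : ∀ K, IsCompact K → IsCompact (T ⁻¹' K))
    (x : Unitization ℂ C₀(Y, ℂ)) (p : OnePoint X) :
    unitizationEquiv Y x (OnePoint.map T p) =
      unitizationEquiv X (Unitization.starMap (c0Comp T hT) x) p := by
  rw [unitizationEquiv_apply, unitizationEquiv_apply, starMap_fst, starMap_snd]
  induction p using OnePoint.rec <;> rfl

/-- `C(X⁺)` is the unitization of `C₀(X)`. -/
def alexIso : funcAlex wellDefined.{u} ⋙ funcCpt ≅ funcC0pr ⋙ (funcUnit wellDefined).op :=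
  NatIso.ofComponents (fun X => (CStarUnitInfTr.isoOfIso
      (A := (funcUnit wellDefined).obj (funcC0pr.obj X).unop)
      (B := (funcCpt.obj ((funcAlex wellDefined).obj X)).unop)
      (CStarUnitTr.isoOfEquiv (unitizationEquiv X.carrier) (intC_push_unitizationEquiv X.prb))
      -- At infinity the extended function vanishes, so evaluation there is the scalar part.
      fun x => add_zero x.fst).op)
    fun T => Quiver.Hom.unop_inj (CStarUnitInfTr.Hom.ext (CStarUnitTr.Hom.ext
      (StarAlgHom.ext fun x => ContinuousMap.ext fun p =>
        unitizationEquiv_onePointMap T.map T.proper x p)))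

/-- The algebra `C₀(X)` carries the same state for the measure on `X` and for its extension. -/
def forgetObjIso (X : LCHprPrb.{u}) : (ndToMult wellDefined).obj (funcC0pr.obj X).unop ≅
    ((funcC0 wellDefined).obj ((lchprToLCH wellDefined).obj X)).unop :=
  CStarMultTr.isoOfEquiv
    (A := (ndToMult wellDefined).obj (funcC0pr.obj X).unop)
    (B := ((funcC0 wellDefined).obj ((lchprToLCH wellDefined).obj X)).unop)
    (StarAlgEquiv.refl ℂ C₀(X.carrier, ℂ))
    (integral_eq_of_baireC (wellDefined.extension X).choose_spec.1)

/-- The functors `C₀` are compatible with the forgetful functors. -/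
def forgetIso : lchprToLCH wellDefined.{u} ⋙ funcC0 wellDefined ≅
    funcC0pr ⋙ (ndToMult wellDefined).op :=
  NatIso.ofComponents (fun X => (forgetObjIso X).op)
    -- Both composites send `f` to multiplication by `f ∘ T`, a function which vanishes at infinity
    -- because `T` is proper.
    fun {X _} T => Quiver.Hom.unop_inj (CStarMultTr.Hom.ext (NonUnitalStarAlgHom.ext fun f =>
      (multExt_toMult _ _ _).trans ((bcfMult_toBCF (c0Comp T.map T.proper f)).trans
        (multExt_toMult (forgetObjIso X).hom.map (forgetObjIso X).hom.nondegenerate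
          (c0Comp T.map T.proper f)).symm)))

/-- `C_b(X)` is the multiplier algebra of `C₀(X)`. -/
def cbIsoMult : funcCb.{u} ≅ funcC0 wellDefined ⋙ (funcMult wellDefined).op :=
  (NatIso.ofComponents (fun X => (CStarUnitTr.isoOfEquiv
      (A := (funcCb.obj X).unop)
      (B := (funcMult wellDefined).obj ((funcC0 wellDefined).obj X).unop)
      (bcfMultEquiv X.carrier) (multState_bcfMult X.prb)).op)
    fun T => Quiver.Hom.unop_inj (CStarUnitTr.Hom.ext (StarAlgHom.ext fun h =>
      (multExt_c0MultComp T.map h))) :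
    funcC0 wellDefined ⋙ (funcMult wellDefined).op ≅ funcCb).symm

/-- `C_b(X)` is the algebra of continuous functions on the Stone–Čech compactification. -/
def cbIsoBeta : funcCb.{u} ≅ funcBeta wellDefined ⋙ funcC :=
  (NatIso.ofComponents (fun X => (CStarUnitTr.isoOfEquiv
      (A := (funcCb.obj X).unop)
      (B := (funcC.obj ((funcBeta wellDefined).obj X)).unop)
      (gelfandStarTransform (X.carrier →ᵇ ℂ)) (fun f : X.carrier →ᵇ ℂ =>
        X.prb.integral_push (evSpec X.carrier) (measurable_continuousMap _) (gelfandStarTransform (X.carrier →ᵇ ℂ) f))).op)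
    fun _ => rfl : funcBeta wellDefined ⋙ funcC ≅ funcCb).symm

/-- A square of functors which commutes with the functors `F` of two dualities also commutes with
the functors `G`. -/
def mateIso {C D C' D' : Type*} [Category* C] [Category* D] [Category* C'] [Category* D']
    {F : C ⥤ D} {G : D ⥤ C} {F' : C' ⥤ D'} {G' : D' ⥤ C'} (ε : G ⋙ F ≅ 𝟭 D)
    (η : 𝟭 C' ≅ F' ⋙ G') {K : C ⥤ C'} {L : D ⥤ D'} (e : K ⋙ F' ≅ F ⋙ L) : G ⋙ K ≅ L ⋙ G' :=
  -- The chain is `GK ≅ GKF'G' ≅ GFLG' ≅ LG'`, in diagrammatic order.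
  (G ⋙ K).rightUnitor.symm ≪≫ Functor.isoWhiskerLeft (G ⋙ K) η ≪≫
    Functor.isoWhiskerLeft G (Functor.isoWhiskerRight e G') ≪≫
    Functor.isoWhiskerRight ε (L ⋙ G')

/-- For compact `X` the algebra `C(X)` coincides with `C₀(X)`. -/
def zeroAtInftyEquiv (X : Type u) [TopologicalSpace X] [CompactSpace X] :
    C(X, ℂ) ≃⋆ₐ[ℂ] C₀(X, ℂ) where
  toFun f := ⟨f, by rw [cocompact_eq_bot]; exact tendsto_bot⟩
  invFun f := f.toContinuousMap
  left_inv _ := rfl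
  right_inv _ := rfl
  map_mul' _ _ := rfl
  map_add' _ _ := rfl
  map_smul' _ _ := rfl
  map_star' _ := rfl

/-- For compact spaces the functors `C` and `C₀` coincide. -/
def compactIso : chToLCHpr.{u} ⋙ funcC0pr ≅ funcC ⋙ unitToNd.op :=
  NatIso.ofComponents (fun X => (CStarNdTr.isoOfEquiv
      (A := unitToNd.obj (funcC.obj X).unop)
      (B := (funcC0pr.obj (chToLCHpr.obj X)).unop)
      (zeroAtInftyEquiv X.carrier) (fun f : C(X.carrier, ℂ) =>
        X.prb.integral_cast baireC_eq_baireB f)).op)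
    fun _ => rfl

/-- The forgetful functors of compact spaces are compatible. -/
def chToLCHIso : chToLCH.{u} ≅ chToLCHpr ⋙ lchprToLCH wellDefined :=
  NatIso.ofComponents (fun X => LCHPrb.isoOfHomeo
      (Y := (lchprToLCH wellDefined).obj (chToLCHpr.obj X)) (Homeomorph.refl X.carrier)
      fun E hE => by
        -- On a compact space the two `σ`-algebras coincide, so the extension agrees with the
        -- original measure on every Baire set.
        have h := (wellDefined.extension (chToLCHpr.obj X)).choose_spec.1 E
          ((baireC_eq_baireB (X := X.carrier)).le E hE)
        exact (RadonProb.cast_apply _ _ _).symm.trans h.symm)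
    fun _ => rfl

/-- For compact spaces the functors `C` and `C₀` coincide, with values in `CStarMultTr`. -/
def compactMultIso : chToLCH.{u} ⋙ funcC0 wellDefined ≅ funcC ⋙ (unitToMult wellDefined).op :=
  Functor.isoWhiskerRight chToLCHIso (funcC0 wellDefined) ≪≫
    Functor.isoWhiskerLeft chToLCHpr forgetIso ≪≫
    Functor.isoWhiskerRight compactIso (ndToMult wellDefined).op

end Diagrams

end

end RieszDuality

theorem theorem5p8 :
    -- the functors below are well defined
    ∃ H : WellDefined.{u},
    -- the vertical functors are full and faithful
    ((funcCpt.{u}.Full ∧ funcCpt.{u}.Faithful) ∧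
      ((rieszUnitInf H).Full ∧ (rieszUnitInf H).Faithful) ∧
      (funcC.{u}.Full ∧ funcC.{u}.Faithful) ∧
      ((rieszUnit H).Full ∧ (rieszUnit H).Faithful) ∧
      (funcC0pr.{u}.Full ∧ funcC0pr.{u}.Faithful) ∧
      ((rieszNd H).Full ∧ (rieszNd H).Faithful) ∧
      ((funcC0 H).Full ∧ (funcC0 H).Faithful) ∧
      ((rieszMult H).Full ∧ (rieszMult H).Faithful)) ∧
    -- the functors between the algebra categories are faithful, and two of them are full
    ((funcUnit H).Faithful ∧ (ndToMult H).Faithful ∧ (funcMult H).Faithful ∧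
      unitInfToUnit.{u}.Faithful ∧
      (unitToNd.{u}.Full ∧ unitToNd.{u}.Faithful) ∧
      ((unitToMult H).Full ∧ (unitToMult H).Faithful)) ∧
    -- the functors between the categories of spaces, and the diagonal functor `C_b`
    ((funcAlex H).Faithful ∧ (lchprToLCH H).Faithful ∧ (funcBeta H).Faithful ∧
      funcCb.{u}.Faithful ∧ chptToCH.{u}.Faithful ∧
      (chToLCHpr.{u}.Full ∧ chToLCHpr.{u}.Faithful) ∧
      (chToLCH.{u}.Full ∧ chToLCH.{u}.Faithful)) ∧
    -- the four dualities
    (IsDuality funcCpt (rieszUnitInf H) ∧ IsDuality funcC (rieszUnit H) ∧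
      IsDuality funcC0pr (rieszNd H) ∧ IsDuality (funcC0 H) (rieszMult H)) ∧
    -- the diagram of `Unit`, `Mult`, `Alex`, `β` and `C_b` commutes up to natural isomorphism
    (Nonempty (funcAlex H ⋙ funcCpt ≅ funcC0pr ⋙ (funcUnit H).op) ∧
      Nonempty (rieszNd H ⋙ funcAlex H ≅ (funcUnit H).op ⋙ rieszUnitInf H) ∧
      Nonempty (lchprToLCH H ⋙ funcC0 H ≅ funcC0pr ⋙ (ndToMult H).op) ∧
      Nonempty (rieszNd H ⋙ lchprToLCH H ≅ (ndToMult H).op ⋙ rieszMult H) ∧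
      Nonempty (funcBeta H ⋙ funcC ≅ funcC0 H ⋙ (funcMult H).op) ∧
      Nonempty (rieszMult H ⋙ funcBeta H ≅ (funcMult H).op ⋙ rieszUnit H) ∧
      Nonempty (funcCb ≅ funcC0 H ⋙ (funcMult H).op) ∧
      Nonempty (funcCb ≅ funcBeta H ⋙ funcC) ∧
      Nonempty (rieszMult H ⋙ funcCb ≅ (funcMult H).op) ∧
      Nonempty (funcCb ⋙ rieszUnit H ≅ funcBeta H)) ∧
    -- the diagram of forgetful functors commutes up to natural isomorphism
    (Nonempty (chptToCH ⋙ funcC ≅ funcCpt ⋙ unitInfToUnit.op) ∧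
      Nonempty (rieszUnitInf H ⋙ chptToCH ≅ unitInfToUnit.op ⋙ rieszUnit H) ∧
      Nonempty (chToLCHpr ⋙ funcC0pr ≅ funcC ⋙ unitToNd.op) ∧
      Nonempty (rieszUnit H ⋙ chToLCHpr ≅ unitToNd.op ⋙ rieszNd H) ∧
      Nonempty (lchprToLCH H ⋙ funcC0 H ≅ funcC0pr ⋙ (ndToMult H).op) ∧
      Nonempty (rieszNd H ⋙ lchprToLCH H ≅ (ndToMult H).op ⋙ rieszMult H) ∧
      Nonempty (chToLCH ⋙ funcC0 H ≅ funcC ⋙ (unitToMult H).op) ∧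
      Nonempty (rieszUnit H ⋙ chToLCH ≅ (unitToMult H).op ⋙ rieszMult H) ∧
      Nonempty (unitToMult H ≅ unitToNd ⋙ ndToMult H) ∧
      Nonempty (chToLCH ≅ chToLCHpr ⋙ lchprToLCH H)) := by
  obtain ⟨hC, hR⟩ := isDuality_funcC.full_faithful
  obtain ⟨hCpt, hRpt⟩ := isDuality_funcCpt.full_faithful
  obtain ⟨hC0pr, hRpr⟩ := isDuality_funcC0pr.full_faithful
  obtain ⟨hC0, hRm⟩ := isDuality_funcC0.full_faithful
  -- Both sides of the Stone–Čech square are compared with the diagonal functor `C_b`.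
  have betaIso := cbIsoBeta.symm ≪≫ cbIsoMult
  refine ⟨wellDefined, ⟨hCpt, hRpt, hC, hR, hC0pr, hRpr, hC0, hRm⟩,
    ⟨funcUnit_faithful, ndToMult_faithful, funcMult_faithful, unitInfToUnit_faithful,
      ⟨unitToNd_full, unitToNd_faithful⟩, ⟨unitToMult_full, unitToMult_faithful⟩⟩,
    ⟨funcAlex_faithful, lchprToLCH_faithful, funcBeta_faithful, funcCb_faithful, chptToCH_faithful,
      ⟨chToLCHpr_full, chToLCHpr_faithful⟩, ⟨chToLCH_full, chToLCH_faithful⟩⟩,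
    ⟨isDuality_funcCpt, isDuality_funcC, isDuality_funcC0pr, isDuality_funcC0⟩,
    ⟨⟨alexIso⟩, ⟨mateIso counitIsoC0pr unitIsoCpt alexIso⟩, ⟨forgetIso⟩,
      ⟨mateIso counitIsoC0pr unitIsoC0 forgetIso⟩, ⟨betaIso⟩,
      ⟨mateIso counitIsoC0 unitIsoC betaIso⟩, ⟨cbIsoMult⟩, ⟨cbIsoBeta⟩,
      ⟨Functor.isoWhiskerLeft (rieszMult wellDefined) cbIsoMult ≪≫
        Functor.isoWhiskerRight counitIsoC0 (funcMult wellDefined).op⟩,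
      ⟨Functor.isoWhiskerRight cbIsoBeta (rieszUnit wellDefined) ≪≫
        Functor.isoWhiskerLeft (funcBeta wellDefined) unitIsoC.symm⟩⟩,
    -- The squares that forget the distinguished point commute on the nose, as does the triangle of
    -- forgetful functors from unital algebras.
    ⟨⟨Iso.refl _⟩, ⟨Iso.refl _⟩, ⟨compactIso⟩, ⟨mateIso counitIsoC unitIsoC0pr compactIso⟩,
      ⟨forgetIso⟩, ⟨mateIso counitIsoC0pr unitIsoC0 forgetIso⟩, ⟨compactMultIso⟩,
      ⟨mateIso counitIsoC unitIsoC0 compactMultIso⟩, ⟨Iso.refl _⟩, ⟨chToLCHIso⟩⟩⟩
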